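/- Let $K$ be a field of characteristic different from $2$ and $3$, and let $C/K$ be a projective nonsingular (geometrically irreducible) curve of genus one. Let $w,u$ be involutions of $C$ defined over $K$ such that $C/\langle w\rangle\simeq\mathbb{P}^1_K$, the quotient $C/\langle u\rangle$ has genus $0$, and $u\cdot w$ is an involution (that is, $(u\cdot w)^2=\mathrm{id}$) such that $C'=C/\langle u\cdot w\rangle$ has genus $1$. Let $L=K(\sqrt d)$, $d\in K$, be a quadratic extension of $K$, let $\sigma$ be the nontrivial element of $\operatorname{Gal}(L/K)$, and suppose that there is a point $P\in C(L)\setminus C(K)$ with $w(P)={}^{\sigma}P$ and $u(P)=P$. An equation $y^2=f(x)$, with $f\in K[X]$ of degree $3$ or $4$ without double roots, is called an equation over $K$ for a curve with function field $M$ if $M=K(x,y)$ for some $x,y\in M$ with $y^2=f(x)$. Suppose that $V^2=U^3+A'U+B'$, with $A',B'\in K$ and $4A'^3+27B'^2\neq0$, is an equation over $K$ for $C'$, and regard $C'$ as the elliptic curve given by this equation. Let $\mathcal{R}$ be the set of the roots $u_0\in K$ of $U^3+A'U+B'$ such that the elliptic curve $C'/\langle(u_0,0)\rangle$ is isomorphic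 over $K$ to the Jacobian $\operatorname{Jac}(C)$ of $C$. Then: (a) There is a $u_0\in\mathcal{R}$ such that $$y^2=d\,x^4+3u_0\,x^2+\frac{A'+3u_0^2}{d}$$ is an equation over $K$ for $C$. (b) In particular, if $\mathcal{R}$ has only one element $u_0$, then the displayed equation with this $u_0$ is an equation over $K$ for $C$. -/

import Mathlib

/-! A projective nonsingular curve `C` over a field `K` is represented by its function field
`F = K(C)`; nonconstant `K`-morphisms of curves are `K`-embeddings of function fields in the
opposite direction.  An automorphism `v` of `C` over `K` is represented by its pull-back
`f ↦ f ∘ v`, which is an element of `Gal(F/K)`, and the function field of the quotient curve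
`C/⟨v⟩` is the fixed field of that element. -/

namespace GenusOne

open Polynomial IntermediateField

section Curves

variable (K F : Type*) [Field K] [Field F] [Algebra K F]

/-- `F` is the function field of a (geometrically irreducible) curve over `K`: it is finitely
generated of transcendence degree one, and `K` is algebraically closed in `F`. -/
structure IsCurve : Prop where
  exists_finite : ∃ x : F, Transcendental K x ∧ FiniteDimensional K⟮x⟯ F
  algClosed : algebraicClosure K F = ⊥

/-- A closed point of the curve with function field `F`, given by its local ring: a valuation ring
of `F` that contains `K` and is different from `F`. -/
@[ext]
structure Place where
  ring : ValuationSubring F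
  algebraMap_mem : ∀ a : K, algebraMap K F a ∈ ring
  ne_top : ring ≠ ⊤

variable {K F}

/-- The inclusion of the constants in the local ring of a closed point. -/
def Place.constants (P : Place K F) : K →+* P.ring :=
  (algebraMap K F).codRestrict P.ring.toSubring P.algebraMap_mem

/-- The degree over `K` of a closed point: the dimension over `K` of its residue field. -/
noncomputable def Place.degree (P : Place K F) : ℕ :=
  letI : Algebra K P.ring := P.constants.toAlgebra
  Module.finrank K (IsLocalRing.ResidueField P.ring)

/-- `t` is a uniformizer at `P`: it generates the maximal ideal of the local ring at `P`. -/
def Place.IsUniformizer (P : Place K F) (t : F) : Prop :=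
  t ≠ 0 ∧ ∀ z : F, z ∈ P.ring.nonunits ↔ z * t⁻¹ ∈ P.ring

/-- `ord_P f ≥ n`, that is, `f * t ^ (-n)` is regular at `P` for a uniformizer `t` at `P`. -/
def Place.OrdGE (P : Place K F) (n : ℤ) (f : F) : Prop :=
  ∀ t : F, P.IsUniformizer t → f * t ^ (-n) ∈ P.ring

/-- The degree of a divisor. -/
noncomputable def divisorDegree (D : Place K F →₀ ℤ) : ℤ :=
  D.sum fun P n => n * (P.degree : ℤ)

/-- The Riemann–Roch space `{f | f = 0 or div f ≥ -D}` of a divisor `D`. -/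
def riemannRochSpace (D : Place K F →₀ ℤ) : Submodule K F where
  carrier := {f | ∀ P : Place K F, P.OrdGE (-D P) f}
  zero_mem' := by
    intro P t _
    simp
  add_mem' := by
    intro f g hf hg P t ht
    rw [add_mul]
    exact P.ring.add_mem _ _ (hf P t ht) (hg P t ht)
  smul_mem' := by
    intro a f hf P t ht
    rw [Algebra.smul_def, mul_assoc]
    exact P.ring.mul_mem _ _ (P.algebraMap_mem a) (hf P t ht)

variable (K F)

/-- The curve with function field `F` has genus `g`: `g` is the maximum over all divisors `D` of
`deg D - ℓ(D) + 1`. -/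
def HasGenus (g : ℕ) : Prop :=
  IsGreatest (Set.range fun D : Place K F →₀ ℤ =>
    divisorDegree D - (Module.finrank K (riemannRochSpace D) : ℤ) + 1) (g : ℤ)

variable {K F}

/-- The function field of the quotient curve `C/⟨v⟩`. -/
abbrev quotientField (v : F ≃ₐ[K] F) : IntermediateField K F :=
  fixedField (Subgroup.zpowers v)

/-- `v ∈ I_i(C)` and `v` is defined over `K`: `v` is an automorphism of `C` over `K` with
`v² = id` and `C/⟨v⟩` has genus `i`. -/
def IsInvolution (i : ℕ) (v : F ≃ₐ[K] F) : Prop :=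
  v ^ 2 = 1 ∧ HasGenus K (quotientField v) i

variable (K F)

/-- `y² = f(x)` is an equation over `K` for the curve with function field `F`: `f` has degree `3`
or `4` and no double roots, and `F = K(x, y)` for some `x, y ∈ F` with `y² = f(x)`. -/
def IsEquation (f : K[X]) : Prop :=
  (f.natDegree = 3 ∨ f.natDegree = 4) ∧ f.Separable ∧
    ∃ x y : F, y ^ 2 = aeval x f ∧ adjoin K {x, y} = ⊤

/-- An `L`-valued point `P ∈ C(L)` of the curve with function field `F`, for a field extension
`L/K`, given by the values `f(P) ∈ L ∪ {∞}` of the functions `f ∈ F` at `P`: the functions with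
`f(P) ≠ ∞` form a ring on which `f ↦ f(P)` is a homomorphism of `K`-algebras, `f(P) = ∞` implies
`(1/f)(P) = 0`, and some function has a pole at `P`. -/
@[ext]
structure CurvePoint (L : Type*) [Field L] [Algebra K L] where
  eval : F → OnePoint L
  eval_algebraMap : ∀ a : K, eval (algebraMap K F a) = ((algebraMap K L a : L) : OnePoint L)
  eval_add : ∀ (f g : F) (a b : L), eval f = (a : OnePoint L) → eval g = (b : OnePoint L) →
    eval (f + g) = ((a + b : L) : OnePoint L)
  eval_mul : ∀ (f g : F) (a b : L), eval f = (a : OnePoint L) → eval g = (b : OnePoint L) →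
    eval (f * g) = ((a * b : L) : OnePoint L)
  eval_inv : ∀ f : F, eval f = OnePoint.infty → eval f⁻¹ = ((0 : L) : OnePoint L)
  exists_pole : ∃ f : F, eval f = OnePoint.infty

variable {K F} {L : Type*} [Field L] [Algebra K L]

/-- The image `v(P)` of a point, where `v` is given by its pull-back: `f(v(P)) = (f ∘ v)(P)`. -/
def CurvePoint.image (v : F ≃ₐ[K] F) (P : CurvePoint K F L) : CurvePoint K F L where
  eval f := P.eval (v f)
  eval_algebraMap a := by rw [v.commutes, P.eval_algebraMap]
  eval_add f g a b hf hg := by rw [map_add]; exact P.eval_add _ _ _ _ hf hg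
  eval_mul f g a b hf hg := by rw [map_mul]; exact P.eval_mul _ _ _ _ hf hg
  eval_inv f hf := by rw [map_inv₀]; exact P.eval_inv _ hf
  exists_pole := by
    obtain ⟨f, hf⟩ := P.exists_pole
    exact ⟨v.symm f, by rwa [v.apply_symm_apply]⟩

/-- The Galois conjugate `σP` of a point. -/
def CurvePoint.conj (σ : L ≃ₐ[K] L) (P : CurvePoint K F L) : CurvePoint K F L where
  eval f := OnePoint.map σ (P.eval f)
  eval_algebraMap a := by rw [P.eval_algebraMap, OnePoint.map_some, σ.commutes]
  eval_add f g a b hf hg := by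
    have key : ∀ (h : F) (c : L), OnePoint.map σ (P.eval h) = (c : OnePoint L) →
        P.eval h = ((σ.symm c : L) : OnePoint L) := by
      intro h c hc
      induction hx : P.eval h using OnePoint.rec with
      | infty => rw [hx, OnePoint.map_infty] at hc; exact absurd hc (OnePoint.infty_ne_coe c)
      | coe x => rw [hx, OnePoint.map_some, OnePoint.coe_eq_coe] at hc; simp [← hc]
    rw [P.eval_add f g _ _ (key f a hf) (key g b hg), OnePoint.map_some]
    simp
  eval_mul f g a b hf hg := by
    have key : ∀ (h : F) (c : L), OnePoint.map σ (P.eval h) = (c : OnePoint L) →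
        P.eval h = ((σ.symm c : L) : OnePoint L) := by
      intro h c hc
      induction hx : P.eval h using OnePoint.rec with
      | infty => rw [hx, OnePoint.map_infty] at hc; exact absurd hc (OnePoint.infty_ne_coe c)
      | coe x => rw [hx, OnePoint.map_some, OnePoint.coe_eq_coe] at hc; simp [← hc]
    rw [P.eval_mul f g _ _ (key f a hf) (key g b hg), OnePoint.map_some]
    simp
  eval_inv f hf := by
    have : P.eval f = OnePoint.infty := by
      induction hx : P.eval f using OnePoint.rec with
      | infty => rfl
      | coe x => rw [hx, OnePoint.map_some] at hf; exact absurd hf (OnePoint.coe_ne_infty _)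
    rw [P.eval_inv f this, OnePoint.map_some, map_zero]
  exists_pole := by
    obtain ⟨f, hf⟩ := P.exists_pole
    exact ⟨f, by rw [hf, OnePoint.map_infty]⟩

/-- `P ∈ C(L)` lies in `C(K)`: all its finite values are in `K`. -/
def CurvePoint.IsRational (P : CurvePoint K F L) : Prop :=
  ∀ (f : F) (a : L), P.eval f = (a : OnePoint L) → a ∈ (algebraMap K L).range

end Curves

section Elliptic

open WeierstrassCurve WeierstrassCurve.Affine

variable {K : Type*} [Field K]

/-- The function `x` on a Weierstrass curve. -/
noncomputable def xFun (W : Affine K) : W.FunctionField :=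
  algebraMap W.CoordinateRing W.FunctionField (CoordinateRing.mk W (C X))

/-- The function `y` on a Weierstrass curve. -/
noncomputable def yFun (W : Affine K) : W.FunctionField :=
  algebraMap W.CoordinateRing W.FunctionField (CoordinateRing.mk W X)

lemma equation_xFun_yFun (W : Affine K) :
    (W.baseChange W.FunctionField).Equation (xFun W) (yFun W) := by
  have h : CoordinateRing.mk W W.polynomial = 0 := AdjoinRoot.mk_self
  have h' := congrArg (algebraMap W.CoordinateRing W.FunctionField) h
  have hC : ∀ a : K, algebraMap K W.FunctionField a =
      algebraMap W.CoordinateRing W.FunctionField (CoordinateRing.mk W (C (C a))) := fun a => rfl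
  rw [equation_iff]
  simp only [WeierstrassCurve.Affine.baseChange, WeierstrassCurve.baseChange,
    WeierstrassCurve.map_a₁, WeierstrassCurve.map_a₂, WeierstrassCurve.map_a₃,
    WeierstrassCurve.map_a₄, WeierstrassCurve.map_a₆, xFun, yFun, hC]
  simp only [WeierstrassCurve.Affine.polynomial, map_sub, map_add, map_mul, map_pow, map_zero] at h'
  linear_combination h'

/-- The generic point `(x, y)` of an elliptic curve `W`, as a point over its function field. -/
noncomputable def genericPoint (W : Affine K) [W.IsElliptic] :
    (W.baseChange W.FunctionField).Point :=
  haveI : (W.baseChange W.FunctionField).IsElliptic :=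
    inferInstanceAs (WeierstrassCurve.map W (algebraMap K W.FunctionField)).IsElliptic
  .mk (equation_xFun_yFun W)

open scoped Classical in
/-- `α` is the (pull-back of the) translation by the point `T ∈ W(K)` on the elliptic curve `W`:
it sends the generic point `η` to `η + T`. -/
def IsTranslation (W : Affine K) [W.IsElliptic] (T : (W.baseChange K).Point)
    (α : W.FunctionField ≃ₐ[K] W.FunctionField) : Prop :=
  Point.map (W' := W) (α : W.FunctionField →ₐ[K] W.FunctionField) (genericPoint W) =
    genericPoint W + Point.map (W' := W) (Algebra.ofId K W.FunctionField) T

/-- The elliptic curve `E` is isomorphic over `K` to the quotient `W/⟨T⟩` of the elliptic curve `W`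
by the subgroup generated by `T ∈ W(K)`: the function field of `E` is isomorphic over `K` to
the subfield of functions on `W` that are invariant under translation by `T`. -/
def IsQuotientBy (W : Affine K) [W.IsElliptic] (T : (W.baseChange K).Point) (E : Affine K) :
    Prop :=
  ∃ α : W.FunctionField ≃ₐ[K] W.FunctionField, IsTranslation W T α ∧
    Nonempty (E.FunctionField ≃ₐ[K] quotientField α)

open scoped Classical in
/-- The elliptic curve `E/K` is the Jacobian of the genus one curve `C/K` with function field `F`,
that is, `C` is a twist of `E` by translations (a principal homogeneous space under `E`).  With
`Kˢ` the separable closure of `K`, there is an isomorphism `φ : C → E` over `Kˢ` such that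
`φ^τ ∘ φ⁻¹` is the translation by some point of `E(Kˢ)`, for every `τ` in the Galois group.

Here `φ` is given by its coordinates `x, y`, a point of `E` over `F·Kˢ` that generates `F·Kˢ` over
`Kˢ`; the Galois group of `Kˢ/K` is that of `F·Kˢ/F`, whose elements are the restrictions of the
automorphisms of an algebraic closure of `F` over `F`. -/
def IsJacobian (E : Affine K) (F : Type*) [Field F] [Algebra K F] : Prop :=
  ∃ (x y : AlgebraicClosure F) (h : (E.baseChange (AlgebraicClosure F)).Nonsingular x y),
    adjoin (separableClosure K (AlgebraicClosure F)) {x, y} =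
      adjoin (separableClosure K (AlgebraicClosure F))
        (Set.range (algebraMap F (AlgebraicClosure F))) ∧
    ∀ τ : AlgebraicClosure F ≃ₐ[F] AlgebraicClosure F,
      ∃ Q : (E.baseChange (separableClosure K (AlgebraicClosure F))).Point,
        Point.map (W' := E)
            (τ.restrictScalars K : AlgebraicClosure F →ₐ[K] AlgebraicClosure F) (.some x y h) =
          .some x y h + Point.map (W' := E) (separableClosure K (AlgebraicClosure F)).val Q

/-- The curve `V² = U³ + A U + B`. -/
def shortWeierstrass (A B : K) : Affine K := ⟨0, 0, 0, A, B⟩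

/-- `u₀` is a root of `U³ + A U + B` and the quotient of the elliptic curve `V² = U³ + A U + B` by
the subgroup generated by its point `(u₀, 0)` is isomorphic over `K` to the Jacobian of the curve
with function field `F`. -/
def IsJacobianRoot (F : Type*) [Field F] [Algebra K F] (A B : K)
    [(shortWeierstrass A B).IsElliptic] (u₀ : K) : Prop :=
  u₀ ^ 3 + A * u₀ + B = 0 ∧
    ∃ (h : ((shortWeierstrass A B).baseChange K).Nonsingular u₀ 0) (E : Affine K),
      E.IsElliptic ∧ IsQuotientBy (shortWeierstrass A B) (.some u₀ 0 h) E ∧ IsJacobian E F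

end Elliptic

end GenusOne

/-! The fixed field of `w` is rational, say `K(x)`, so `F = K(x, y)` with `y² = f(x)`, `f`
squarefree and `w y = -y`. Because `w` sends `P` to its conjugate, the image of `P` on the line
`C/⟨w⟩` is `K`-rational, and `x` can be chosen to have its pole at `P`. As `u` commutes with `w` and
fixes `P`, it acts on `x` by an affine involution, which becomes `x ↦ -x` after a shift. Hence `f`
is even, of degree `2m`. The value `β` of `y/xᵐ` at `P` satisfies `β² = lc(f)` and `σβ = -β`, so `β
∈ K·√d`, and rescaling `y` makes `d` the leading coefficient. From `u(P) = P` follows `u y = (-1)ᵐ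
y`. This is `exists_normalForm`.

Functions with poles only at `P` show that genus one forces `m ≤ 2`
(`IsModel.le_two_of_hasGenus_one`). If `m = 0`, then `y` is a constant, against `w y = -y`. If `m =
1`, then `C'` has function field `K(y)`, which carries no cubic model (`not_isModel_cubic_ratFunc`).
So `y² = d x⁴ + 3u₀ x² + c`, and `u·w` is `(x, y) ↦ (-x, -y)`.

The invariants `d x² + u₀` and `d x y` generate the function field of `C'` and satisfy a short
Weierstrass equation with root `u₀` and linear coefficient `dc - 3u₀²`
(`exists_isModel_quotientField`). By `IsModel.scaling` it differs from the given equation by factors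
`k⁴, k⁶`; the substitution `(kx, k²y)` absorbs them and replaces `u₀` by `k²u₀`.

It remains to see that this root lies in `ℛ`. With `b = 3u₀` and `e = A' + 3u₀²`, the curve `Y² = X³
- 2bX² + (b² - 4e)X` is the quotient of `C'` by `(u₀, 0)` (`isQuotientBy_isogenousCurve`), and it is
also the Jacobian of `y² = d x⁴ + b x² + e/d`, by an isomorphism over `K(√d)` whose conjugate
differs from it by translation by `(0, 0)` (`isJacobian_isogenousCurve`). -/

namespace GenusOne

open Polynomial IntermediateField

/-! ### Function fields `K(x, y)` with `y² = f(x)`: normal forms and regular functions -/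

section Quadratic

variable {K F : Type*} [Field K] [Field F] [Algebra K F]

lemma mem_quotientField {v : F ≃ₐ[K] F} {h : F} : h ∈ quotientField v ↔ v h = h := by
  rw [mem_fixedField_iff]
  constructor
  · exact fun H => H v (Subgroup.mem_zpowers v)
  · intro H f hf
    have : Subgroup.zpowers v ≤ MulAction.stabilizer (F ≃ₐ[K] F) h := by
      rw [Subgroup.zpowers_le]
      exact H
    exact this hf

/-- The function field of the curve `y² = f(x)`, with its generators. -/
structure IsModel (f : K[X]) (x y : F) : Prop where
  transcendental : Transcendental K x
  sq : y ^ 2 = aeval x f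
  adjoin_eq_top : adjoin K {x, y} = ⊤

lemma aeval_ne_zero {x : F} (hx : Transcendental K x) {p : K[X]} (hp : p ≠ 0) :
    aeval x p ≠ 0 := fun h => hx ⟨p, hp, h⟩

lemma aeval_inj {x : F} (hx : Transcendental K x) {p q : K[X]} (h : aeval x p = aeval x q) :
    p = q := transcendental_iff_injective.mp hx h

lemma exists_coprime_factor (p : K[X]) {s : K[X]} (hs : s ≠ 0) :
    ∃ g p' s' : K[X], g ≠ 0 ∧ p = g * p' ∧ s = g * s' ∧ s' ≠ 0 ∧ IsCoprime p' s' := by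
  classical
  obtain ⟨p', hp⟩ := EuclideanDomain.gcd_dvd_left p s
  obtain ⟨s', hs'⟩ := EuclideanDomain.gcd_dvd_right p s
  have hg : EuclideanDomain.gcd p s ≠ 0 := fun h => hs (EuclideanDomain.gcd_eq_zero_iff.mp h).2
  refine ⟨_, p', s', hg, hp, hs', ?_, ?_⟩
  · rintro rfl
    exact hs (by rw [hs', mul_zero])
  · refine ⟨EuclideanDomain.gcdA p s, EuclideanDomain.gcdB p s, mul_left_cancel₀ hg ?_⟩
    have := EuclideanDomain.gcd_eq_gcd_ab p s
    linear_combination - this - EuclideanDomain.gcdA p s * hp - EuclideanDomain.gcdB p s * hs'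

lemma exists_repr_of_mem_adjoin_simple {x : F} (hx : Transcendental K x) {h : F}
    (hh : h ∈ adjoin K {x}) :
    ∃ p r : K[X], r ≠ 0 ∧ IsCoprime p r ∧ h * aeval x r = aeval x p := by
  obtain ⟨p, s, rfl⟩ := (mem_adjoin_simple_iff K h).mp hh
  by_cases hs : s = 0
  · exact ⟨0, 1, one_ne_zero, isCoprime_one_right, by simp [hs]⟩
  obtain ⟨g, p', s', hg, rfl, rfl, hs', hc⟩ := exists_coprime_factor p hs
  refine ⟨p', s', hs', hc, ?_⟩
  have h1 := aeval_ne_zero hx hg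
  have h2 := aeval_ne_zero hx hs'
  simp only [map_mul]
  field_simp

/-- After division by the gcd, the square of the rest of `r` is coprime to that of `q`, so it
divides `f` and must be a unit. -/
lemma squarefree_dvd {f q r : K[X]} (hf : Squarefree f) (h : r ^ 2 ∣ q ^ 2 * f) : r ∣ q := by
  by_cases hr : r = 0
  · subst hr
    have : q ^ 2 * f = 0 := by simpa using h
    rcases mul_eq_zero.mp this with h | h
    · simp [pow_eq_zero_iff] at h; simp [h]
    · exact absurd h hf.ne_zero
  obtain ⟨g, q', r', hg, rfl, rfl, hr', hc⟩ := exists_coprime_factor q hr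
  have h1 : r' ^ 2 ∣ q' ^ 2 * f := by
    refine (mul_dvd_mul_iff_left (pow_ne_zero 2 hg)).mp ?_
    convert h using 1 <;> ring
  have h2 : r' * r' ∣ f := by
    rw [← sq]
    exact (hc.symm.pow (m := 2) (n := 2)).dvd_of_dvd_mul_left h1
  obtain ⟨c, hc⟩ := (hf r' h2).exists_right_inv
  exact ⟨c * q', by linear_combination - g * q' * hc⟩

lemma IsModel.exists_repr {f : K[X]} {x y : F} (H : IsModel f x y) (h : F) :
    ∃ p q r : K[X], r ≠ 0 ∧ h * aeval x r = aeval x p + aeval x q * y := by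
  have hx := H.transcendental
  have hy := H.sq
  have h0 : h ∈ adjoin K {x, y} := by rw [H.adjoin_eq_top]; trivial
  induction h0 using adjoin_induction with
  | mem z hz =>
    rcases hz with rfl | rfl
    · exact ⟨X, 0, 1, one_ne_zero, by simp⟩
    · exact ⟨0, 1, 1, one_ne_zero, by simp⟩
  | algebraMap a => exact ⟨C a, 0, 1, one_ne_zero, by simp⟩
  | add a b _ _ ha hb =>
    obtain ⟨p, q, r, hr, e⟩ := ha
    obtain ⟨p', q', r', hr', e'⟩ := hb
    refine ⟨p * r' + p' * r, q * r' + q' * r, r * r', mul_ne_zero hr hr', ?_⟩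
    simp only [map_mul, map_add]
    linear_combination aeval x r' * e + aeval x r * e'
  | mul a b _ _ ha hb =>
    obtain ⟨p, q, r, hr, e⟩ := ha
    obtain ⟨p', q', r', hr', e'⟩ := hb
    refine ⟨p * p' + q * q' * f, p * q' + q * p', r * r', mul_ne_zero hr hr', ?_⟩
    simp only [map_mul, map_add]
    linear_combination b * aeval x r' * e + (aeval x p + aeval x q * y) * e' +
      aeval x q * aeval x q' * hy
  | inv a _ ha =>
    obtain ⟨p, q, r, hr, e⟩ := ha
    by_cases ha0 : a = 0
    · exact ⟨0, 0, 1, one_ne_zero, by simp [ha0]⟩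
    have hr0 := aeval_ne_zero hx hr
    -- A model may have `y ∈ K(x)`, so the norm of a nonzero element can vanish. In that case `p = q
    -- y` and the element is `2p/r`; otherwise it is inverted by its conjugate.
    by_cases hN : p ^ 2 - q ^ 2 * f = 0
    · have hN' := congrArg (aeval x) hN
      simp only [map_sub, map_mul, map_pow, map_zero, ← hy] at hN'
      have : (aeval x p + aeval x q * y) * (aeval x p - aeval x q * y) = 0 := by
        linear_combination hN'
      rw [← e] at this
      have h1 : aeval x p = aeval x q * y := by
        have := (mul_eq_zero.mp this).resolve_left (mul_ne_zero ha0 hr0)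
        linear_combination this
      have hp : p ≠ 0 := by
        rintro rfl
        apply mul_ne_zero ha0 hr0
        rw [e, ← h1]; simp
      by_cases h2 : (2 : F) = 0
      · exact absurd (by rw [e, ← h1]; linear_combination aeval x p * h2 )
          (mul_ne_zero ha0 hr0)
      refine ⟨r, 0, 2 * p, mul_ne_zero ?_ hp, ?_⟩
      · intro h
        apply h2
        have := congrArg (aeval x) h
        rwa [map_ofNat, map_zero] at this
      · simp only [map_mul, map_ofNat, map_zero, zero_mul, add_zero]
        field_simp
        linear_combination h1 - e
    · refine ⟨r * p, - r * q, _, hN, ?_⟩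
      simp only [map_sub, map_mul, map_pow, ← hy, map_neg]
      have hN' := aeval_ne_zero hx hN
      simp only [map_sub, map_mul, map_pow, ← hy] at hN'
      have hn : aeval x p + aeval x q * y ≠ 0 := by
        intro h0
        apply hN'
        linear_combination h0 * (aeval x p - aeval x q * y)
      rw [eq_div_of_mul_eq hr0 e]
      field_simp
      ring

lemma isTrivialOn_valuation {V : ValuationSubring F} (hV : ∀ a : K, algebraMap K F a ∈ V) :
    V.valuation.IsTrivialOn K := by
  refine ⟨fun a ha => le_antisymm ((V.valuation_le_one_iff _).mpr (hV a)) ?_⟩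
  have h := (V.valuation_le_one_iff _).mpr (hV a⁻¹)
  rw [map_inv₀, map_inv₀] at h
  exact (inv_le_one₀ (by simpa [zero_lt_iff] using ha)).mp h

lemma valuation_aeval {V : ValuationSubring F} (hV : ∀ a : K, algebraMap K F a ∈ V) {x : F}
    (hx : x ∉ V) {p : K[X]} (hp : p ≠ 0) :
    V.valuation (aeval x p) = V.valuation x ^ p.natDegree := by
  have := isTrivialOn_valuation hV
  refine valuation_aeval_eq_valuation_X_pow_natDegree_of_one_lt_valuation_X x ?_ hp
  rwa [← not_le, V.valuation_le_one_iff]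

lemma aeval_mem {V : ValuationSubring F} (hV : ∀ a : K, algebraMap K F a ∈ V) {x : F}
    (hx : x ∈ V) (p : K[X]) : aeval x p ∈ V := by
  rw [aeval_eq_sum_range]
  refine sum_mem fun i _ => ?_
  rw [Algebra.smul_def]
  exact mul_mem (hV _) (pow_mem hx i)

lemma mem_of_sq_mem {V : ValuationSubring F} {y : F} (h : y ^ 2 ∈ V) : y ∈ V := by
  rw [← V.valuation_le_one_iff] at h ⊢
  rw [map_pow] at h
  exact (pow_le_one_iff two_ne_zero).mp h

lemma transcendental_of_notMem {V : ValuationSubring F} (hV : ∀ a : K, algebraMap K F a ∈ V) {x : F}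
    (hx : x ∉ V) : Transcendental K x := by
  have := isTrivialOn_valuation hV
  refine V.valuation.transcendental_of_ne_one K x ?_ ?_
  · rintro rfl
    exact hx V.zero_mem
  · rw [← V.valuation_le_one_iff] at hx
    exact fun h => hx h.le

/-- A function is regular at the unique pole of `x` on a hyperelliptic curve of odd degree if and
only if both of its components are. -/
lemma IsModel.mem_iff {f : K[X]} {x y : F} (H : IsModel f x y) (hf : Odd f.natDegree)
    {V : ValuationSubring F} (hV : ∀ a : K, algebraMap K F a ∈ V) (hx : x ∉ V)
    {h : F} {p q r : K[X]} (hr : r ≠ 0) (e : h * aeval x r = aeval x p + aeval x q * y) :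
    h ∈ V ↔ (p = 0 ∨ p.natDegree ≤ r.natDegree) ∧
      (q = 0 ∨ 2 * q.natDegree + f.natDegree ≤ 2 * r.natDegree) := by
  have hf0 : f ≠ 0 := by
    rintro rfl
    simp at hf
  have hlt : 1 < V.valuation x := by rwa [← not_le, V.valuation_le_one_iff]
  have hvr := valuation_aeval hV hx hr
  have hvy : V.valuation y ^ 2 = V.valuation x ^ f.natDegree := by
    rw [← map_pow, H.sq, valuation_aeval hV hx hf0]
  have hpos : (0 : V.ValueGroup) < V.valuation x ^ r.natDegree := by
    rw [← hvr, zero_lt_iff, Ne, map_eq_zero]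
    exact aeval_ne_zero H.transcendental hr
  have h1 : h ∈ V ↔ V.valuation (aeval x p + aeval x q * y) ≤ V.valuation x ^ r.natDegree := by
    rw [← e, map_mul, hvr, ← V.valuation_le_one_iff, mul_le_iff_le_one_left hpos]
  have hp : V.valuation (aeval x p) ≤ V.valuation x ^ r.natDegree ↔
      (p = 0 ∨ p.natDegree ≤ r.natDegree) := by
    by_cases hp : p = 0
    · simp [hp]
    · rw [valuation_aeval hV hx hp, pow_le_pow_iff_right₀ hlt]
      simp [hp]
  have hq' : q ≠ 0 → V.valuation (aeval x q * y) ^ 2 =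
      V.valuation x ^ (2 * q.natDegree + f.natDegree) := by
    intro hq
    rw [map_mul, mul_pow, valuation_aeval hV hx hq, hvy, ← pow_mul, ← pow_add, mul_comm 2]
  have hq : V.valuation (aeval x q * y) ≤ V.valuation x ^ r.natDegree ↔
      (q = 0 ∨ 2 * q.natDegree + f.natDegree ≤ 2 * r.natDegree) := by
    by_cases hq : q = 0
    · simp [hq]
    · rw [← pow_le_pow_iff_left₀ zero_le zero_le two_ne_zero, hq' hq, ← pow_mul,
        pow_le_pow_iff_right₀ hlt, mul_comm _ 2]
      simp [hq]
  rw [h1, ← hp, ← hq]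
  by_cases hp0 : p = 0
  · simp [hp0]
  by_cases hq0 : q = 0
  · simp [hq0]
  -- The squares of the two values are an even and an odd power of `v(x)`, because `deg f` is odd.
  -- The summands therefore cannot cancel.
  rw [Valuation.map_add_of_distinct_val, max_le_iff]
  intro heq
  have := congrArg (· ^ 2) heq
  rw [hq' hq0, valuation_aeval hV hx hp0, ← pow_mul] at this
  have h2 := pow_right_injective₀ (zero_lt_one.trans hlt) hlt.ne' this
  obtain ⟨k, hk⟩ := hf
  omega

/-- The criterion of `IsModel.mem_iff` involves only degrees and not the valuation ring itself. -/
lemma IsModel.valuationSubring_unique {f : K[X]} {x y : F} (H : IsModel f x y)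
    (hf : Odd f.natDegree) {V V' : ValuationSubring F} (hV : ∀ a : K, algebraMap K F a ∈ V)
    (hV' : ∀ a : K, algebraMap K F a ∈ V') (hx : x ∉ V) (hx' : x ∉ V') : V = V' := by
  ext h
  obtain ⟨p, q, r, hr, e⟩ := H.exists_repr h
  rw [H.mem_iff hf hV hx hr e, H.mem_iff hf hV' hx' hr e]

lemma exists_valuationSubring {A : Subalgebra K F} {a : F} (ha : a ∈ A)
    (hinv : a⁻¹ ∉ A) : ∃ V : ValuationSubring F, (∀ b ∈ A, b ∈ V) ∧ a ∈ V.nonunits := by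
  obtain ⟨B, h1, h2⟩ := Ideal.image_subset_nonunits_valuationSubring
    (A := A.toSubring) (Ideal.span {⟨a, ha⟩}) (by
      rw [Ne, Ideal.span_singleton_eq_top]
      intro hu
      obtain ⟨b, hb⟩ := hu.exists_right_inv
      have : a * b = 1 := congrArg Subtype.val hb
      apply hinv
      rw [inv_eq_of_mul_eq_one_right this]
      exact b.2)
  exact ⟨B, h1, h2 ⟨_, Ideal.mem_span_singleton_self _, rfl⟩⟩

/-- If the reduced denominator `r` were not a unit of `K[x]`, some valuation ring containing `K[x]`
would have `r` in its maximal ideal. There a Bézout relation `αp + βr = 1` reads `(αh + β) r = 1`,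
which is absurd when `h` is regular. -/
lemma exists_aeval_eq_of_forall_mem {x : F} (hx : Transcendental K x) {h : F}
    (hh : h ∈ adjoin K {x})
    (hreg : ∀ V : ValuationSubring F, (∀ a : K, algebraMap K F a ∈ V) → x ∈ V → h ∈ V) :
    ∃ p : K[X], h = aeval x p := by
  obtain ⟨p, r, hr, ⟨α, β, hc⟩, e⟩ := exists_repr_of_mem_adjoin_simple hx hh
  have hr0 := aeval_ne_zero hx hr
  by_cases hu : (aeval x r)⁻¹ ∈ (aeval x : K[X] →ₐ[K] F).range
  · obtain ⟨s, hs⟩ := hu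
    exact ⟨p * s, by rw [map_mul, ← e]; erw [hs]; field_simp⟩
  · obtain ⟨V, hA, hV⟩ := exists_valuationSubring (A := (aeval x : K[X] →ₐ[K] F).range)
      (a := aeval x r) (AlgHom.mem_range_self _ r) hu
    have hmem : h ∈ V := hreg V (fun a => hA _ ⟨C a, by simp⟩) (hA _ ⟨X, by simp⟩)
    rw [V.mem_nonunits_iff] at hV
    have h1 : V.valuation (aeval x (α * p + β * r)) < 1 := by
      rw [map_add, map_mul, map_mul, ← e]
      have h2 : aeval x α * (h * aeval x r) + aeval x β * aeval x r =
        (aeval x α * h + aeval x β) * aeval x r := by ring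
      rw [h2, map_mul]
      refine mul_lt_one_of_nonneg_of_lt_one_right ?_ zero_le hV
      rw [V.valuation_le_one_iff]
      exact add_mem (mul_mem (hA _ ⟨α, rfl⟩) hmem) (hA _ ⟨β, rfl⟩)
    simp [hc] at h1

lemma IsModel.fixed_of_involution {f : K[X]} {x y : F} (H : IsModel f x y) (h2 : (2 : K) ≠ 0)
    {w : F ≃ₐ[K] F} (hwx : w x = x) (hwy : w y = - y) {h : F} (hh : w h = h) :
    h ∈ adjoin K {x} := by
  obtain ⟨p, q, r, hr, e⟩ := H.exists_repr h
  have hr0 := aeval_ne_zero H.transcendental hr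
  have h2' : (2 : F) ≠ 0 := by
    have := (map_ne_zero (algebraMap K F)).mpr h2
    rwa [map_ofNat] at this
  have hwp : ∀ p : K[X], w (aeval x p) = aeval x p := fun p => by
    have := aeval_algHom_apply (w : F →ₐ[K] F) x p
    simp only [AlgEquiv.coe_toAlgHom, hwx] at this
    exact this.symm
  have e' := congrArg w e
  simp only [map_mul, map_add, hwp, hh, hwy] at e'
  rw [mem_adjoin_simple_iff]
  refine ⟨p, r, ?_⟩
  rw [eq_div_iff hr0]
  apply mul_left_cancel₀ h2'
  linear_combination e + e'

/-- As `w` fixes `x`, the function `w h` is regular wherever `x` is, hence so are the even and odd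
parts of `h`. The even part is then a polynomial in `x`; so is the square of the odd part, and
squarefreeness of `f` clears the denominator of the odd part. -/
lemma IsModel.exists_of_forall_mem {f : K[X]} {x y : F} (H : IsModel f x y) (h2 : (2 : K) ≠ 0)
    {w : F ≃ₐ[K] F} (hwx : w x = x) (hwy : w y = - y) (hf : Squarefree f) {h : F}
    (hreg : ∀ V : ValuationSubring F, (∀ a : K, algebraMap K F a ∈ V) → x ∈ V → h ∈ V) :
    ∃ p q : K[X], h = aeval x p + aeval x q * y := by
  obtain ⟨p, q, r, hr, e⟩ := H.exists_repr h
  have hr0 := aeval_ne_zero H.transcendental hr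
  have h2' : (2 : F) ≠ 0 := by
    have := (map_ne_zero (algebraMap K F)).mpr h2
    rwa [map_ofNat] at this
  have hwp : ∀ p : K[X], w (aeval x p) = aeval x p := fun p => by
    have := aeval_algHom_apply (w : F →ₐ[K] F) x p
    simp only [AlgEquiv.coe_toAlgHom, hwx] at this
    exact this.symm
  have e' := congrArg w e
  simp only [map_mul, map_add, hwp, hwy] at e'
  have hregw : ∀ V : ValuationSubring F, (∀ a : K, algebraMap K F a ∈ V) → x ∈ V → w h ∈ V := by
    intro V hV hxV
    exact hreg (V.comap (w : F →+* F)) (fun a => by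
      change w (algebraMap K F a) ∈ V
      rw [w.commutes]
      exact hV a) (by
      change w x ∈ V
      rwa [hwx])
  have hhalf : ∀ V : ValuationSubring F, (∀ a : K, algebraMap K F a ∈ V) → (2 : F)⁻¹ ∈ V := by
    intro V hV
    have := hV (2⁻¹)
    rwa [map_inv₀, map_ofNat] at this
  have hP : aeval x p / aeval x r = (h + w h) * 2⁻¹ := by
    field_simp
    linear_combination - e - e'
  have hQ : aeval x q * y / aeval x r = (h - w h) * 2⁻¹ := by
    field_simp
    linear_combination - e + e'
  obtain ⟨p₀, hp₀⟩ := exists_aeval_eq_of_forall_mem H.transcendental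
    (h := aeval x p / aeval x r) ((mem_adjoin_simple_iff K _).mpr ⟨p, r, rfl⟩)
    (fun V hV hxV => by
      rw [hP]
      exact mul_mem (add_mem (hreg V hV hxV) (hregw V hV hxV)) (hhalf V hV))
  obtain ⟨g, hg⟩ := exists_aeval_eq_of_forall_mem H.transcendental
    (h := aeval x (q ^ 2 * f) / aeval x (r ^ 2))
    ((mem_adjoin_simple_iff K _).mpr ⟨_, _, rfl⟩)
    (fun V hV hxV => by
      have : aeval x (q ^ 2 * f) / aeval x (r ^ 2) = (aeval x q * y / aeval x r) ^ 2 := by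
        simp only [map_mul, map_pow, ← H.sq]
        ring
      rw [this, hQ]
      exact pow_mem (mul_mem (sub_mem (hreg V hV hxV) (hregw V hV hxV)) (hhalf V hV)) 2)
  have hdvd : r ^ 2 ∣ q ^ 2 * f := by
    refine ⟨g, aeval_inj H.transcendental ?_⟩
    rw [map_mul (aeval x) (r ^ 2) g, ← hg, mul_div_cancel₀]
    simpa using hr0
  obtain ⟨q₀, rfl⟩ := squarefree_dvd hf hdvd
  refine ⟨p₀, q₀, ?_⟩
  have h3 : h = aeval x p / aeval x r + aeval x (r * q₀) * y / aeval x r := by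
    field_simp
    linear_combination e
  rw [h3, hp₀, map_mul]
  field_simp

lemma IsModel.mem_of_mem {f : K[X]} {x y : F} (H : IsModel f x y) {V : ValuationSubring F}
    (hV : ∀ a : K, algebraMap K F a ∈ V) (hx : x ∈ V) (p q : K[X]) :
    aeval x p + aeval x q * y ∈ V := by
  refine add_mem (aeval_mem hV hx p) (mul_mem (aeval_mem hV hx q) (mem_of_sq_mem ?_))
  rw [H.sq]
  exact aeval_mem hV hx f

/-- The fixed field of an involution that changes the sign of a square root. -/
lemma quotientField_eq_of_sq_mem (h2 : (2 : K) ≠ 0) {v : F ≃ₐ[K] F} {S : IntermediateField K F}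
    (hS : S ≤ quotientField v) {z : F} (hz : v z = - z) (hz2 : z ^ 2 ∈ S)
    {T : Set F} (hT : adjoin K T = ⊤) (hTS : T ⊆ (S⟮z⟯ : Set F)) : quotientField v = S := by
  refine le_antisymm (fun h hh => ?_) hS
  rw [mem_quotientField] at hh
  have h2' : (2 : F) ≠ 0 := by
    have := (map_ne_zero (algebraMap K F)).mpr h2
    rwa [map_ofNat] at this
  have hzalg : IsAlgebraic S z := by
    refine ⟨X ^ 2 - C ⟨z ^ 2, hz2⟩, X_pow_sub_C_ne_zero two_pos _, ?_⟩
    simp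
  have hmem : h ∈ S⟮z⟯ := by
    have h1 : adjoin K T ≤ S⟮z⟯.restrictScalars K := adjoin_le_iff.mpr hTS
    rw [hT] at h1
    exact h1 (by trivial)
  have hsub : h ∈ Algebra.adjoin S {z} := by
    rw [← adjoin_simple_toSubalgebra_of_isAlgebraic hzalg]
    exact hmem
  have hrep : ∃ p ∈ S, ∃ q ∈ S, h = p + q * z := by
    clear hh hmem
    induction hsub using Algebra.adjoin_induction with
    | mem a ha =>
      rw [Set.mem_singleton_iff] at ha
      exact ⟨0, S.zero_mem, 1, S.one_mem, by simp [ha]⟩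
    | algebraMap a => exact ⟨a, a.2, 0, S.zero_mem, by simp⟩
    | add a b _ _ ha hb =>
      obtain ⟨p, hp, q, hq, rfl⟩ := ha
      obtain ⟨p', hp', q', hq', rfl⟩ := hb
      exact ⟨p + p', add_mem hp hp', q + q', add_mem hq hq', by ring⟩
    | mul a b _ _ ha hb =>
      obtain ⟨p, hp, q, hq, rfl⟩ := ha
      obtain ⟨p', hp', q', hq', rfl⟩ := hb
      exact ⟨p * p' + q * q' * z ^ 2, add_mem (mul_mem hp hp') (mul_mem (mul_mem hq hq') hz2),
        p * q' + q * p', add_mem (mul_mem hp hq') (mul_mem hq hp'), by ring⟩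
  obtain ⟨p, hp, q, hq, rfl⟩ := hrep
  have hp' := mem_quotientField.mp (hS hp)
  have hq' := mem_quotientField.mp (hS hq)
  rw [map_add, map_mul, hz, hp', hq'] at hh
  have : q * z = 0 := mul_left_cancel₀ h2' (by linear_combination - hh)
  rw [this, add_zero]
  exact hp

end Quadratic

/-! ### Discreteness of the valuations of a curve -/

section Places

variable {K F : Type*} [Field K] [Field F] [Algebra K F]

lemma finiteDimensional_adjoin_of_transcendental
    (hfin : ∃ x : F, Transcendental K x ∧ FiniteDimensional K⟮x⟯ F) {t : F}
    (ht : Transcendental K t) : FiniteDimensional K⟮t⟯ F := by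
  obtain ⟨x, hx, hfd⟩ := hfin
  have hess : Algebra.EssFiniteType K F := by
    have : Algebra.EssFiniteType K K⟮x⟯ :=
      (IntermediateField.essFiniteType_iff).mpr (fg_adjoin_of_finite (Set.finite_singleton x))
    exact Algebra.EssFiniteType.comp K K⟮x⟯ F
  have hess' : Algebra.EssFiniteType K⟮t⟯ F := Algebra.EssFiniteType.of_comp K K⟮t⟯ F
  have hrange : ∀ z : F, Set.range (fun _ : Unit => z) = {z} := fun z => by simp
  have hxi : AlgebraicIndependent K (fun _ : Unit => x) :=
    (algebraicIndependent_singleton_iff ()).mpr hx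
  have hti : AlgebraicIndependent K (fun _ : Unit => t) :=
    (algebraicIndependent_singleton_iff ()).mpr ht
  have hxb : IsTranscendenceBasis K (fun _ : Unit => x) := by
    rw [hxi.isTranscendenceBasis_iff_isAlgebraic, hrange]
    refine ⟨fun z => ?_⟩
    rw [← isAlgebraic_adjoin_iff]
    exact Algebra.IsAlgebraic.isAlgebraic z
  have htb : IsTranscendenceBasis K (fun _ : Unit => t) :=
    hti.isTranscendenceBasis_of_lift_trdeg_le_of_finite hxb.lift_cardinalMk_eq_trdeg.ge
  have halg := htb.isAlgebraic_field
  rw [hrange] at halg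
  exact Algebra.finite_of_essFiniteType_of_isAlgebraic

/-- At a pole of `x` the value of a polynomial in `x` depends only on its degree. -/
lemma valuation_of_mem_adjoin {V : ValuationSubring F} (hV : ∀ a : K, algebraMap K F a ∈ V) {x : F}
    (hx : x ∉ V) {c : F} (hc : c ∈ K⟮x⟯) (hc0 : c ≠ 0) :
    ∃ k : ℤ, V.valuation c = V.valuation x ^ k := by
  have htr := transcendental_of_notMem hV hx
  obtain ⟨p, r, hr, -, e⟩ := exists_repr_of_mem_adjoin_simple htr hc
  have hr0 := aeval_ne_zero htr hr
  have hp : p ≠ 0 := by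
    rintro rfl
    rw [map_zero] at e
    exact mul_ne_zero hc0 hr0 e
  have hx0 : V.valuation x ≠ 0 := by
    rw [Ne, map_eq_zero]
    rintro rfl
    exact hx V.zero_mem
  refine ⟨p.natDegree - r.natDegree, ?_⟩
  rw [zpow_sub₀ hx0, zpow_natCast, zpow_natCast, ← valuation_aeval hV hx hp,
    ← valuation_aeval hV hx hr, ← map_div₀, ← e, mul_div_cancel_right₀ _ hr0]

/-- The local ring of a closed point of a curve is a discrete valuation ring. -/
lemma Place.exists_isUniformizer (hfin : ∃ x : F, Transcendental K x ∧ FiniteDimensional K⟮x⟯ F)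
    (Q : Place K F) : ∃ t, Q.IsUniformizer t := by
  classical
  set V := Q.ring with hVdef
  have hV := Q.algebraMap_mem
  obtain ⟨x, hx⟩ : ∃ x, x ∉ V := by
    by_contra! h
    exact Q.ne_top (top_unique fun z _ => h z)
  have hx1 : 1 < V.valuation x := by rwa [← not_le, V.valuation_le_one_iff]
  have hfd := finiteDimensional_adjoin_of_transcendental hfin (transcendental_of_notMem hV hx)
  suffices h : ∃ t : F, t ≠ 0 ∧ V.valuation t < 1 ∧
      ∀ z, V.valuation z < 1 → V.valuation z ≤ V.valuation t by
    obtain ⟨t, ht0, ht1, ht⟩ := h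
    have hvt : 0 < V.valuation t := by simpa [zero_lt_iff] using ht0
    refine ⟨t, ht0, fun z => ?_⟩
    rw [V.mem_nonunits_iff, ← V.valuation_le_one_iff, map_mul, map_inv₀,
      ← div_eq_mul_inv, div_le_one₀ hvt]
    exact ⟨ht z, fun h => h.trans_lt ht1⟩
  -- Without a largest value below `1` there is an infinite strictly increasing sequence of values
  -- in `[v(x)⁻¹, 1)`. Such values are distinct modulo powers of `v(x)`, which makes the
  -- corresponding functions linearly independent over `K(x)`.
  by_contra! H
  have hnext : ∀ z : {z : F // z ≠ 0 ∧ V.valuation z < 1}, ∃ z' : {z : F // z ≠ 0 ∧ V.valuation z < 1},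
      V.valuation z.1 < V.valuation z'.1 := by
    rintro ⟨z, hz0, hz1⟩
    obtain ⟨z', h1, h2⟩ := H z hz0 hz1
    refine ⟨⟨z', ?_, h1⟩, h2⟩
    rintro rfl
    simp at h2
  choose next hnext using hnext
  have hx0 : x ≠ 0 := by
    rintro rfl
    exact hx V.zero_mem
  let z : ℕ → {z : F // z ≠ 0 ∧ V.valuation z < 1} := fun n =>
    Nat.rec ⟨x⁻¹, inv_ne_zero hx0, by rw [map_inv₀]; exact inv_lt_one_of_one_lt₀ hx1⟩
      (fun _ => next) n
  have hmono : StrictMono fun n => V.valuation (z n).1 :=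
    strictMono_nat_of_lt_succ fun n => hnext (z n)
  have hge : ∀ n, (V.valuation x)⁻¹ ≤ V.valuation (z n).1 := fun n => by
    rw [← map_inv₀]
    exact hmono.monotone (Nat.zero_le n)
  have hvx : V.valuation x ≠ 0 := by simpa using hx0
  have hdist : ∀ (c d : F) (i j : ℕ), c ∈ K⟮x⟯ → d ∈ K⟮x⟯ → c ≠ 0 → d ≠ 0 →
      V.valuation (c * (z i).1) = V.valuation (d * (z j).1) → i = j := by
    have key : ∀ (k l : ℤ) (i j : ℕ), V.valuation x ^ k * V.valuation (z i).1 =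
        V.valuation x ^ l * V.valuation (z j).1 → k ≤ l := by
      intro k l i j h
      by_contra! hlt
      have h1 : V.valuation x ^ l * V.valuation (z j).1 < V.valuation x ^ l :=
        mul_lt_of_lt_one_right (zpow_pos (zero_lt_iff.mpr hvx) _) (z j).2.2
      have h2 : V.valuation x ^ (k - 1) ≤ V.valuation x ^ k * V.valuation (z i).1 := by
        rw [zpow_sub_one₀ hvx]
        exact mul_le_mul_right (hge i) _
      have h3 : V.valuation x ^ l ≤ V.valuation x ^ (k - 1) :=
        zpow_le_zpow_right₀ hx1.le (by omega)
      exact absurd (h3.trans h2) (not_le.mpr (h ▸ h1))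
    intro c d i j hc hd hc0 hd0 h
    obtain ⟨k, hk⟩ := valuation_of_mem_adjoin hV hx hc hc0
    obtain ⟨l, hl⟩ := valuation_of_mem_adjoin hV hx hd hd0
    rw [map_mul, map_mul, hk, hl] at h
    have hkl : k = l := le_antisymm (key _ _ _ _ h) (key _ _ _ _ h.symm)
    rw [hkl] at h
    exact hmono.injective (mul_left_cancel₀ (zpow_ne_zero _ hvx) h)
  have hli : LinearIndependent K⟮x⟯ fun i : Fin (Module.finrank K⟮x⟯ F + 1) => (z i).1 := by
    rw [linearIndependent_iff']
    intro s g hg i hi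
    by_contra hgi
    let s' := s.filter fun i => g i ≠ 0
    have hsum : ∑ i ∈ s', g i • (z i).1 = 0 := by
      refine (Finset.sum_filter_of_ne ?_).trans hg
      intro j _ hj h0
      exact hj (by rw [h0, zero_smul])
    -- The nonzero terms of the relation have pairwise distinct values, so the largest one is the
    -- value of the sum.
    obtain ⟨j, hj, hmax⟩ := s'.exists_max_image (fun j => V.valuation (g j • (z j).1))
      ⟨i, Finset.mem_filter.mpr ⟨hi, hgi⟩⟩
    have h1 := V.valuation.map_sum_eq_of_lt hj (f := fun j => g j • (z j).1) (fun k hk => by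
      rw [Finset.mem_sdiff, Finset.mem_singleton] at hk
      refine lt_of_le_of_ne (hmax k hk.1) fun h => hk.2 (Fin.ext ?_)
      exact hdist (g k) (g j) k j (g k).2 (g j).2
        (by simpa using (Finset.mem_filter.mp hk.1).2)
        (by simpa using (Finset.mem_filter.mp hj).2) h)
    rw [hsum, map_zero] at h1
    have h2 := (V.valuation.zero_iff).mp h1.symm
    rw [smul_eq_zero] at h2
    exact h2.elim (Finset.mem_filter.mp hj).2 (z j).2.1
  have := hli.fintype_card_le_finrank
  simp at this

end Places

/-! ### Local rings of `L`-valued points and the degree bound from genus one -/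

section CurvePoints

variable {K F L : Type*} [Field K] [Field F] [Algebra K F] [Field L] [Algebra K L]

lemma CurvePoint.eval_zero (P : CurvePoint K F L) : P.eval 0 = ((0 : L) : OnePoint L) := by
  simpa using P.eval_algebraMap 0

lemma CurvePoint.eval_one (P : CurvePoint K F L) : P.eval 1 = ((1 : L) : OnePoint L) := by
  simpa using P.eval_algebraMap 1

/-- The local ring of a point. -/
def CurvePoint.ring (P : CurvePoint K F L) : ValuationSubring F where
  carrier := {f | ∃ a : L, P.eval f = (a : OnePoint L)}
  mul_mem' := by
    rintro f g ⟨a, ha⟩ ⟨b, hb⟩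
    exact ⟨_, P.eval_mul f g a b ha hb⟩
  one_mem' := ⟨1, P.eval_one⟩
  add_mem' := by
    rintro f g ⟨a, ha⟩ ⟨b, hb⟩
    exact ⟨_, P.eval_add f g a b ha hb⟩
  zero_mem' := ⟨0, P.eval_zero⟩
  neg_mem' := by
    rintro f ⟨a, ha⟩
    refine ⟨algebraMap K L (-1) * a, ?_⟩
    have := P.eval_mul _ _ _ _ (P.eval_algebraMap (-1)) ha
    rwa [map_neg, map_one, neg_one_mul] at this
  mem_or_inv_mem' := by
    intro f
    induction h : P.eval f using OnePoint.rec with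
    | infty => exact Or.inr ⟨0, P.eval_inv f h⟩
    | coe _ => exact Or.inl ⟨_, h⟩

lemma CurvePoint.mem_ring {P : CurvePoint K F L} {f : F} :
    f ∈ P.ring ↔ ∃ a : L, P.eval f = (a : OnePoint L) := Iff.rfl

lemma CurvePoint.eval_eq_infty_iff {P : CurvePoint K F L} {f : F} :
    P.eval f = OnePoint.infty ↔ f ∉ P.ring := by
  rw [CurvePoint.mem_ring]
  induction P.eval f using OnePoint.rec with
  | infty => simp [OnePoint.infty_ne_coe]
  | coe a => simp

/-- The value of a regular function at a point. -/
noncomputable def CurvePoint.value (P : CurvePoint K F L) : P.ring →+* L :=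
  have key : ∀ (f : P.ring) (a : L), P.eval f = (a : OnePoint L) → f.2.choose = a :=
    fun f a h => OnePoint.coe_injective (f.2.choose_spec.symm.trans h)
  { toFun := fun f => f.2.choose
    map_one' := key 1 1 P.eval_one
    map_zero' := key 0 0 P.eval_zero
    map_mul' := fun f g => key (f * g) _ (P.eval_mul f g _ _ f.2.choose_spec g.2.choose_spec)
    map_add' := fun f g => key (f + g) _ (P.eval_add f g _ _ f.2.choose_spec g.2.choose_spec) }

lemma CurvePoint.eval_eq_value (P : CurvePoint K F L) (f : P.ring) :
    P.eval f = (P.value f : OnePoint L) := f.2.choose_spec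

lemma CurvePoint.algebraMap_mem (P : CurvePoint K F L) (a : K) : algebraMap K F a ∈ P.ring :=
  ⟨_, P.eval_algebraMap a⟩

lemma CurvePoint.value_algebraMap (P : CurvePoint K F L) (a : K) :
    P.value ⟨algebraMap K F a, P.algebraMap_mem a⟩ = algebraMap K L a :=
  OnePoint.coe_injective ((P.eval_eq_value _).symm.trans (P.eval_algebraMap a))

/-- The closed point below an `L`-valued point. -/
def CurvePoint.toPlace (P : CurvePoint K F L) : Place K F where
  ring := P.ring
  algebraMap_mem := P.algebraMap_mem
  ne_top h := by
    obtain ⟨f, hf⟩ := P.exists_pole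
    rw [P.eval_eq_infty_iff, h] at hf
    exact hf trivial

/-- Evaluation embeds the residue field in `L`. If its degree were one, every finite value would
come from `K`. -/
lemma CurvePoint.two_le_degree [FiniteDimensional K L] (P : CurvePoint K F L)
    (hP : ¬ P.IsRational) : 2 ≤ P.toPlace.degree := by
  let _ : Algebra K P.toPlace.ring := P.toPlace.constants.toAlgebra
  change 2 ≤ Module.finrank K (IsLocalRing.ResidueField P.toPlace.ring)
  let φ₀ : P.toPlace.ring →+* L := P.value
  have hloc : IsLocalHom φ₀ := by
    refine ⟨fun f hf => ?_⟩
    by_contra hu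
    have hm : (f : F) ∈ P.ring.nonunits :=
      P.ring.coe_mem_nonunits_iff.mpr ((IsLocalRing.mem_maximalIdeal _).mpr hu)
    rw [P.ring.mem_nonunits_iff_or] at hm
    apply hf.ne_zero
    rcases hm with h | h
    · have : f = 0 := Subtype.ext h
      rw [this, map_zero]
    · rw [← CurvePoint.eval_eq_infty_iff] at h
      have := P.eval_inv _ h
      rw [inv_inv] at this
      exact OnePoint.coe_injective ((P.eval_eq_value f).symm.trans this)
  let φ : IsLocalRing.ResidueField P.toPlace.ring →ₐ[K] L :=
    { IsLocalRing.ResidueField.lift φ₀ with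
      commutes' := fun a => P.value_algebraMap a }
  have hφ : ∀ f : P.toPlace.ring, φ (IsLocalRing.residue _ f) = P.value f := fun f => rfl
  have hfd : FiniteDimensional K (IsLocalRing.ResidueField P.toPlace.ring) :=
    FiniteDimensional.of_injective φ.toLinearMap φ.toRingHom.injective
  have hpos : 0 < Module.finrank K (IsLocalRing.ResidueField P.toPlace.ring) :=
    Module.finrank_pos
  by_contra! hlt
  have h1 : Module.finrank K (IsLocalRing.ResidueField P.toPlace.ring) = 1 := by omega
  rw [← Subalgebra.bot_eq_top_iff_finrank_eq_one] at h1
  apply hP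
  intro f a hf
  have hmem : f ∈ P.ring := ⟨a, hf⟩
  have h2 : IsLocalRing.residue P.toPlace.ring ⟨f, hmem⟩ ∈
      (⊥ : Subalgebra K (IsLocalRing.ResidueField P.toPlace.ring)) := by
    rw [h1]
    trivial
  obtain ⟨b, hb⟩ := Algebra.mem_bot.mp h2
  refine ⟨b, ?_⟩
  rw [← φ.commutes, hb, hφ]
  exact OnePoint.coe_injective ((P.eval_eq_value _).symm.trans hf)

lemma CurvePoint.apply_mem_ring_iff {P : CurvePoint K F L} {w : F ≃ₐ[K] F} {σ : L ≃ₐ[K] L}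
    (h : P.image w = P.conj σ) (f : F) : w f ∈ P.ring ↔ f ∈ P.ring := by
  have h1 : P.eval (w f) = OnePoint.map σ (P.eval f) := congrArg (fun Q => Q.eval f) h
  rw [← not_iff_not, ← P.eval_eq_infty_iff, ← P.eval_eq_infty_iff, h1]
  induction P.eval f using OnePoint.rec with
  | infty => simp
  | coe a => simp

/-- On the hyperelliptic curve `y² = f(x)` of genus one, the polynomial `f` has degree at most `4`,
provided that there is a point of degree two over the pole of `x`. -/
lemma IsModel.le_two_of_hasGenus_one [FiniteDimensional K L] (h2 : (2 : K) ≠ 0)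
    (hfin : ∃ x : F, Transcendental K x ∧ FiniteDimensional K⟮x⟯ F) (hg : HasGenus K F 1)
    {f : K[X]} {x y : F} (H : IsModel f x y) (hf : Squarefree f) {m : ℕ}
    (hm : f.natDegree = 2 * m)
    {w : F ≃ₐ[K] F} (hwx : w x = x) (hwy : w y = - y) {σ : L ≃ₐ[K] L} {P : CurvePoint K F L}
    (hP : ¬ P.IsRational) (hPw : P.image w = P.conj σ) (hPx : x ∉ P.ring) : m ≤ 2 := by
  classical
  by_contra! hlt
  set V := P.ring with hVdef
  have hV := P.algebraMap_mem
  obtain ⟨n, rfl⟩ : ∃ n, m = n + 1 := ⟨m - 1, by omega⟩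
  -- With `n = m - 1` the order of `y` at `P` is too negative for `y` to contribute, so `ℓ(nP) ≤ n +
  -- 1`, while `deg (nP) ≥ 2n`.
  let D : Place K F →₀ ℤ := Finsupp.single P.toPlace (n : ℤ)
  have hdeg : divisorDegree D = n * P.toPlace.degree := by
    simp [divisorDegree, D, Finsupp.sum_single_index]
  have hub := hg.2 ⟨D, rfl⟩
  have h2' : (2 : F) ≠ 0 := by
    have := (map_ne_zero (algebraMap K F)).mpr h2
    rwa [map_ofNat] at this
  have hlt1 : 1 < V.valuation x := by rwa [← not_le, V.valuation_le_one_iff]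
  have hx0 : x ≠ 0 := by
    rintro rfl
    exact hPx V.zero_mem
  have hle : riemannRochSpace D ≤ (degreeLT K (n + 1)).map (aeval x : K[X] →ₐ[K] F).toLinearMap := by
    intro h hh
    have hh' : ∀ Q : Place K F, Q.OrdGE (- D Q) h := hh
    -- Only `ord_P x⁻¹ ≥ 1` is needed here; it need not be a uniformizer.
    have hPh : h * x⁻¹ ^ n ∈ V := by
      obtain ⟨t, ht⟩ := P.toPlace.exists_isUniformizer hfin
      have h1 := hh' P.toPlace t ht
      simp only [D, Finsupp.single_eq_same, neg_neg, zpow_natCast] at h1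
      have h3 : x⁻¹ * t⁻¹ ∈ V := by
        refine (ht.2 _).mp ?_
        change x⁻¹ ∈ V.nonunits
        rw [V.inv_mem_nonunits_iff]
        exact Or.inr hPx
      have h4 : h * x⁻¹ ^ n = (h * t ^ n) * (x⁻¹ * t⁻¹) ^ n := by
        have h5 : t ^ n * t⁻¹ ^ n = 1 := by rw [← mul_pow, mul_inv_cancel₀ ht.1, one_pow]
        rw [mul_pow]
        linear_combination (- (h * x⁻¹ ^ n)) * h5
      rw [h4]
      exact mul_mem h1 (pow_mem h3 n)
    obtain ⟨p, q, rfl⟩ := H.exists_of_forall_mem h2 hwx hwy hf (h := h) (by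
      intro W hW hxW
      by_cases hWt : W = ⊤
      · rw [hWt]; trivial
      let Q : Place K F := ⟨W, hW, hWt⟩
      have hQP : Q ≠ P.toPlace := by
        intro hQP
        apply hPx
        have : W = V := congrArg Place.ring hQP
        rwa [← this]
      obtain ⟨t, ht⟩ := Q.exists_isUniformizer hfin
      have h1 := hh' Q t ht
      simpa [D, Finsupp.single_eq_of_ne hQP] using h1)
    have hwp : ∀ p : K[X], w (aeval x p) = aeval x p := fun p => by
      have := aeval_algHom_apply (w : F →ₐ[K] F) x p
      simp only [AlgEquiv.coe_toAlgHom, hwx] at this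
      exact this.symm
    -- The conjugate points `P` and `w(P)` lie over the same closed point, so its local ring is
    -- stable under `w` and the two components of `h` can be bounded separately.
    have hPw' : (aeval x p - aeval x q * y) * x⁻¹ ^ n ∈ V := by
      have := (P.apply_mem_ring_iff hPw _).mpr hPh
      simpa only [map_mul, map_add, hwp, hwx, hwy, map_pow, map_inv₀, mul_neg,
        ← sub_eq_add_neg] using this
    have hhalf : (2 : F)⁻¹ ∈ V := by
      have := hV (2⁻¹)
      rwa [map_inv₀, map_ofNat] at this
    have hpV : aeval x p * x⁻¹ ^ n ∈ V := by
      have h5 : aeval x p * x⁻¹ ^ n = ((aeval x p + aeval x q * y) * x⁻¹ ^ n +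
        (aeval x p - aeval x q * y) * x⁻¹ ^ n) * 2⁻¹ := by
        field_simp
        ring
      rw [h5]
      exact mul_mem (add_mem hPh hPw') hhalf
    have hqV : (aeval x q * y) * x⁻¹ ^ n ∈ V := by
      have h5 : (aeval x q * y) * x⁻¹ ^ n = ((aeval x p + aeval x q * y) * x⁻¹ ^ n -
        (aeval x p - aeval x q * y) * x⁻¹ ^ n) * 2⁻¹ := by
        field_simp
        ring
      rw [h5]
      exact mul_mem (sub_mem hPh hPw') hhalf
    have hpos : ∀ k : ℕ, (0 : V.ValueGroup) < V.valuation x ^ k := fun k =>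
      pow_pos (zero_lt_one.trans hlt1) k
    have hq : q = 0 := by
      by_contra hq
      have h6 : aeval x (q ^ 2 * f) * x⁻¹ ^ (2 * n) ∈ V := by
        have := pow_mem hqV 2
        convert this using 1
        simp only [map_mul, map_pow, ← H.sq]
        ring
      rw [← V.valuation_le_one_iff, map_mul, map_pow, map_inv₀, inv_pow, ← div_eq_mul_inv,
        div_le_one₀ (hpos _), valuation_aeval hV hPx (mul_ne_zero (pow_ne_zero 2 hq) hf.ne_zero),
        pow_le_pow_iff_right₀ hlt1, natDegree_mul (pow_ne_zero 2 hq) hf.ne_zero, natDegree_pow,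
        hm] at h6
      omega
    subst hq
    refine ⟨p, ?_, by simp⟩
    rw [SetLike.mem_coe, mem_degreeLT]
    by_cases hp : p = 0
    · simp [hp]
    rw [← V.valuation_le_one_iff, map_mul, map_pow, map_inv₀, inv_pow, ← div_eq_mul_inv,
        div_le_one₀ (hpos _), valuation_aeval hV hPx hp, pow_le_pow_iff_right₀ hlt1] at hpV
    rw [degree_eq_natDegree hp]
    exact_mod_cast Nat.lt_succ_of_le hpV
  have hfd : Module.Finite K (degreeLT K (n + 1)) :=
    Module.Finite.equiv (degreeLTEquiv K (n + 1)).symm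
  have hrank : Module.finrank K (riemannRochSpace D) ≤ n + 1 := by
    refine (Submodule.finrank_mono hle).trans ((Submodule.finrank_map_le _ _).trans ?_)
    rw [(degreeLTEquiv K (n + 1)).finrank_eq]
    simp
  have h7 : (2 : ℤ) ≤ P.toPlace.degree := by exact_mod_cast P.two_le_degree hP
  have h8 : (Module.finrank K (riemannRochSpace D) : ℤ) ≤ n + 1 := by exact_mod_cast hrank
  simp only [hdeg] at hub
  push_cast at hub
  -- The genus bound now gives `2n - (n + 1) + 1 ≤ 1`, that is `n ≤ 1`.
  have : (n : ℤ) * 2 ≤ n * P.toPlace.degree := by gcongr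
  omega

end CurvePoints

/-! ### The function field of a Weierstrass curve and its embeddings -/

section FunctionFields

open WeierstrassCurve WeierstrassCurve.Affine

variable {K : Type*} [Field K]

lemma algebraMap_injective_coordinateRing (W : Affine K) :
    Function.Injective (algebraMap K[X] W.CoordinateRing) := FaithfulSMul.algebraMap_injective _ _

lemma aeval_xFun (W : Affine K) (p : K[X]) : aeval (xFun W) p =
    algebraMap W.CoordinateRing W.FunctionField (algebraMap K[X] W.CoordinateRing p) := by
  have : (aeval (xFun W) : K[X] →ₐ[K] W.FunctionField) =
      (IsScalarTower.toAlgHom K W.CoordinateRing W.FunctionField).comp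
        (IsScalarTower.toAlgHom K K[X] W.CoordinateRing) := by
    ext
    simp
    rfl
  rw [this]
  rfl

lemma transcendental_xFun (W : Affine K) : Transcendental K (xFun W) := by
  rw [transcendental_iff_injective]
  intro p q h
  rw [aeval_xFun, aeval_xFun] at h
  exact algebraMap_injective_coordinateRing W (IsFractionRing.injective _ _ h)

lemma adjoin_xFun_yFun (W : Affine K) : adjoin K {xFun W, yFun W} = ⊤ := by
  rw [eq_top_iff]
  intro z _
  obtain ⟨a, b, -, rfl⟩ := IsFractionRing.div_surjective (A := W.CoordinateRing) z
  have key : ∀ a : W.CoordinateRing,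
      algebraMap W.CoordinateRing W.FunctionField a ∈ adjoin K {xFun W, yFun W} := by
    intro a
    have hx : xFun W ∈ adjoin K {xFun W, yFun W} := subset_adjoin _ _ (by simp)
    have hy : yFun W ∈ adjoin K {xFun W, yFun W} := subset_adjoin _ _ (by simp)
    have hp : ∀ p : K[X], aeval (xFun W) p ∈ adjoin K {xFun W, yFun W} := fun p => by
      rw [aeval_eq_sum_range]
      exact sum_mem fun i _ => IntermediateField.smul_mem _ (pow_mem hx i)
    obtain ⟨p, q, rfl⟩ := CoordinateRing.exists_smul_basis_eq a
    rw [Algebra.smul_def, Algebra.smul_def, mul_one, map_add, map_mul, ← aeval_xFun, ← aeval_xFun]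
    exact add_mem (hp p) (mul_mem (hp q) hy)
  exact div_mem (key a) (key b)

lemma algHom_ext_xFun_yFun {W : Affine K} {M : Type*} [Field M] [Algebra K M]
    {φ ψ : W.FunctionField →ₐ[K] M} (hx : φ (xFun W) = ψ (xFun W))
    (hy : φ (yFun W) = ψ (yFun W)) : φ = ψ := by
  refine AlgHom.ext fun z => ?_
  have hz : z ∈ adjoin K {xFun W, yFun W} := by
    rw [adjoin_xFun_yFun]
    trivial
  induction hz using adjoin_induction with
  | mem z hz =>
    rcases hz with rfl | rfl
    exacts [hx, hy]
  | algebraMap a => rw [φ.commutes, ψ.commutes]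
  | add a b _ _ ha hb => rw [map_add, map_add, ha, hb]
  | mul a b _ _ ha hb => rw [map_mul, map_mul, ha, hb]
  | inv a _ ha => rw [map_inv₀, map_inv₀, ha]

/-- A point with transcendental `x`-coordinate is a specialization of the generic point. -/
lemma exists_algHom_functionField {W : Affine K} {M : Type*} [Field M] [Algebra K M] {x y : M}
    (h : (W.baseChange M).Equation x y) (hx : Transcendental K x) :
    ∃ φ : W.FunctionField →ₐ[K] M, φ (xFun W) = x ∧ φ (yFun W) = y := by
  have h0 : eval₂ ((aeval x : K[X] →ₐ[K] M) : K[X] →+* M) y W.polynomial = 0 := by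
    rw [equation_iff] at h
    simp only [WeierstrassCurve.Affine.baseChange, WeierstrassCurve.baseChange,
      WeierstrassCurve.map_a₁, WeierstrassCurve.map_a₂, WeierstrassCurve.map_a₃,
      WeierstrassCurve.map_a₄, WeierstrassCurve.map_a₆] at h
    simp only [WeierstrassCurve.Affine.polynomial, eval₂_sub, eval₂_add, eval₂_mul, eval₂_pow,
      eval₂_X, eval₂_C, RingHom.coe_coe, map_add, map_mul, map_pow, aeval_X, aeval_C]
    linear_combination h
  let φ : W.CoordinateRing →ₐ[K] M := AdjoinRoot.liftAlgHom _ (aeval x) y h0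
  have hφx : φ (CoordinateRing.mk W (C X)) = x := by
    have : φ (CoordinateRing.mk W (C X)) = aeval x (X : K[X]) :=
      AdjoinRoot.liftAlgHom_of W.polynomial (aeval x) y h0 X
    simpa using this
  have hφy : φ (CoordinateRing.mk W X) = y := AdjoinRoot.liftAlgHom_root W.polynomial (aeval x) y h0
  have hφp : ∀ p : K[X], φ (algebraMap K[X] W.CoordinateRing p) = aeval x p := fun p =>
    AdjoinRoot.liftAlgHom_of W.polynomial (aeval x) y h0 p
  -- The coordinate ring is an integral domain finite over `K[X]`, so a nonzero kernel would meet
  -- `K[X]`; the transcendence of `x` excludes this.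
  have hinj : Function.Injective φ := by
    have : Module.Finite K[X] W.CoordinateRing :=
      Module.Finite.of_basis (CoordinateRing.basis W)
    change Function.Injective (φ : W.CoordinateRing →+* M)
    rw [RingHom.injective_iff_ker_eq_bot]
    refine Ideal.eq_bot_of_comap_eq_bot (R := K[X]) ?_
    rw [eq_bot_iff]
    intro p hp
    rw [Ideal.mem_comap, RingHom.mem_ker] at hp
    have hp' : aeval x p = 0 := (hφp p).symm.trans hp
    by_contra hp0
    exact hx ⟨p, hp0, hp'⟩
  refine ⟨IsFractionRing.liftAlgHom hinj, ?_, ?_⟩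
  · exact (IsFractionRing.lift_algebraMap (g := φ.toRingHom) hinj _).trans hφx
  · exact (IsFractionRing.lift_algebraMap (g := φ.toRingHom) hinj _).trans hφy

lemma fieldRange_functionField {W : Affine K} {M : Type*} [Field M] [Algebra K M]
    (φ : W.FunctionField →ₐ[K] M) : φ.fieldRange = adjoin K {φ (xFun W), φ (yFun W)} := by
  rw [AlgHom.fieldRange_eq_map, ← adjoin_xFun_yFun, adjoin_map, Set.image_pair]

lemma exists_algEquiv_functionField {W : Affine K} {M : Type*} [Field M] [Algebra K M] {x y : M}
    (h : (W.baseChange M).Equation x y) (hx : Transcendental K x) (htop : adjoin K {x, y} = ⊤) :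
    ∃ φ : W.FunctionField ≃ₐ[K] M, φ (xFun W) = x ∧ φ (yFun W) = y := by
  obtain ⟨φ, h1, h2⟩ := exists_algHom_functionField h hx
  refine ⟨AlgEquiv.ofBijective φ ⟨φ.toRingHom.injective, fun z => ?_⟩, h1, h2⟩
  have : z ∈ φ.fieldRange := by
    rw [fieldRange_functionField, h1, h2, htop]
    trivial
  exact this

end FunctionFields

/-! ### Short Weierstrass cubics -/

section Cubic

open WeierstrassCurve WeierstrassCurve.Affine

variable {K : Type*} [Field K]

/-- The polynomial `X³ + A X + B`. -/
noncomputable abbrev cubic (A B : K) : K[X] := X ^ 3 + C A * X + C B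

lemma natDegree_cubic (A B : K) : (cubic A B).natDegree = 3 := by
  unfold cubic
  compute_degree!

lemma odd_natDegree_cubic (A B : K) : Odd (cubic A B).natDegree := by
  rw [natDegree_cubic]
  decide

lemma discr_ne_zero {A B : K} [h : (shortWeierstrass A B).IsElliptic] :
    4 * A ^ 3 + 27 * B ^ 2 ≠ 0 := by
  intro h0
  apply h.isUnit.ne_zero
  simp only [shortWeierstrass, WeierstrassCurve.Δ, WeierstrassCurve.b₂, WeierstrassCurve.b₄,
    WeierstrassCurve.b₆, WeierstrassCurve.b₈]
  linear_combination (-16) * h0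

lemma squarefree_cubic {A B : K} (h : 4 * A ^ 3 + 27 * B ^ 2 ≠ 0) : Squarefree (cubic A B) := by
  apply Separable.squarefree
  rw [separable_def]
  have hd : derivative (cubic A B) = 3 * X ^ 2 + C A := by
    simp only [cubic, derivative_add, derivative_X_pow, derivative_C_mul, derivative_X,
      derivative_C]
    simp
    exact map_ofNat C 3
  rw [hd]
  set D := 4 * A ^ 3 + 27 * B ^ 2 with hD
  -- Bézout coefficients of the cubic and its derivative, whose combination is the discriminant
  -- expression `4A³ + 27B²`.
  refine ⟨C D⁻¹ * (27 * C B - 18 * C A * X), C D⁻¹ * (6 * C A * X ^ 2 - 9 * C B * X + 4 * C A ^ 2), ?_⟩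
  have h1 : C D⁻¹ * C D = (1 : K[X]) := by rw [← C_mul, inv_mul_cancel₀ h, C_1]
  have h2 : (C D : K[X]) = 4 * C A ^ 3 + 27 * C B ^ 2 := by
    simp only [hD, map_add, map_mul, map_pow, map_ofNat]
  rw [h2] at h1
  linear_combination h1

lemma equation_shortWeierstrass {A B : K} {M : Type*} [Field M] [Algebra K M] {x y : M} :
    ((shortWeierstrass A B).baseChange M).Equation x y ↔ y ^ 2 = aeval x (cubic A B) := by
  rw [equation_iff]
  simp [WeierstrassCurve.Affine.baseChange, shortWeierstrass]

lemma isModel_shortWeierstrass (A B : K) :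
    IsModel (cubic A B) (xFun (shortWeierstrass A B)) (yFun (shortWeierstrass A B)) where
  transcendental := transcendental_xFun _
  sq := equation_shortWeierstrass.mp (equation_xFun_yFun _)
  adjoin_eq_top := adjoin_xFun_yFun _

end Cubic

/-! ### Translations as automorphisms of the function field -/

section Translation

open WeierstrassCurve WeierstrassCurve.Affine

variable {K : Type*} [Field K]

lemma exists_genericPoint_eq (W : Affine K) [W.IsElliptic] :
    ∃ h, genericPoint W = .some (xFun W) (yFun W) h := ⟨_, rfl⟩

open scoped Classical in
-- Used with `K'` the algebraic closure of `K` in the function field: the generic point is not a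
-- combination of points with algebraic coordinates.
lemma genericPoint_ne_map (W : Affine K) [W.IsElliptic] (K' : IntermediateField K W.FunctionField)
    (hK' : xFun W ∉ K') (T : (W.baseChange K').Point) :
    genericPoint W ≠ Point.map (W' := W) K'.val T := by
  obtain ⟨h, hη⟩ := exists_genericPoint_eq W
  rw [hη]
  intro h'
  rcases T with _ | ⟨a, b, hab⟩
  · exact Point.some_ne_zero h h'
  · rw [Point.map_some] at h'
    apply hK'
    injection h' with h1 h2
    rw [h1]
    exact a.2

lemma xFun_notMem_algebraicClosure (W : Affine K) :
    xFun W ∉ algebraicClosure K W.FunctionField := by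
  intro h
  exact transcendental_xFun W (mem_algebraicClosure_iff.mp h)

open scoped Classical in
-- The point `η + T` is affine with transcendental `x`-coordinate. Otherwise it would have
-- coordinates algebraic over `K`, and so would `η`, obtained by subtracting `T`.
lemma exists_algHom_translation {W : Affine K} [W.IsElliptic] {A B : K}
    (hW : W = shortWeierstrass A B) (T : (W.baseChange K).Point) :
    ∃ φ : W.FunctionField →ₐ[K] W.FunctionField, Point.map (W' := W) φ (genericPoint W) =
      genericPoint W + Point.map (W' := W) (Algebra.ofId K W.FunctionField) T := by
  have hsq : ∀ a b : W.FunctionField, (W.baseChange W.FunctionField).Equation a b →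
      b ^ 2 = aeval a (cubic A B) := by
    subst hW
    exact fun a b => equation_shortWeierstrass.mp
  set K' := algebraicClosure K W.FunctionField with hK'
  have hT : Point.map (W' := W) (Algebra.ofId K W.FunctionField) T =
      Point.map (W' := W) K'.val (Point.map (W' := W) (Algebra.ofId K K') T) := by
    rw [Point.map_map]
    congr 1
  have hx := xFun_notMem_algebraicClosure W
  rcases hR : genericPoint W + Point.map (W' := W) (Algebra.ofId K W.FunctionField) T with
    _ | ⟨a, b, hab⟩
  · exfalso
    refine genericPoint_ne_map W K' hx (- Point.map (W' := W) (Algebra.ofId K K') T) ?_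
    rw [map_neg, ← hT]
    exact eq_neg_of_add_eq_zero_left hR
  · have htr : Transcendental K a := by
      intro ha
      have hb : IsAlgebraic K b := by
        refine IsAlgebraic.of_pow two_pos ?_
        rw [hsq a b hab.1]
        simp only [cubic, map_add, map_mul, map_pow, aeval_X, aeval_C]
        exact ((ha.pow 3).add ((isAlgebraic_algebraMap A).mul ha)).add (isAlgebraic_algebraMap B)
      let a' : K' := ⟨a, mem_algebraicClosure_iff.mpr ha⟩
      let b' : K' := ⟨b, mem_algebraicClosure_iff.mpr hb⟩
      have hab' : (W.baseChange K').Nonsingular a' b' :=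
        (baseChange_nonsingular W (f := K'.val) K'.val.injective a' b').mp hab
      refine genericPoint_ne_map W K' hx
        (.some a' b' hab' - Point.map (W' := W) (Algebra.ofId K K') T) ?_
      rw [map_sub, ← hT, Point.map_some, eq_sub_iff_add_eq]
      exact hR
    obtain ⟨φ, h1, h2⟩ := exists_algHom_functionField hab.1 htr
    obtain ⟨h, hη⟩ := exists_genericPoint_eq W
    refine ⟨φ, ?_⟩
    rw [hη, Point.map_some]
    simp only [h1, h2]

open scoped Classical in
-- The endomorphisms attached to `T` and `-T` are mutually inverse, since both composites fix the
-- generic point.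
lemma exists_isTranslation {W : Affine K} [W.IsElliptic] {A B : K}
    (hW : W = shortWeierstrass A B) (T : (W.baseChange K).Point) :
    ∃ α, IsTranslation W T α := by
  have key : ∀ (T : (W.baseChange K).Point) (φ ψ : W.FunctionField →ₐ[K] W.FunctionField),
      Point.map (W' := W) φ (genericPoint W) =
        genericPoint W + Point.map (W' := W) (Algebra.ofId K _) T →
      Point.map (W' := W) ψ (genericPoint W) =
        genericPoint W + Point.map (W' := W) (Algebra.ofId K _) (-T) →
      φ.comp ψ = AlgHom.id K _ := by
    intro T φ ψ hφ hψ
    have h1 : Point.map (W' := W) (φ.comp ψ) (genericPoint W) = genericPoint W := by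
      rw [← Point.map_map, hψ, map_add, hφ, Point.map_map, map_neg,
        Subsingleton.elim (φ.comp (Algebra.ofId K W.FunctionField)) (Algebra.ofId K _)]
      abel
    obtain ⟨h, hη⟩ := exists_genericPoint_eq W
    rw [hη, Point.map_some] at h1
    injection h1 with h2 h3
    exact algHom_ext_xFun_yFun h2 h3
  obtain ⟨φ, hφ⟩ := exists_algHom_translation hW T
  obtain ⟨ψ, hψ⟩ := exists_algHom_translation hW (-T)
  exact ⟨AlgEquiv.ofAlgHom φ ψ (key T φ ψ hφ hψ)
    (key (-T) ψ φ hψ (by rw [neg_neg]; exact hφ)), hφ⟩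

open scoped Classical in
-- This is the chord formula for `η + (a, b)`, with `s` the slope of the chord.
lemma IsTranslation.apply {W : Affine K} [W.IsElliptic] {A B : K}
    (hW : W = shortWeierstrass A B) {a b : K} {h : (W.baseChange K).Nonsingular a b}
    {α : W.FunctionField ≃ₐ[K] W.FunctionField} (hα : IsTranslation W (.some a b h) α)
    {s : W.FunctionField} (hs : s * (xFun W - algebraMap K _ a) = yFun W - algebraMap K _ b) :
    α (xFun W) = s ^ 2 - xFun W - algebraMap K _ a ∧
      α (yFun W) = - (s * (α (xFun W) - xFun W) + yFun W) := by
  have ha₁ : W.a₁ = 0 := by rw [hW]; rfl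
  have ha₂ : W.a₂ = 0 := by rw [hW]; rfl
  have ha₃ : W.a₃ = 0 := by rw [hW]; rfl
  clear hW
  obtain ⟨hη', hη⟩ := exists_genericPoint_eq W
  have hne : xFun W ≠ algebraMap K W.FunctionField a := by
    intro h
    apply transcendental_xFun W
    rw [h]
    exact isAlgebraic_algebraMap a
  have hne' := sub_ne_zero.mpr hne
  have hsl : (W.baseChange W.FunctionField).slope (xFun W) (algebraMap K W.FunctionField a)
      (yFun W) (algebraMap K W.FunctionField b) = s := by
    rw [slope_of_X_ne hne, ← hs, mul_div_cancel_right₀ _ hne']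
  unfold IsTranslation at hα
  rw [hη, Point.map_some, Point.map_some] at hα
  erw [Point.add_of_X_ne hne] at hα
  injection hα with h1 h2
  have h1' : α (xFun W) = s ^ 2 - xFun W - algebraMap K _ a := by
    refine h1.trans ?_
    erw [hsl]
    simp [addX, WeierstrassCurve.baseChange, WeierstrassCurve.Affine.baseChange, ha₁, ha₂]
  refine ⟨h1', ?_⟩
  rw [h1']
  refine h2.trans ?_
  erw [hsl]
  simp [addX, addY, negAddY, negY, WeierstrassCurve.baseChange, WeierstrassCurve.Affine.baseChange,
    ha₁, ha₂, ha₃]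

end Translation

/-! ### Uniqueness of short Weierstrass equations up to scaling -/

section Scaling

variable {K M : Type*} [Field K] [Field M] [Algebra K M]

lemma IsModel.map {M' : Type*} [Field M'] [Algebra K M'] {f : K[X]} {x y : M} (H : IsModel f x y)
    (e : M ≃ₐ[K] M') : IsModel f (e x) (e y) where
  transcendental := fun h => H.transcendental ((isAlgebraic_algHom_iff (e : M →ₐ[K] M')
    e.injective).mp h)
  sq := by
    have := aeval_algHom_apply (e : M →ₐ[K] M') x f
    simp only [AlgEquiv.coe_toAlgHom] at this
    rw [this, ← H.sq, map_pow]
  adjoin_eq_top := by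
    have := adjoin_map K {x, y} (e : M →ₐ[K] M')
    rw [H.adjoin_eq_top, Set.image_pair, ← AlgHom.fieldRange_eq_map] at this
    rw [← AlgEquiv.coe_toAlgHom, ← this]
    exact AlgHom.fieldRange_eq_top.mpr e.surjective

lemma IsModel.exists_algEquiv {A B : K} {x y : M} (H : IsModel (cubic A B) x y) :
    ∃ φ : (shortWeierstrass A B).FunctionField ≃ₐ[K] M,
      φ (xFun _) = x ∧ φ (yFun _) = y :=
  exists_algEquiv_functionField (equation_shortWeierstrass.mpr H.sq) H.transcendental
    H.adjoin_eq_top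

lemma IsModel.neg {f : K[X]} {x y : M} (H : IsModel f x y) : IsModel f x (-y) where
  transcendental := H.transcendental
  sq := by rw [neg_sq, H.sq]
  adjoin_eq_top := by
    rw [eq_top_iff, ← H.adjoin_eq_top, adjoin_le_iff]
    rintro z (rfl | rfl)
    · exact subset_adjoin _ _ (by simp)
    · rw [SetLike.mem_coe, ← neg_mem_iff]
      exact subset_adjoin _ _ (by simp)

lemma IsModel.exists_involution {A B : K} {x y : M} (H : IsModel (cubic A B) x y) :
    ∃ w : M ≃ₐ[K] M, w x = x ∧ w y = - y := by
  obtain ⟨φ, h1, h2⟩ := H.exists_algEquiv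
  obtain ⟨ψ, h3, h4⟩ := H.neg.exists_algEquiv
  refine ⟨φ.symm.trans ψ, ?_, ?_⟩
  · conv_lhs => rw [← h1]
    simp [h3]
  · conv_lhs => rw [← h2]
    simp [h4]

/-- The residue field at the pole of `x` is `K`. -/
lemma IsModel.exists_sub_mem_nonunits {f : K[X]} {x y : M} (H : IsModel f x y)
    (hf : Odd f.natDegree) {V : ValuationSubring M} (hV : ∀ a : K, algebraMap K M a ∈ V)
    (hx : x ∉ V) {h : M} (hh : h ∈ V) : ∃ c : K, h - algebraMap K M c ∈ V.nonunits := by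
  obtain ⟨p, q, r, hr, e⟩ := H.exists_repr h
  obtain ⟨h1, h2⟩ := (H.mem_iff hf hV hx hr e).mp hh
  have hf0 : f ≠ 0 := by
    rintro rfl
    simp at hf
  have hlt : 1 < V.valuation x := by rwa [← not_le, V.valuation_le_one_iff]
  have hvr := valuation_aeval hV hx hr
  have hpos : (0 : V.ValueGroup) < V.valuation x ^ r.natDegree :=
    pow_pos (zero_lt_one.trans hlt) _
  -- The limit of `p/r` at the pole: a ratio of leading coefficients, and `0` when `deg p < deg r`.
  -- The term `q y / r` tends to `0`, because its order is odd.
  let c := p.coeff r.natDegree / r.leadingCoeff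
  refine ⟨c, ?_⟩
  have h3 : (h - algebraMap K M c) * aeval x r = aeval x (p - C c * r) + aeval x q * y := by
    simp only [map_sub, map_mul, aeval_C]
    linear_combination e
  rw [V.mem_nonunits_iff]
  refine lt_of_mul_lt_mul_right (a := V.valuation x ^ r.natDegree) ?_ hpos.le
  rw [one_mul]
  conv_lhs => rw [← hvr, ← map_mul, h3]
  apply V.valuation.map_add_lt
  · by_cases hp : p - C c * r = 0
    · rw [hp, map_zero, map_zero]
      exact hpos
    · rw [valuation_aeval hV hx hp]
      refine pow_lt_pow_right₀ hlt ?_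
      have hle : (p - C c * r).natDegree ≤ r.natDegree := by
        refine (natDegree_sub_le _ _).trans (max_le ?_ (natDegree_C_mul_le c r))
        rcases h1 with h | h
        · simp [h]
        · exact h
      refine lt_of_le_of_ne hle fun heq => hp ?_
      rw [← leadingCoeff_eq_zero, leadingCoeff, heq, coeff_sub, coeff_C_mul]
      have : r.leadingCoeff ≠ 0 := leadingCoeff_ne_zero.mpr hr
      simp only [c, leadingCoeff] at this ⊢
      field_simp
      ring
  · by_cases hq : q = 0
    · rw [hq, map_zero, zero_mul, map_zero]
      exact hpos
    · have h4 := h2.resolve_left hq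
      rw [← pow_lt_pow_iff_left₀ zero_le zero_le two_ne_zero, ← map_pow, mul_pow, H.sq, map_mul,
        map_pow, valuation_aeval hV hx hq, valuation_aeval hV hx hf0, ← pow_mul, ← pow_mul,
        ← pow_add]
      refine pow_lt_pow_right₀ hlt ?_
      obtain ⟨k, hk⟩ := hf
      omega

/-- Since `x⁻¹` is not a unit of the polynomial ring `K[x⁻¹]`, some valuation ring over this ring
has it in its maximal ideal. -/
lemma exists_notMem_of_transcendental {x : M} (hx : Transcendental K x) :
    ∃ V : ValuationSubring M, (∀ a : K, algebraMap K M a ∈ V) ∧ x ∉ V := by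
  have hs : Transcendental K x⁻¹ := fun h => hx (IsAlgebraic.inv_iff.mp h)
  obtain ⟨V, hA, hV⟩ := exists_valuationSubring (A := (aeval x⁻¹ : K[X] →ₐ[K] M).range)
    (a := x⁻¹) ⟨X, by simp⟩ (by
      rintro ⟨p, hp⟩
      have hp' : aeval x⁻¹ p = x⁻¹⁻¹ := hp
      have h1 : aeval x⁻¹ (X * p) = aeval x⁻¹ (1 : K[X]) := by
        rw [map_mul, hp', aeval_X, map_one]
        refine mul_inv_cancel₀ fun h0 => hs ?_
        rw [h0]
        exact isAlgebraic_zero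
      exact not_isUnit_X (IsUnit.of_mul_eq_one _ (aeval_inj hs h1)))
  refine ⟨V, fun a => hA _ ⟨C a, by simp⟩, ?_⟩
  rw [V.inv_mem_nonunits_iff] at hV
  refine hV.resolve_left ?_
  rintro rfl
  exact hx isAlgebraic_zero

lemma exists_of_natDegree_le_one {p : K[X]} (h : p = 0 ∨ p.natDegree ≤ 1) :
    ∃ α β, p = C α * X + C β := by
  refine ⟨p.coeff 1, p.coeff 0, eq_X_add_C_of_natDegree_le_one ?_⟩
  rcases h with rfl | h
  · simp
  · exact h

lemma IsModel.eq_linear {A B : K} {x y : M} (H : IsModel (cubic A B) x y)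
    {V : ValuationSubring M} (hV : ∀ a : K, algebraMap K M a ∈ V) (hx : x ∉ V) {p q : K[X]}
    (h : (aeval x p + aeval x q * y) / x ∈ V) :
    ∃ α β : K, aeval x p + aeval x q * y = algebraMap K M α * x + algebraMap K M β := by
  have hx0 : x ≠ 0 := by
    rintro rfl
    exact hx V.zero_mem
  obtain ⟨h1, h2⟩ := (H.mem_iff (odd_natDegree_cubic A B) hV hx (r := X) (p := p) (q := q) X_ne_zero
    (by rw [aeval_X, div_mul_cancel₀ _ hx0])).mp h
  rw [natDegree_cubic, natDegree_X] at h2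
  have hq : q = 0 := by
    by_contra hq
    have := h2.resolve_left hq
    omega
  rw [natDegree_X] at h1
  obtain ⟨α, β, rfl⟩ := exists_of_natDegree_le_one h1
  exact ⟨α, β, by simp [hq]⟩

lemma IsModel.eq_affine {A B : K} {x y : M} (H : IsModel (cubic A B) x y)
    {V : ValuationSubring M} (hV : ∀ a : K, algebraMap K M a ∈ V) (hx : x ∉ V) {p q : K[X]}
    (h : (aeval x p + aeval x q * y) / y ∈ V) :
    ∃ γ δ ε : K, aeval x p + aeval x q * y =
      algebraMap K M γ + algebraMap K M δ * x + algebraMap K M ε * y := by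
  have hf : cubic A B ≠ 0 := by
    intro h
    have := natDegree_cubic A B
    simp [h] at this
  have hy0 : y ≠ 0 := by
    intro h
    have := H.sq
    rw [h, zero_pow two_ne_zero] at this
    exact aeval_ne_zero H.transcendental hf this.symm
  -- Multiplying numerator and denominator by `y` gives `(p + q y)/y = (q f + p y)/f`, so the roles
  -- of `p` and `q` are exchanged. The degree bounds are then `deg q ≤ 0` and `deg p ≤ 1`.
  obtain ⟨h1, h2⟩ := (H.mem_iff (odd_natDegree_cubic A B) hV hx (r := cubic A B)
    (p := q * cubic A B) (q := p) hf
    (by rw [map_mul, ← H.sq]; field_simp; ring)).mp h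
  simp only [natDegree_cubic] at h1 h2
  have hq : ∃ ε, q = C ε := by
    by_cases hq : q = 0
    · exact ⟨0, by simp [hq]⟩
    · have := h1.resolve_left (mul_ne_zero hq hf)
      rw [natDegree_mul hq hf, natDegree_cubic] at this
      exact ⟨_, eq_C_of_natDegree_eq_zero (by omega)⟩
  obtain ⟨ε, rfl⟩ := hq
  obtain ⟨δ, γ, rfl⟩ := exists_of_natDegree_le_one (h2.imp_right (by omega))
  exact ⟨γ, δ, ε, by simp; ring⟩

/-- Comparing with the image under `y ↦ -y` removes the cross term. The absence of quadratic terms,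
with `2` and `3` invertible, then reduces the substitution to `x' = αx`, `y' = εy`. -/
lemma scaling_of_affine (h2 : (2 : K) ≠ 0) (h3 : (3 : K) ≠ 0) {A B A' B' : K}
    {x y : M} (H : IsModel (cubic A B) x y) {α β γ δ ε : K} (hα : α ≠ 0)
    (h : (algebraMap K M γ + algebraMap K M δ * x + algebraMap K M ε * y) ^ 2 =
      aeval (algebraMap K M α * x + algebraMap K M β) (cubic A' B')) :
    ∃ c : K, c ≠ 0 ∧ A' = c ^ 4 * A ∧ B' = c ^ 6 * B := by
  obtain ⟨w, hwx, hwy⟩ := H.exists_involution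
  have hw := congrArg w h
  have h2' : (2 : M) ≠ 0 := by
    have := (map_ne_zero (algebraMap K M)).mpr h2
    rwa [map_ofNat] at this
  have hf : cubic A B ≠ 0 := by
    intro h
    have := natDegree_cubic A B
    simp [h] at this
  have hy0 : y ≠ 0 := by
    intro h
    have := H.sq
    rw [h, zero_pow two_ne_zero] at this
    exact aeval_ne_zero H.transcendental hf this.symm
  simp only [cubic, map_pow, map_add, map_mul, hwx, hwy, w.commutes, aeval_X, aeval_C] at hw h
  have hsq := H.sq
  simp only [cubic, map_pow, map_add, map_mul, aeval_X, aeval_C] at hsq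
  have hcross : algebraMap K M ε * (algebraMap K M γ + algebraMap K M δ * x) = 0 := by
    have : (4 * y) * (algebraMap K M ε * (algebraMap K M γ + algebraMap K M δ * x)) = 0 := by
      linear_combination h - hw
    refine (mul_eq_zero.mp this).resolve_left (mul_ne_zero ?_ hy0)
    have : (4 : M) = 2 * 2 := by norm_num
    rw [this]
    exact mul_ne_zero h2' h2'
  have hpoly : (C γ + C δ * X) ^ 2 + C (ε ^ 2) * (X ^ 3 + C A * X + C B) =
      (C α * X + C β) ^ 3 + C A' * (C α * X + C β) + C B' := by
    apply aeval_inj H.transcendental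
    simp only [map_pow, map_add, map_mul, aeval_X, aeval_C]
    linear_combination h - 2 * y * hcross - algebraMap K M ε ^ 2 * hsq
  have hcoeff : (⟨ε ^ 2, δ ^ 2, 2 * γ * δ + ε ^ 2 * A, γ ^ 2 + ε ^ 2 * B⟩ : Cubic K) =
      ⟨α ^ 3, 3 * α ^ 2 * β, 3 * α * β ^ 2 + A' * α, β ^ 3 + A' * β + B'⟩ := by
    apply (Cubic.toPoly_injective _ _).mp
    simp only [Cubic.toPoly, map_add, map_mul, map_pow, map_ofNat] at hpoly ⊢
    linear_combination hpoly
  obtain ⟨e3, e2, e1, e0⟩ := Cubic.mk.inj hcoeff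
  have hε : ε ≠ 0 := by
    rintro rfl
    rw [zero_pow two_ne_zero] at e3
    exact pow_ne_zero 3 hα e3.symm
  have hγδ : (⟨0, 0, δ, γ⟩ : Cubic K) = ⟨0, 0, 0, 0⟩ := by
    apply (Cubic.toPoly_injective _ _).mp
    apply aeval_inj H.transcendental
    have := (mul_eq_zero.mp hcross).resolve_left ((_root_.map_ne_zero _).mpr hε)
    simp [Cubic.toPoly]
    linear_combination this
  obtain ⟨-, -, rfl, rfl⟩ := Cubic.mk.inj hγδ
  have hβ : β = 0 := by
    have : 3 * α ^ 2 * β = 0 := by rw [← e2]; ring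
    exact (mul_eq_zero.mp this).resolve_left (mul_ne_zero h3 (pow_ne_zero 2 hα))
  subst hβ
  -- From `ε² = α³` one has `α = (ε/α)²` and `ε = (ε/α)³`.
  refine ⟨ε / α, div_ne_zero hε hα, ?_, ?_⟩
  · field_simp
    linear_combination (- α ^ 3) * e1 - A * ε ^ 2 * e3
  · field_simp
    linear_combination (- α ^ 6) * e0 - B * ε ^ 2 * (ε ^ 2 + α ^ 3) * e3

/-- The common pole is the only pole of `x` and of `x'`, so each pair of coordinates is polynomial
in the other pair. Comparing growth at the pole makes the change of coordinates affine. -/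
lemma scaling_of_common_pole (h2 : (2 : K) ≠ 0) (h3 : (3 : K) ≠ 0) {A B A' B' : K}
    (hd : 4 * A ^ 3 + 27 * B ^ 2 ≠ 0) (hd' : 4 * A' ^ 3 + 27 * B' ^ 2 ≠ 0) {x y x' y' : M}
    (H : IsModel (cubic A B) x y) (H' : IsModel (cubic A' B') x' y') {V : ValuationSubring M}
    (hV : ∀ a : K, algebraMap K M a ∈ V) (hx : x ∉ V) (hx' : x' ∉ V) :
    ∃ c : K, c ≠ 0 ∧ A' = c ^ 4 * A ∧ B' = c ^ 6 * B := by
  obtain ⟨w, hwx, hwy⟩ := H.exists_involution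
  obtain ⟨w', hwx', hwy'⟩ := H'.exists_involution
  have hodd := odd_natDegree_cubic A B
  have hodd' := odd_natDegree_cubic A' B'
  have hreg : ∀ W : ValuationSubring M, (∀ a : K, algebraMap K M a ∈ W) → (x ∈ W ↔ x' ∈ W) := by
    intro W hW
    rw [← not_iff_not]
    constructor
    · intro h
      rwa [H.valuationSubring_unique hodd hW hV h hx]
    · intro h
      rwa [H'.valuationSubring_unique hodd' hW hV h hx']
  have hmem : ∀ W : ValuationSubring M, (∀ a : K, algebraMap K M a ∈ W) → x ∈ W → y' ∈ W := by
    intro W hW hxW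
    have := H'.mem_of_mem hW ((hreg W hW).mp hxW) 0 1
    simpa using this
  have hmem' : ∀ W : ValuationSubring M, (∀ a : K, algebraMap K M a ∈ W) → x' ∈ W → y ∈ W := by
    intro W hW hxW
    have := H.mem_of_mem hW ((hreg W hW).mpr hxW) 0 1
    simpa using this
  obtain ⟨p, q, e⟩ := H.exists_of_forall_mem h2 hwx hwy (squarefree_cubic hd) (h := x')
    fun W hW => (hreg W hW).mp
  obtain ⟨p', q', e'⟩ := H'.exists_of_forall_mem h2 hwx' hwy' (squarefree_cubic hd') (h := x)
    fun W hW => (hreg W hW).mpr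
  obtain ⟨r, s, g⟩ := H.exists_of_forall_mem h2 hwx hwy (squarefree_cubic hd) (h := y') hmem
  obtain ⟨r', s', g'⟩ := H'.exists_of_forall_mem h2 hwx' hwy' (squarefree_cubic hd') (h := y) hmem'
  have hlin : ∃ α β : K, α ≠ 0 ∧ x' = algebraMap K M α * x + algebraMap K M β := by
    -- One of `x'/x`, `x/x'` is regular at the pole, so one coordinate is a linear polynomial in the
    -- other; in the second case the relation is inverted.
    rcases V.mem_or_inv_mem (x' / x) with h | h
    · rw [e] at h
      obtain ⟨α, β, h⟩ := H.eq_linear hV hx h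
      refine ⟨α, β, ?_, e.trans h⟩
      rintro rfl
      rw [← e] at h
      apply H'.transcendental
      rw [h, map_zero, zero_mul, zero_add]
      exact isAlgebraic_algebraMap β
    · rw [inv_div, e'] at h
      obtain ⟨α, β, h⟩ := H'.eq_linear hV hx' h
      rw [← e'] at h
      have hα : α ≠ 0 := by
        rintro rfl
        apply H.transcendental
        rw [h, map_zero, zero_mul, zero_add]
        exact isAlgebraic_algebraMap β
      have hα' : algebraMap K M α ≠ 0 := (_root_.map_ne_zero _).mpr hα
      refine ⟨α⁻¹, - (α⁻¹ * β), inv_ne_zero hα, ?_⟩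
      rw [h]
      simp only [map_neg, map_mul, map_inv₀]
      field_simp
      ring
  obtain ⟨α, β, hα, hlin⟩ := hlin
  have haff : ∃ γ δ ε : K, y' = algebraMap K M γ + algebraMap K M δ * x + algebraMap K M ε * y := by
    rcases V.mem_or_inv_mem (y' / y) with h | h
    · rw [g] at h
      obtain ⟨γ, δ, ε, h⟩ := H.eq_affine hV hx h
      exact ⟨γ, δ, ε, g.trans h⟩
    · rw [inv_div, g'] at h
      obtain ⟨γ, δ, ε, h⟩ := H'.eq_affine hV hx' h
      rw [← g'] at h
      -- Otherwise `y` would be a polynomial in `x`, hence fixed by `w`.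
      have hε : ε ≠ 0 := by
        rintro rfl
        have h4 : w y = y := by
          rw [h, hlin]
          simp [hwx]
        rw [hwy] at h4
        have h2' : (2 : M) ≠ 0 := by
          have := (map_ne_zero (algebraMap K M)).mpr h2
          rwa [map_ofNat] at this
        have hy : y = 0 := mul_left_cancel₀ h2' (by linear_combination - h4)
        have hsq := H.sq
        rw [hy, zero_pow two_ne_zero] at hsq
        exact aeval_ne_zero H.transcendental (squarefree_cubic hd).ne_zero hsq.symm
      have hε' : algebraMap K M ε ≠ 0 := (_root_.map_ne_zero _).mpr hε
      refine ⟨- (ε⁻¹ * (γ + δ * β)), - (ε⁻¹ * δ * α), ε⁻¹, ?_⟩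
      simp only [map_neg, map_mul, map_add, map_inv₀]
      field_simp
      linear_combination - h - algebraMap K M δ * hlin
  obtain ⟨γ, δ, ε, haff⟩ := haff
  have hsq' := H'.sq
  rw [haff, hlin] at hsq'
  exact scaling_of_affine h2 h3 H hα hsq'

open WeierstrassCurve WeierstrassCurve.Affine in
/-- Two short Weierstrass equations of an elliptic function field differ by a scaling. -/
theorem IsModel.scaling (h2 : (2 : K) ≠ 0) (h3 : (3 : K) ≠ 0) {A B A' B' : K}
    (hd : 4 * A ^ 3 + 27 * B ^ 2 ≠ 0) (hd' : 4 * A' ^ 3 + 27 * B' ^ 2 ≠ 0) {x y x' y' : M}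
    (H : IsModel (cubic A B) x y) (H' : IsModel (cubic A' B') x' y') :
    ∃ c : K, c ≠ 0 ∧ A' = c ^ 4 * A ∧ B' = c ^ 6 * B := by
  obtain ⟨V, hV, hx'⟩ := exists_notMem_of_transcendental H'.transcendental
  by_cases hx : x ∉ V
  · exact scaling_of_common_pole h2 h3 hd hd' H H' hV hx hx'
  rw [not_not] at hx
  have hy : y ∈ V := by simpa using H.mem_of_mem hV hx 0 1
  -- If `x` is regular at the pole of `x'`, then `(x, y)` reduces there to a `K`-rational point `(a,
  -- b)`, as the residue field is `K`.
  obtain ⟨a, ha⟩ := H'.exists_sub_mem_nonunits (odd_natDegree_cubic _ _) hV hx' hx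
  obtain ⟨b, hb⟩ := H'.exists_sub_mem_nonunits (odd_natDegree_cubic _ _) hV hx' hy
  have hmul : ∀ {z t : M}, z ∈ V → t ∈ V.nonunits → z * t ∈ V.nonunits := by
    intro z t hz ht
    rw [V.mem_nonunits_iff] at ht ⊢
    rw [map_mul]
    exact mul_lt_one_of_nonneg_of_lt_one_right ((V.valuation_le_one_iff _).mpr hz) zero_le ht
  have hconst : ∀ c : K, algebraMap K M c ∈ V.nonunits → c = 0 := by
    intro c hc
    by_contra hc0
    have := (isTrivialOn_valuation hV).eq_one c hc0
    rw [V.mem_nonunits_iff, this] at hc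
    exact lt_irrefl _ hc
  have hsq := H.sq
  simp only [cubic, map_pow, map_add, map_mul, aeval_X, aeval_C] at hsq
  have hab : b ^ 2 = a ^ 3 + A * a + B := by
    rw [← sub_eq_zero]
    apply hconst
    have h1 : algebraMap K M (b ^ 2 - (a ^ 3 + A * a + B)) =
        (x ^ 2 + x * algebraMap K M a + algebraMap K M a ^ 2 + algebraMap K M A) *
          (x - algebraMap K M a) - (y + algebraMap K M b) * (y - algebraMap K M b) := by
      simp only [map_sub, map_add, map_mul, map_pow]
      linear_combination hsq
    rw [h1]
    refine sub_mem (hmul ?_ ha) (hmul (add_mem hy (hV b)) hb)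
    exact add_mem (add_mem (add_mem (pow_mem hx 2) (mul_mem hx (hV a))) (pow_mem (hV a) 2)) (hV A)
  have hell : (shortWeierstrass A B).IsElliptic := by
    rw [WeierstrassCurve.isElliptic_iff, isUnit_iff_ne_zero]
    simp only [shortWeierstrass, WeierstrassCurve.Δ, WeierstrassCurve.b₂, WeierstrassCurve.b₄,
      WeierstrassCurve.b₆, WeierstrassCurve.b₈]
    intro h
    have h16 : (16 : K) ≠ 0 := by
      have : (16 : K) = 2 ^ 4 := by norm_num
      rw [this]
      exact pow_ne_zero 4 h2
    refine mul_ne_zero h16 hd ?_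
    linear_combination - h
  have heq : ((shortWeierstrass A B).baseChange K).Equation a (-b) := by
    rw [equation_shortWeierstrass, neg_sq, hab]
    simp [cubic]
  have hns : ((shortWeierstrass A B).baseChange K).Nonsingular a (-b) := by
    have : ((shortWeierstrass A B).baseChange K).IsElliptic :=
      inferInstanceAs ((shortWeierstrass A B).map (algebraMap K K)).IsElliptic
    exact equation_iff_nonsingular.mp heq
  -- Translation by `-(a, b) = (a, -b)` moves this reduction to the origin, so the translated `x`
  -- has its pole at `V` and the common-pole case applies.
  obtain ⟨α, hα⟩ := exists_isTranslation rfl (.some a (-b) hns)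
  obtain ⟨φ, hφx, hφy⟩ := H.exists_algEquiv
  have hxa : x - algebraMap K M a ≠ 0 := by
    rw [sub_ne_zero]
    intro h
    apply H.transcendental
    rw [h]
    exact isAlgebraic_algebraMap a
  set s := (y + algebraMap K M b) / (x - algebraMap K M a) with hs
  have hs' : s * (x - algebraMap K M a) = y + algebraMap K M b := div_mul_cancel₀ _ hxa
  have hα1 := (hα.apply rfl (s := φ.symm s) (by
    apply φ.injective
    simp only [map_mul, map_sub, AlgEquiv.apply_symm_apply, hφx, hφy, AlgEquiv.commutes, hs', map_neg,
      sub_neg_eq_add, map_add])).1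
  have hα1' := congrArg φ hα1
  simp only [map_sub, map_pow, AlgEquiv.apply_symm_apply, hφx, AlgEquiv.commutes] at hα1'
  refine scaling_of_common_pole h2 h3 hd hd'
    ((isModel_shortWeierstrass A B).map (α.trans φ)) H' hV ?_ hx'
  rw [AlgEquiv.trans_apply, hα1']
  -- If the translated `x` were regular, the slope `s` would be too. Reducing `s (x - a) = y + b`
  -- gives `b = 0`, and reducing `s² (x - a)` gives `3a² + A = 0`, so `a` would be a double root of
  -- the cubic.
  intro hmem
  have hsV : s ∈ V := by
    apply mem_of_sq_mem
    have : s ^ 2 = (s ^ 2 - x - algebraMap K M a) + x + algebraMap K M a := by ring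
    rw [this]
    exact add_mem (add_mem hmem hx) (hV a)
  have hb0 : b = 0 := by
    have h4 : 2 * b = 0 := by
      apply hconst
      have : algebraMap K M (2 * b) = s * (x - algebraMap K M a) - (y - algebraMap K M b) := by
        rw [hs', map_mul, map_ofNat]
        ring
      rw [this]
      exact sub_mem (hmul hsV ha) hb
    exact (mul_eq_zero.mp h4).resolve_left h2
  subst hb0
  rw [map_zero, add_zero] at hs'
  have hder : 3 * a ^ 2 + A = 0 := by
    apply hconst
    have h5 : s ^ 2 * (x - algebraMap K M a) = x ^ 2 + x * algebraMap K M a +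
        algebraMap K M a ^ 2 + algebraMap K M A := by
      apply mul_left_cancel₀ hxa
      have h6 := congrArg (algebraMap K M) hab
      simp only [map_pow, map_add, map_mul, map_zero] at h6
      linear_combination (s * (x - algebraMap K M a) + y) * hs' + hsq - h6
    have : algebraMap K M (3 * a ^ 2 + A) = s ^ 2 * (x - algebraMap K M a) -
        (x + 2 * algebraMap K M a) * (x - algebraMap K M a) := by
      rw [h5]
      simp only [map_add, map_mul, map_pow, map_ofNat]
      ring
    rw [this]
    refine sub_mem (hmul (pow_mem hsV 2) ha) (hmul (add_mem hx ?_) ha)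
    have := hV (2 * a)
    rwa [map_mul, map_ofNat] at this
  apply hd
  -- The Bézout identity for the discriminant, evaluated at the common root `a`.
  linear_combination (6 * A * a ^ 2 - 9 * B * a + 4 * A ^ 2) * hder + (18 * A * a - 27 * B) * hab

end Scaling

/-! ### The quotient by a rational two-torsion point -/

section Isogeny

open WeierstrassCurve WeierstrassCurve.Affine

variable {K : Type*} [Field K]

/-- The quotient of `y² = x³ + b x² + c x` by `(0, 0)`. -/
def isogenousCurve (b c : K) : Affine K := ⟨0, -2 * b, 0, b ^ 2 - 4 * c, 0⟩

lemma isElliptic_isogenousCurve (h2 : (2 : K) ≠ 0) {b c : K} (hc : c ≠ 0)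
    (hbc : b ^ 2 - 4 * c ≠ 0) : (isogenousCurve b c).IsElliptic := by
  rw [WeierstrassCurve.isElliptic_iff, isUnit_iff_ne_zero]
  have : WeierstrassCurve.Δ (isogenousCurve b c) = 2 ^ 8 * c * (b ^ 2 - 4 * c) ^ 2 := by
    simp only [isogenousCurve, WeierstrassCurve.Δ, WeierstrassCurve.b₂, WeierstrassCurve.b₄,
      WeierstrassCurve.b₆, WeierstrassCurve.b₈]
    ring
  rw [this]
  exact mul_ne_zero (mul_ne_zero (pow_ne_zero 8 h2) hc) (pow_ne_zero 2 hbc)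

lemma equation_isogenousCurve {b c : K} {M : Type*} [Field M] [Algebra K M] {x y : M} :
    ((isogenousCurve b c).baseChange M).Equation x y ↔
      y ^ 2 = x ^ 3 - 2 * algebraMap K M b * x ^ 2 +
        (algebraMap K M b ^ 2 - 4 * algebraMap K M c) * x := by
  rw [equation_iff]
  simp only [WeierstrassCurve.Affine.baseChange, WeierstrassCurve.baseChange, isogenousCurve,
    WeierstrassCurve.map_a₁, WeierstrassCurve.map_a₂, WeierstrassCurve.map_a₃,
    WeierstrassCurve.map_a₄, WeierstrassCurve.map_a₆, map_zero, map_mul, map_neg, map_sub, map_pow,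
    map_ofNat]
  constructor <;> intro h <;> linear_combination h

/-- In the coordinate `X = U - u` the cubic is `X (X² + 3u X + A + 3u²)`, and its discriminant
factors accordingly. -/
lemma discr_factor_ne_zero {A B u : K} [(shortWeierstrass A B).IsElliptic]
    (hu : u ^ 3 + A * u + B = 0) :
    A + 3 * u ^ 2 ≠ 0 ∧ (3 * u) ^ 2 - 4 * (A + 3 * u ^ 2) ≠ 0 := by
  have hd : 4 * A ^ 3 + 27 * B ^ 2 = - ((3 * u) ^ 2 - 4 * (A + 3 * u ^ 2)) * (A + 3 * u ^ 2) ^ 2 := by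
    linear_combination 27 * (B - u ^ 3 - A * u) * hu
  have := discr_ne_zero (A := A) (B := B)
  rw [hd] at this
  constructor
  · intro h
    apply this
    rw [h]
    ring
  · intro h
    apply this
    rw [h]
    ring

/-- With `X = x - u` and `s = y/X`, translation by `(u, 0)` sends `X` to `c/X` and `s` to `-s`,
hence changes the sign of `z = X - c/X`. The invariants `s²` and `s z` satisfy the equation of the
isogenous curve because `z² = (s² - b)² - 4c`, and adjoining `z` to them recovers `x` and `y`. -/
lemma nonempty_algEquiv_quotientField (h2 : (2 : K) ≠ 0) {M : Type*} [Field M] [Algebra K M]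
    {A B u : K} (hu : u ^ 3 + A * u + B = 0) (hc0 : A + 3 * u ^ 2 ≠ 0) {x y : M}
    (H : IsModel (cubic A B) x y) {α : M ≃ₐ[K] M}
    (key : ∀ s : M, s * (x - algebraMap K M u) = y →
      α x = s ^ 2 - x - algebraMap K M u ∧ α y = - (s * (α x - x) + y)) :
    Nonempty ((isogenousCurve (3 * u) (A + 3 * u ^ 2)).FunctionField ≃ₐ[K] quotientField α) := by
  have htr := H.transcendental
  have hsq := H.sq
  have htop := H.adjoin_eq_top
  have h2' : (2 : M) ≠ 0 := by
    have := (_root_.map_ne_zero (algebraMap K M)).mpr h2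
    rwa [map_ofNat] at this
  simp only [cubic, map_pow, map_add, map_mul, aeval_X, aeval_C] at hsq
  obtain ⟨X, hX⟩ : ∃ X, X = x - algebraMap K M u := ⟨_, rfl⟩
  obtain ⟨c, hc⟩ : ∃ c, c = algebraMap K M (A + 3 * u ^ 2) := ⟨_, rfl⟩
  obtain ⟨b, hb⟩ : ∃ b, b = algebraMap K M (3 * u) := ⟨_, rfl⟩
  have hcne : c ≠ 0 := by
    rw [hc]
    exact (_root_.map_ne_zero _).mpr hc0
  have hu' := congrArg (algebraMap K M) hu
  simp only [map_add, map_mul, map_pow, map_zero, map_ofNat] at hu' hc hb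
  have hX0 : X ≠ 0 := by
    rw [hX, sub_ne_zero]
    intro h
    apply htr
    rw [h]
    exact isAlgebraic_algebraMap u
  have hy2 : y ^ 2 = X * (X ^ 2 + b * X + c) := by
    rw [hX, hb, hc]
    linear_combination hsq + hu'
  obtain ⟨s, hs⟩ : ∃ s, s = y / X := ⟨_, rfl⟩
  have hsX : s * X = y := by rw [hs, div_mul_cancel₀ _ hX0]
  obtain ⟨hαx, hαy⟩ := key s (by rw [← hX, hsX])
  have hs2 : s ^ 2 = X + b + c / X := by
    field_simp
    apply mul_left_cancel₀ hX0
    linear_combination (s * X + y) * hsX + hy2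
  have hαX : α X = c / X := by
    have h1 : α X = α x - algebraMap K M u := by rw [hX, map_sub, α.commutes]
    rw [h1, hαx, hs2, hb]
    linear_combination hX
  have hαs : α s = - s := by
    have h1 : α y = - (s * (c / X)) := by
      rw [hαy]
      have h3 : α x = c / X + algebraMap K M u := by
        rw [← hαX, hX, map_sub, α.commutes]
        ring
      rw [h3]
      linear_combination - s * hX + hsX
    rw [hs, map_div₀, h1, hαX, ← hs]
    field_simp
  obtain ⟨z, hz⟩ : ∃ z, z = X - c / X := ⟨_, rfl⟩
  have hαz : α z = - z := by
    have hαc : α c = c := by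
      rw [hc, ← map_ofNat (algebraMap K M) 3, ← map_pow, ← map_mul, ← map_add, α.commutes]
    rw [hz, map_sub, map_div₀, hαX, hαc]
    field_simp
    ring
  have hz2 : z ^ 2 = (s ^ 2 - b) ^ 2 - 4 * c := by
    rw [hs2, hz]
    field_simp
    ring
  -- At a pole of `x` the function `X` has a pole while `c/X` is regular; hence `z ≠ 0`, and `s²`
  -- has a pole and is transcendental.
  obtain ⟨V, hV, hxV⟩ := exists_notMem_of_transcendental htr
  have hXV : X ∉ V := by
    intro h
    apply hxV
    have : x = X + algebraMap K M u := by rw [hX]; ring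
    rw [this]
    exact add_mem h (hV u)
  have hbV : b ∈ V := by
    have := hV (3 * u)
    rwa [map_mul, map_ofNat, ← hb] at this
  have hcV : c / X ∈ V := by
    have := hV (A + 3 * u ^ 2)
    simp only [map_add, map_mul, map_pow, map_ofNat, ← hc] at this
    rw [div_eq_mul_inv]
    exact mul_mem this ((V.mem_or_inv_mem X).resolve_left hXV)
  have hz0 : z ≠ 0 := by
    intro h
    apply hXV
    rw [hz, sub_eq_zero] at h
    rwa [h]
  have hstr : Transcendental K (s ^ 2) := by
    apply transcendental_of_notMem hV
    intro h
    apply hXV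
    have : X = s ^ 2 - b - c / X := by rw [hs2]; ring
    rw [this]
    exact sub_mem (sub_mem h hbV) hcV
  have heq : ((isogenousCurve (3 * u) (A + 3 * u ^ 2)).baseChange M).Equation (s ^ 2) (- (s * z)) := by
    rw [equation_isogenousCurve]
    simp only [map_add, map_mul, map_pow, map_ofNat, ← hc, ← hb]
    rw [neg_sq, mul_pow, hz2]
    ring
  obtain ⟨φ, hφx, hφy⟩ := exists_algHom_functionField heq hstr
  have hrange := fieldRange_functionField φ
  rw [hφx, hφy] at hrange
  have hquot : quotientField α = φ.fieldRange := by
    have hs2mem : s ^ 2 ∈ φ.fieldRange := ⟨_, hφx⟩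
    have hszmem : - (s * z) ∈ φ.fieldRange := ⟨_, hφy⟩
    have hbmem : b ∈ φ.fieldRange := by
      have := φ.fieldRange.algebraMap_mem (3 * u)
      rwa [map_mul, map_ofNat, ← hb] at this
    have hcmem : c ∈ φ.fieldRange := by
      have := φ.fieldRange.algebraMap_mem (A + 3 * u ^ 2)
      simpa only [map_add, map_mul, map_pow, map_ofNat, ← hc] using this
    refine quotientField_eq_of_sq_mem h2 ?_ hαz ?_ htop ?_
    · rw [hrange, adjoin_le_iff]
      rintro t (rfl | rfl)
      · rw [SetLike.mem_coe, mem_quotientField, map_pow, hαs, neg_sq]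
      · rw [SetLike.mem_coe, mem_quotientField, map_neg, map_mul, hαs, hαz, neg_mul_neg]
    · rw [hz2]
      exact sub_mem (pow_mem (sub_mem hs2mem hbmem) 2) (mul_mem (ofNat_mem _ 4) hcmem)
    · set S := φ.fieldRange
      have hS : ∀ t ∈ S, t ∈ S⟮z⟯ := fun t ht => S⟮z⟯.algebraMap_mem ⟨t, ht⟩
      have hzmem : z ∈ S⟮z⟯ := mem_adjoin_simple_self S z
      have hXmem : X ∈ S⟮z⟯ := by
        have : X = (s ^ 2 - b + z) / 2 := by
          rw [hs2, hz]
          field_simp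
          ring
        rw [this]
        exact div_mem (add_mem (sub_mem (hS _ hs2mem) (hS _ hbmem)) hzmem) (ofNat_mem _ 2)
      have hsmem : s ∈ S⟮z⟯ := by
        have : s = - (- (s * z)) / z := by
          field_simp
        rw [this]
        exact div_mem (neg_mem (hS _ hszmem)) hzmem
      rintro t (rfl | rfl)
      · have : t = X + algebraMap K M u := by rw [hX]; ring
        rw [this]
        exact add_mem hXmem (hS _ (S.algebraMap_mem u))
      · rw [← hsX]
        exact mul_mem hsmem hXmem
  exact ⟨(AlgEquiv.ofInjectiveField φ).trans (equivOfEq hquot.symm)⟩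

open scoped Classical in
lemma isQuotientBy_isogenousCurve (h2 : (2 : K) ≠ 0) {A B u : K} [(shortWeierstrass A B).IsElliptic]
    (hu : u ^ 3 + A * u + B = 0) (h : ((shortWeierstrass A B).baseChange K).Nonsingular u 0) :
    IsQuotientBy (shortWeierstrass A B) (.some u 0 h)
      (isogenousCurve (3 * u) (A + 3 * u ^ 2)) := by
  obtain ⟨α, hα⟩ := exists_isTranslation rfl (.some u 0 h)
  refine ⟨α, hα, nonempty_algEquiv_quotientField h2 hu (discr_factor_ne_zero hu).1
    (isModel_shortWeierstrass A B) fun s hs => hα.apply rfl ?_⟩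
  rw [hs, map_zero, sub_zero]

end Isogeny

/-! ### The Jacobian of `y² = d x⁴ + b x² + c` -/

section Jacobian

open WeierstrassCurve WeierstrassCurve.Affine

lemma some_congr {R : Type*} [CommRing R] {W : Affine R} {x x' y y' : R} (hx : x = x') (hy : y = y')
    (h : W.Nonsingular x y) (h' : W.Nonsingular x' y') : Point.some x y h = Point.some x' y' h' := by
  subst hx hy
  rfl

variable {K F Ω : Type*} [Field K] [Field F] [Algebra K F] [Field Ω] [Algebra K Ω] [Algebra F Ω]
  [IsScalarTower K F Ω]

open scoped Classical in
-- With `q = √d`, the isomorphism is `X = 2q(y + q x²) + b`, `Y = 2q x X`. Changing the sign of `q`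
-- replaces `X` by `X₁` with `X X₁ = b² - 4dc`, which is the effect of adding `(0, 0)`.
lemma exists_twist_isogenousCurve [IsAlgClosed Ω] (h2 : (2 : K) ≠ 0) {b c d : K} (hd : d ≠ 0)
    (hc : d * c ≠ 0) (hbc : b ^ 2 - 4 * (d * c) ≠ 0) {x y : F}
    (hxy : y ^ 2 = algebraMap K F d * x ^ 4 + algebraMap K F b * x ^ 2 + algebraMap K F c)
    (htop : adjoin K {x, y} = ⊤) :
    ∃ (X Y : Ω) (h : ((isogenousCurve b (d * c)).baseChange Ω).Nonsingular X Y),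
      adjoin (separableClosure K Ω) {X, Y} =
        adjoin (separableClosure K Ω) (Set.range (algebraMap F Ω)) ∧
      ∀ τ : Ω ≃ₐ[F] Ω,
        ∃ Q : ((isogenousCurve b (d * c)).baseChange (separableClosure K Ω)).Point,
          Point.map (W' := isogenousCurve b (d * c)) (τ.restrictScalars K : Ω →ₐ[K] Ω)
              (.some X Y h) =
            .some X Y h +
              Point.map (W' := isogenousCurve b (d * c)) (separableClosure K Ω).val Q := by
  set Ks := separableClosure K Ω
  have h2' : (2 : Ω) ≠ 0 := by
    have := (_root_.map_ne_zero (algebraMap K Ω)).mpr h2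
    rwa [map_ofNat] at this
  obtain ⟨q, hq⟩ := IsAlgClosed.exists_pow_nat_eq (algebraMap K Ω d) two_pos
  have hd' : algebraMap K Ω d ≠ 0 := (_root_.map_ne_zero _).mpr hd
  have hq0 : q ≠ 0 := by
    rintro rfl
    rw [zero_pow two_ne_zero] at hq
    exact hd' hq.symm
  have hqs : q ∈ Ks := by
    rw [mem_separableClosure_iff]
    refine Separable.of_dvd (f := (X ^ 2 - C d : K[X])) (separable_X_pow_sub_C d ?_ hd)
      (minpoly.dvd K q ?_)
    · exact_mod_cast h2
    · simp [hq]
  obtain ⟨x', hx'⟩ : ∃ x', x' = algebraMap F Ω x := ⟨_, rfl⟩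
  obtain ⟨y', hy'⟩ : ∃ y', y' = algebraMap F Ω y := ⟨_, rfl⟩
  have hxy' : y' ^ 2 = q ^ 2 * x' ^ 4 + algebraMap K Ω b * x' ^ 2 + algebraMap K Ω c := by
    have := congrArg (algebraMap F Ω) hxy
    simp only [map_add, map_mul, map_pow, ← IsScalarTower.algebraMap_apply, ← hx', ← hy'] at this
    rw [this, hq]
  obtain ⟨X, hX⟩ : ∃ X, X = 2 * q * (y' + q * x' ^ 2) + algebraMap K Ω b := ⟨_, rfl⟩
  obtain ⟨X₁, hX₁⟩ : ∃ X, X = - 2 * q * (y' - q * x' ^ 2) + algebraMap K Ω b := ⟨_, rfl⟩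
  have hbc' : algebraMap K Ω b ^ 2 - 4 * (q ^ 2 * algebraMap K Ω c) ≠ 0 := by
    have := (_root_.map_ne_zero (algebraMap K Ω)).mpr hbc
    simpa only [map_sub, map_mul, map_pow, map_ofNat, ← hq] using this
  have hXX : X * X₁ = algebraMap K Ω b ^ 2 - 4 * (q ^ 2 * algebraMap K Ω c) := by
    rw [hX, hX₁]
    linear_combination (- 4 * q ^ 2) * hxy'
  have hX0 : X ≠ 0 := by
    rintro h
    rw [h, zero_mul] at hXX
    exact hbc' hXX.symm
  have hell := isElliptic_isogenousCurve h2 hc hbc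
  have hellΩ : ((isogenousCurve b (d * c)).baseChange Ω).IsElliptic :=
    inferInstanceAs ((isogenousCurve b (d * c)).map (algebraMap K Ω)).IsElliptic
  have hellK : ((isogenousCurve b (d * c)).baseChange Ks).IsElliptic :=
    inferInstanceAs ((isogenousCurve b (d * c)).map (algebraMap K Ks)).IsElliptic
  have heq : ((isogenousCurve b (d * c)).baseChange Ω).Equation X (2 * q * x' * X) := by
    rw [equation_isogenousCurve]
    simp only [map_mul, ← hq]
    linear_combination (- X ^ 2) * (hX + hX₁) + X * hXX
  have hns := equation_iff_nonsingular.mp heq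
  refine ⟨X, 2 * q * x' * X, hns, ?_, ?_⟩
  · have hKs : ∀ a ∈ Ks, ∀ S : IntermediateField Ks Ω, a ∈ S := fun a ha S =>
      S.algebraMap_mem ⟨a, ha⟩
    have hK : ∀ (a : K) (S : IntermediateField Ks Ω), algebraMap K Ω a ∈ S := fun a =>
      hKs _ (Ks.algebraMap_mem a)
    apply le_antisymm
    · set S := adjoin Ks (Set.range (algebraMap F Ω))
      have hx'S : x' ∈ S := subset_adjoin _ _ ⟨x, hx'.symm⟩
      have hy'S : y' ∈ S := subset_adjoin _ _ ⟨y, hy'.symm⟩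
      have hXS : X ∈ S := by
        rw [hX]
        exact add_mem (mul_mem (mul_mem (ofNat_mem S 2) (hKs q hqs S))
          (add_mem hy'S (mul_mem (hKs q hqs S) (pow_mem hx'S 2)))) (hK b S)
      rw [adjoin_le_iff]
      rintro z (rfl | rfl)
      · exact hXS
      · exact mul_mem (mul_mem (mul_mem (ofNat_mem S 2) (hKs q hqs S)) hx'S) hXS
    · set S := adjoin Ks {X, 2 * q * x' * X}
      have hXS : X ∈ S := subset_adjoin _ _ (by simp)
      have hYS : 2 * q * x' * X ∈ S := subset_adjoin _ _ (by simp)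
      have hx'S : x' ∈ S := by
        have : x' = (2 * q * x' * X) / (2 * q * X) := by field_simp
        rw [this]
        exact div_mem hYS (mul_mem (mul_mem (ofNat_mem S 2) (hKs q hqs S)) hXS)
      have hy'S : y' ∈ S := by
        have : y' = (X - algebraMap K Ω b) / (2 * q) - q * x' ^ 2 := by
          rw [hX]
          field_simp
          ring
        rw [this]
        exact sub_mem (div_mem (sub_mem hXS (hK b S)) (mul_mem (ofNat_mem S 2) (hKs q hqs S)))
          (mul_mem (hKs q hqs S) (pow_mem hx'S 2))
      rw [adjoin_le_iff]
      rintro z ⟨t, rfl⟩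
      have ht : t ∈ adjoin K {x, y} := by
        rw [htop]
        trivial
      induction ht using adjoin_induction with
      | mem t ht =>
        rcases ht with rfl | rfl
        · rwa [← hx']
        · rwa [← hy']
      | algebraMap a =>
        rw [← IsScalarTower.algebraMap_apply]
        exact hK a S
      | add s t _ _ hs ht =>
        rw [map_add]
        exact add_mem hs ht
      | mul s t _ _ hs ht =>
        rw [map_mul]
        exact mul_mem hs ht
      | inv t _ ht =>
        rw [map_inv₀]
        exact inv_mem ht
  · intro τ
    have hτx : τ x' = x' := by rw [hx', τ.commutes]
    have hτy : τ y' = y' := by rw [hy', τ.commutes]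
    have hτK : ∀ a : K, τ (algebraMap K Ω a) = algebraMap K Ω a := fun a => by
      rw [IsScalarTower.algebraMap_apply K F Ω, τ.commutes]
    have hτq : τ q = q ∨ τ q = - q := by
      apply sq_eq_sq_iff_eq_or_eq_neg.mp
      rw [← map_pow, hq, hτK]
    rcases hτq with hτq | hτq
    · refine ⟨0, ?_⟩
      rw [map_zero, add_zero, Point.map_some]
      have h1 : τ X = X := by
        simp only [hX, map_add, map_mul, map_pow, map_ofNat, hτq, hτx, hτy, hτK]
      have h3 : τ (2 * q * x' * X) = 2 * q * x' * X := by
        simp only [map_mul, map_ofNat, hτq, hτx, h1]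
      exact some_congr h1 h3 _ _
    -- The chord through `(X, Y)` and `(0, 0)` has slope `2q x`, and `X + X₁ = 4q² x² + 2b`, so the
    -- sum of these points has `x`-coordinate `X₁`.
    · have h1 : τ X = X₁ := by
        simp only [hX, hX₁, map_add, map_mul, map_pow, map_ofNat, hτq, hτx, hτy, hτK]
        ring
      have h3 : τ (2 * q * x' * X) = - (2 * q * x' * X₁) := by
        simp only [map_mul, map_ofNat, hτq, hτx, h1]
        ring
      have h0 : ∀ (N : Type _) [Field N] [Algebra K N],
          ((isogenousCurve b (d * c)).baseChange N).Equation 0 0 := fun N _ _ => by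
        rw [equation_isogenousCurve]
        ring
      have h0K := equation_iff_nonsingular.mp (h0 Ks)
      have h0Ω := equation_iff_nonsingular.mp (h0 Ω)
      refine ⟨.some 0 0 h0K, ?_⟩
      have hmap : Point.map (W' := isogenousCurve b (d * c)) Ks.val (.some 0 0 h0K) =
          .some 0 0 h0Ω := by
        rw [Point.map_some]
        exact some_congr (map_zero _) (map_zero _) _ _
      rw [hmap, Point.map_some, Point.add_of_X_ne hX0]
      have hsl : ((isogenousCurve b (d * c)).baseChange Ω).slope X 0 (2 * q * x' * X) 0 =
          2 * q * x' := by
        rw [slope_of_X_ne hX0, sub_zero, sub_zero, mul_div_cancel_right₀ _ hX0]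
      refine some_congr (h1.trans ?_) (h3.trans ?_) _ _
      · rw [hsl]
        simp only [addX, WeierstrassCurve.baseChange, WeierstrassCurve.Affine.baseChange,
          isogenousCurve, WeierstrassCurve.map_a₁, WeierstrassCurve.map_a₂, map_mul, map_neg,
          map_ofNat, map_zero]
        linear_combination hX + hX₁
      · rw [hsl]
        simp only [addX, addY, negAddY, negY, WeierstrassCurve.baseChange,
          WeierstrassCurve.Affine.baseChange, isogenousCurve, WeierstrassCurve.map_a₁,
          WeierstrassCurve.map_a₂, WeierstrassCurve.map_a₃, map_mul, map_neg, map_ofNat, map_zero]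
        linear_combination (- 2 * q * x') * (hX + hX₁)

lemma isJacobian_isogenousCurve (h2 : (2 : K) ≠ 0) {b c d : K} (hd : d ≠ 0) (hc : d * c ≠ 0)
    (hbc : b ^ 2 - 4 * (d * c) ≠ 0) {x y : F}
    (hxy : y ^ 2 = algebraMap K F d * x ^ 4 + algebraMap K F b * x ^ 2 + algebraMap K F c)
    (htop : adjoin K {x, y} = ⊤) : IsJacobian (isogenousCurve b (d * c)) F :=
  exists_twist_isogenousCurve h2 hd hc hbc hxy htop

end Jacobian

/-! ### Rational function fields: Möbius changes and absence of cubic models -/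

section RationalFunctions

variable {K F : Type*} [Field K] [Field F] [Algebra K F]

lemma two_ne_zero_of_algebra (F : Type*) [Field F] [Algebra K F] (h2 : (2 : K) ≠ 0) :
    (2 : F) ≠ 0 := by
  have := (_root_.map_ne_zero (algebraMap K F)).mpr h2
  rwa [map_ofNat] at this

/-- Two generators of a purely transcendental extension of degree one differ by a fractional linear
transformation. -/
lemma exists_mobius {s t : F} (ht : Transcendental K t) (hs : s ∈ K⟮t⟯) (hts : t ∈ K⟮s⟯) :
    ∃ a b c e : K, algebraMap K F c * t + algebraMap K F e ≠ 0 ∧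
      s * (algebraMap K F c * t + algebraMap K F e) =
        algebraMap K F a * t + algebraMap K F b := by
  let e := RatFunc.algEquivOfTranscendental t ht
  set φ : RatFunc K →ₐ[K] F := K⟮t⟯.val.comp (e : RatFunc K →ₐ[K] K⟮t⟯) with hφ
  have hφp : ∀ p : K[X], φ (algebraMap K[X] (RatFunc K) p) = aeval t p := fun p => by
    have h1 : φ RatFunc.X = t := RatFunc.algEquivOfTranscendental_X t ht
    have h2 : aeval (RatFunc.X : RatFunc K) p = algebraMap K[X] (RatFunc K) p := by
      rw [← RatFunc.algebraMap_X, aeval_algebraMap_apply, aeval_X_left_apply]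
    rw [← h2, ← aeval_algHom_apply, h1]
  set g : RatFunc K := e.symm ⟨s, hs⟩ with hg
  have hφg : φ g = s := by
    change ((e (e.symm ⟨s, hs⟩) : K⟮t⟯) : F) = s
    rw [AlgEquiv.apply_symm_apply]
  have htop : K⟮g⟯ = ⊤ := by
    rw [eq_top_iff, ← RatFunc.adjoin_X, adjoin_simple_le_iff]
    obtain ⟨p, q, hpq⟩ := (mem_adjoin_simple_iff K t).mp hts
    rw [mem_adjoin_simple_iff]
    have hinj : Function.Injective φ := φ.toRingHom.injective
    refine ⟨p, q, hinj ?_⟩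
    rw [map_div₀, ← aeval_algHom_apply, ← aeval_algHom_apply, hφg, ← hpq, ← RatFunc.algebraMap_X,
      hφp, aeval_X]
  have hdeg := RatFunc.finrank_eq_max_natDegree g
  rw [IntermediateField.finrank_eq_one_iff_eq_top.mpr htop] at hdeg
  have hnum : g.num.natDegree ≤ 1 := hdeg ▸ le_max_left _ _
  have hden : g.denom.natDegree ≤ 1 := hdeg ▸ le_max_right _ _
  obtain ⟨a, b, hab⟩ := exists_of_natDegree_le_one (Or.inr hnum)
  obtain ⟨c, e', hce⟩ := exists_of_natDegree_le_one (Or.inr hden)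
  have hd0 := aeval_ne_zero ht g.denom_ne_zero
  have h1 : s * aeval t g.denom = aeval t g.num := by
    have h2 := congrArg φ (RatFunc.num_div_denom g)
    rw [map_div₀, hφp, hφp, hφg] at h2
    rw [← h2, div_mul_cancel₀ _ hd0]
  rw [hab, hce] at h1
  rw [hce] at hd0
  simp only [map_add, map_mul, aeval_C, aeval_X] at h1 hd0
  exact ⟨a, b, c, e', hd0, h1⟩

/-- The generator `T` is quadratic over `K(U)` with coefficients linear in `U`, so completing the
square gives `S` with `S² = D(U)` and `deg D ≤ 2`. The involution moves `T`, hence negates `S`, so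
`S/V ∈ K(U)`. Then the cubic is `D` up to squares, and squarefreeness contradicts `deg D ≤ 2`. -/
lemma not_isModel_cubic_ratFunc (h2 : (2 : K) ≠ 0) {A B : K} (hd : 4 * A ^ 3 + 27 * B ^ 2 ≠ 0)
    {U V : RatFunc K} (H : IsModel (cubic A B) U V) : False := by
  obtain ⟨w, hwU, hwV⟩ := H.exists_involution
  have hsqf := squarefree_cubic hd
  have h2' := two_ne_zero_of_algebra (RatFunc K) h2
  have hV0 : V ≠ 0 := by
    intro h
    have := H.sq
    rw [h, zero_pow two_ne_zero] at this
    exact aeval_ne_zero H.transcendental hsqf.ne_zero this.symm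
  have hfix : ∀ h : RatFunc K, w h = h → h ∈ K⟮U⟯ := fun h => H.fixed_of_involution h2 hwU hwV
  have hw : w RatFunc.X ≠ RatFunc.X := by
    intro h
    have h3 : V ∈ K⟮(RatFunc.X : RatFunc K)⟯ := by
      rw [RatFunc.adjoin_X]
      trivial
    have h4 : K⟮(RatFunc.X : RatFunc K)⟯ ≤ quotientField w := by
      rw [adjoin_simple_le_iff, mem_quotientField, h]
    have h5 := mem_quotientField.mp (h4 h3)
    rw [hwV] at h5
    exact hV0 (mul_left_cancel₀ h2' (by linear_combination - h5))
  have hrank : Module.finrank K⟮U⟯ (RatFunc K) ≤ 2 := by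
    let g : K⟮U⟯ := ⟨aeval U (cubic A B), by
      rw [mem_adjoin_simple_iff]
      exact ⟨cubic A B, 1, by simp⟩⟩
    have hroot : aeval V (X ^ 2 - C g) = 0 := by
      simp [g, H.sq]
    have hint : IsIntegral K⟮U⟯ V := ⟨X ^ 2 - C g, monic_X_pow_sub_C g two_ne_zero, hroot⟩
    have htop : K⟮U⟯⟮V⟯ = ⊤ := by
      rw [← restrictScalars_eq_top_iff (K := K), adjoin_simple_adjoin_simple]
      exact H.adjoin_eq_top
    rw [← finrank_top', ← htop, adjoin.finrank hint, ← natDegree_X_pow_sub_C (n := 2) (r := g)]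
    exact natDegree_le_of_dvd (minpoly.dvd _ _ hroot) (X_pow_sub_C_ne_zero two_pos g)
  rw [RatFunc.finrank_eq_max_natDegree] at hrank
  have hnum : U.num.natDegree ≤ 2 := (le_max_left _ _).trans hrank
  have hden : U.denom.natDegree ≤ 2 := (le_max_right _ _).trans hrank
  have hU : U * algebraMap K[X] (RatFunc K) U.denom = algebraMap K[X] (RatFunc K) U.num := by
    have h1 := RatFunc.num_div_denom U
    have h3 : algebraMap K[X] (RatFunc K) U.denom ≠ 0 := by
      simpa using U.denom_ne_zero
    rw [div_eq_iff h3] at h1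
    exact h1.symm
  have hquad : ∀ p : K[X], p.natDegree ≤ 2 → algebraMap K[X] (RatFunc K) p =
      algebraMap K _ (p.coeff 2) * RatFunc.X ^ 2 + algebraMap K _ (p.coeff 1) * RatFunc.X +
        algebraMap K _ (p.coeff 0) := by
    intro p hp
    have h1 : p = C (p.coeff 2) * X ^ 2 + C (p.coeff 1) * X + C (p.coeff 0) :=
      eq_quadratic_of_degree_le_two (natDegree_le_iff_degree_le.mp hp)
    conv_lhs => rw [h1]
    simp
  rw [hquad _ hnum, hquad _ hden] at hU
  set T : RatFunc K := RatFunc.X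
  -- the coefficients of the quadratic equation of `T` over `K[U]`
  obtain ⟨a, ha⟩ : ∃ a, a = C (U.num.coeff 2) - C (U.denom.coeff 2) * X := ⟨_, rfl⟩
  obtain ⟨b, hb⟩ : ∃ b, b = C (U.num.coeff 1) - C (U.denom.coeff 1) * X := ⟨_, rfl⟩
  obtain ⟨c, hc⟩ : ∃ c, c = C (U.num.coeff 0) - C (U.denom.coeff 0) * X := ⟨_, rfl⟩
  have heq : aeval U a * T ^ 2 + aeval U b * T + aeval U c = 0 := by
    rw [ha, hb, hc]
    simp only [map_sub, map_mul, aeval_C, aeval_X]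
    linear_combination - hU
  have hdeg : ∀ α β : K, (C α - C β * X).natDegree ≤ 1 := fun α β => by
    compute_degree
  have hwp : ∀ p : K[X], w (aeval U p) = aeval U p := fun p => by
    have := aeval_algHom_apply (w : RatFunc K →ₐ[K] RatFunc K) U p
    simp only [AlgEquiv.coe_toAlgHom, hwU] at this
    exact this.symm
  obtain ⟨S, hS⟩ : ∃ S, S = 2 * aeval U a * T + aeval U b := ⟨_, rfl⟩
  obtain ⟨D, hD⟩ : ∃ D, D = b ^ 2 - 4 * a * c := ⟨_, rfl⟩
  have hSD : S ^ 2 = aeval U D := by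
    rw [hS, hD]
    simp only [map_sub, map_mul, map_pow, map_ofNat]
    linear_combination 4 * aeval U a * heq
  have hDdeg : D.natDegree ≤ 2 := by
    have h1 := hdeg (U.num.coeff 2) (U.denom.coeff 2)
    have h3 := hdeg (U.num.coeff 1) (U.denom.coeff 1)
    have h4 := hdeg (U.num.coeff 0) (U.denom.coeff 0)
    rw [← ha] at h1
    rw [← hb] at h3
    rw [← hc] at h4
    rw [hD]
    refine (natDegree_sub_le _ _).trans (max_le ?_ ?_)
    · refine natDegree_pow_le.trans ?_
      omega
    · refine natDegree_mul_le.trans ?_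
      have : (4 * a).natDegree ≤ a.natDegree := by
        have : (4 : K[X]) = C 4 := (map_ofNat C 4).symm
        rw [this]
        exact natDegree_C_mul_le _ _
      omega
  have hwS : w S = S ∨ w S = - S := by
    apply sq_eq_sq_iff_eq_or_eq_neg.mp
    rw [← map_pow, hSD, hwp]
  -- If `a` vanished, `T` would lie in `K(U)` or `U` would have zero denominator.
  have ha0 : aeval U a ≠ 0 := by
    intro ha0
    rw [ha0, zero_mul, zero_add] at heq
    have hb0 : aeval U b ≠ 0 := by
      intro hb0
      rw [hb0, zero_mul, zero_add] at heq
      have hz : ∀ {α β : K}, aeval U (C α - C β * X) = 0 → α = 0 ∧ β = 0 := by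
        intro α β h
        have h1 : C α - C β * X = 0 := by
          by_contra h0
          exact aeval_ne_zero H.transcendental h0 h
        have h3 := congrArg (fun p => coeff p 0) h1
        have h4 := congrArg (fun p => coeff p 1) h1
        simpa using And.intro h3 h4
      rw [ha] at ha0
      rw [hb] at hb0
      rw [hc] at heq
      apply U.denom_ne_zero
      rw [eq_quadratic_of_degree_le_two (natDegree_le_iff_degree_le.mp hden), (hz ha0).2, (hz hb0).2,
        (hz heq).2]
      simp
    apply hw
    have hT : T = - aeval U c / aeval U b := by
      field_simp
      linear_combination heq
    rw [hT, map_div₀, map_neg, hwp, hwp]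
  have hT : T = (S - aeval U b) / (2 * aeval U a) := by
    rw [hS]
    field_simp
    ring
  rcases hwS with hwS | hwS
  · apply hw
    rw [hT, map_div₀, map_sub, map_mul, map_ofNat, hwp, hwp, hwS]
  · obtain ⟨P, R, hR, -, e⟩ := exists_repr_of_mem_adjoin_simple H.transcendental
      (hfix (S / V) (by rw [map_div₀, hwS, hwV, neg_div_neg_eq]))
    have hpoly : D * R ^ 2 = P ^ 2 * cubic A B := by
      apply aeval_inj H.transcendental
      rw [map_mul, map_mul, map_pow, map_pow, ← hSD, ← H.sq, ← e]
      field_simp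
    obtain ⟨P', rfl⟩ := squarefree_dvd hsqf (Dvd.intro_left _ hpoly)
    have hpoly' : D = P' ^ 2 * cubic A B := by
      apply mul_left_cancel₀ (pow_ne_zero 2 hR)
      linear_combination hpoly
    have hP' : P' = 0 := by
      by_contra hP'
      rw [hpoly', natDegree_mul (pow_ne_zero 2 hP') hsqf.ne_zero, natDegree_cubic] at hDdeg
      omega
    have hS0 : S = 0 := by
      rw [hpoly', hP', zero_pow two_ne_zero, zero_mul, map_zero] at hSD
      exact pow_eq_zero_iff two_ne_zero |>.mp hSD
    apply hw
    rw [hT, map_div₀, map_sub, map_mul, map_ofNat, hwp, hwp, hS0, map_zero]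

end RationalFunctions

/-! ### Hyperelliptic equations and commuting involutions -/

section Involutions

variable {K F : Type*} [Field K] [Field F] [Algebra K F]

lemma algEquiv_aeval (v : F ≃ₐ[K] F) (x : F) (p : K[X]) : v (aeval x p) = aeval (v x) p :=
  (aeval_algHom_apply (v : F →ₐ[K] F) x p).symm

lemma apply_apply_of_sq_eq_one {v : F ≃ₐ[K] F} (hv : v ^ 2 = 1) (h : F) : v (v h) = h := by
  have := DFunLike.congr_fun hv h
  rwa [sq] at this

lemma exists_apply_eq_neg {w : F ≃ₐ[K] F} (hw : w ^ 2 = 1) (hw1 : w ≠ 1) :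
    ∃ z, z ≠ 0 ∧ w z = - z := by
  by_contra! H
  apply hw1
  ext h
  by_contra hne
  refine H (h - w h) (fun h0 => hne (sub_eq_zero.mp h0).symm) ?_
  rw [map_sub, apply_apply_of_sq_eq_one hw, neg_sub]

/-- Every function is of the form `a + b z` with `a`, `b` invariant under the involution `w`, if
`w z = -z`. -/
lemma exists_fixed_add_mul (h2 : (2 : K) ≠ 0) {w : F ≃ₐ[K] F} (hw : w ^ 2 = 1) {z : F} (hz : z ≠ 0)
    (hwz : w z = - z) (h : F) : ∃ a b, w a = a ∧ w b = b ∧ h = a + b * z := by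
  have h2' := two_ne_zero_of_algebra F h2
  have hww := apply_apply_of_sq_eq_one hw
  refine ⟨(h + w h) / 2, (h - w h) / (2 * z), ?_, ?_, ?_⟩
  · rw [map_div₀, map_add, hww, map_ofNat, add_comm]
  · rw [map_div₀, map_sub, map_mul, hww, map_ofNat, hwz]
    field_simp
    ring
  · field_simp
    ring

lemma eq_one_of_fixed (h2 : (2 : K) ≠ 0) {v w : F ≃ₐ[K] F} (hw : w ^ 2 = 1)
    (hv : ∀ h, w h = h → v h = h) {z : F} (hz : z ≠ 0) (hwz : w z = - z) (hvz : v z = z) :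
    v = 1 := by
  ext h
  obtain ⟨a, b, ha, hb, rfl⟩ := exists_fixed_add_mul h2 hw hz hwz h
  rw [map_add, map_mul, hv a ha, hv b hb, hvz]
  rfl

lemma exists_sq_mul_squarefree (g : K[X]) (hg : g ≠ 0) :
    ∃ s f : K[X], s ≠ 0 ∧ g = s ^ 2 * f ∧ Squarefree f := by
  induction hn : g.natDegree using Nat.strong_induction_on generalizing g with
  | _ n ih =>
    by_cases hsq : Squarefree g
    · exact ⟨1, g, one_ne_zero, by simp, hsq⟩
    · obtain ⟨r, ⟨g', rfl⟩, hr⟩ : ∃ r, r * r ∣ g ∧ ¬ IsUnit r := by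
        simpa [Squarefree] using hsq
      have hr0 : r ≠ 0 := by
        rintro rfl
        simp at hg
      have hg' : g' ≠ 0 := by
        rintro rfl
        simp at hg
      have hdeg : 0 < r.natDegree := by
        by_contra! h
        obtain ⟨a, rfl⟩ := natDegree_eq_zero.mp (Nat.le_zero.mp h)
        apply hr
        rw [isUnit_C, isUnit_iff_ne_zero]
        rintro rfl
        simp at hr0
      rw [natDegree_mul (mul_ne_zero hr0 hr0) hg', natDegree_mul hr0 hr0] at hn
      obtain ⟨s, f, hs, rfl, hf⟩ := ih g'.natDegree (by omega) g' hg' rfl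
      exact ⟨r * s, f, mul_ne_zero hr0 hs, by ring, hf⟩

/-- An involution with rational fixed field is hyperelliptic. -/
lemma exists_isModel (h2 : (2 : K) ≠ 0) {w : F ≃ₐ[K] F} (hw : w ^ 2 = 1) (hw1 : w ≠ 1) {x : F}
    (hx : Transcendental K x) (hwx : w x = x) (hfix : ∀ h, w h = h → h ∈ K⟮x⟯) :
    ∃ (f : K[X]) (y : F), IsModel f x y ∧ Squarefree f ∧ w y = - y := by
  obtain ⟨z, hz, hwz⟩ := exists_apply_eq_neg hw hw1
  obtain ⟨p, r, hr, -, e⟩ := exists_repr_of_mem_adjoin_simple hx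
    (hfix (z ^ 2) (by rw [map_pow, hwz, neg_sq]))
  have hr0 := aeval_ne_zero hx hr
  have hp : p ≠ 0 := by
    rintro rfl
    rw [map_zero] at e
    exact mul_ne_zero (pow_ne_zero 2 hz) hr0 e
  obtain ⟨s, f, hs, hpr, hf⟩ := exists_sq_mul_squarefree (p * r) (mul_ne_zero hp hr)
  have hs0 := aeval_ne_zero hx hs
  have hwp : ∀ p : K[X], w (aeval x p) = aeval x p := fun p => by
    rw [algEquiv_aeval, hwx]
  have hwy : w (z * aeval x r / aeval x s) = - (z * aeval x r / aeval x s) := by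
    rw [map_div₀, map_mul, hwp, hwp, hwz]
    ring
  -- From `z² = p/r` follows `(z r)² = p r = s² f`, so dividing `z r` by `s` leaves the squarefree
  -- part `f`.
  refine ⟨f, z * aeval x r / aeval x s, ⟨hx, ?_, ?_⟩, hf, hwy⟩
  · have h3 := congrArg (aeval x) hpr
    simp only [map_mul, map_pow] at h3
    field_simp
    linear_combination h3 + aeval x r * e
  · rw [eq_top_iff]
    rintro h -
    obtain ⟨a, b, ha, hb, rfl⟩ := exists_fixed_add_mul h2 hw
      (div_ne_zero (mul_ne_zero hz hr0) hs0) hwy h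
    have hle : K⟮x⟯ ≤ adjoin K {x, z * aeval x r / aeval x s} :=
      adjoin.mono _ _ _ (Set.singleton_subset_iff.mpr (Set.mem_insert _ _))
    exact add_mem (hle (hfix a ha)) (mul_mem (hle (hfix b hb))
      (subset_adjoin _ _ (Set.mem_insert_of_mem _ rfl)))

/-- The ratio `u y / y` is fixed by `w`, hence is some `p/r` in `K(x)`, and `f(-X) r² = p² f`.
Squarefreeness and comparison of degrees make it a constant `ρ`; `u² = 1` gives `ρ² = 1`, and then
`f(-X) = f`. -/
lemma IsModel.even_of_apply_eq_neg {f : K[X]} {x y : F} (H : IsModel f x y) (hf : Squarefree f)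
    {w u : F ≃ₐ[K] F} (hfix : ∀ h, w h = h → h ∈ K⟮x⟯) (hwy : w y = - y) (hu : u ^ 2 = 1)
    (huw : ∀ h, u (w h) = w (u h)) (hux : u x = - x) :
    ∃ ρ : K, ρ ^ 2 = 1 ∧ u y = algebraMap K F ρ * y ∧ f.comp (- X) = f := by
  have hx := H.transcendental
  have hy0 : y ≠ 0 := by
    intro h
    have := H.sq
    rw [h, zero_pow two_ne_zero] at this
    exact aeval_ne_zero hx hf.ne_zero this.symm
  obtain ⟨p, r, hr, hpr, e⟩ := exists_repr_of_mem_adjoin_simple hx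
    (hfix (u y / y) (by rw [map_div₀, ← huw, hwy, map_neg, neg_div_neg_eq]))
  have hneg : aeval x (f.comp (- X)) = u y ^ 2 := by
    rw [aeval_comp, map_neg, aeval_X, ← map_pow, H.sq, algEquiv_aeval, hux]
  have e' : u y * aeval x r = aeval x p * y := by
    rw [← e]
    field_simp
  have hpoly : f.comp (- X) * r ^ 2 = p ^ 2 * f := by
    apply aeval_inj hx
    rw [map_mul, map_mul, map_pow, map_pow, hneg, ← H.sq, ← mul_pow, e', mul_pow]
  have hru : IsUnit r := hpr.isUnit_of_dvd' (squarefree_dvd hf (Dvd.intro_left _ hpoly)) dvd_rfl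
  obtain ⟨c, hc, rfl⟩ := isUnit_iff.mp hru
  have hp : p ≠ 0 := by
    rintro rfl
    apply mul_ne_zero ((_root_.map_ne_zero u).mpr hy0) (aeval_ne_zero hx hr)
    rw [e', map_zero, zero_mul]
  have hc0 : c ≠ 0 := hc.ne_zero
  have hdeg := congrArg natDegree hpoly
  rw [← C_pow, natDegree_mul_C (pow_ne_zero 2 hc0), natDegree_comp, natDegree_neg, natDegree_X,
    natDegree_mul (pow_ne_zero 2 hp) hf.ne_zero, natDegree_pow] at hdeg
  obtain ⟨a, rfl⟩ := natDegree_eq_zero.mp (show p.natDegree = 0 by omega)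
  have huy : u y = algebraMap K F (a / c) * y := by
    rw [aeval_C, aeval_C] at e'
    have : algebraMap K F c ≠ 0 := (_root_.map_ne_zero _).mpr hc0
    rw [map_div₀]
    field_simp
    linear_combination e'
  have hρ : (a / c) ^ 2 = 1 := by
    apply (algebraMap K F).injective
    have h3 := apply_apply_of_sq_eq_one hu y
    rw [huy, map_mul, u.commutes, huy] at h3
    rw [map_pow, map_one]
    apply mul_right_cancel₀ hy0
    linear_combination h3
  refine ⟨a / c, hρ, huy, aeval_inj hx ?_⟩
  rw [hneg, huy, mul_pow, ← map_pow, hρ, map_one, one_mul, H.sq]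

end Involutions

/-! ### Coordinates adapted to the point `P` and the normal form -/

section Points

variable {K F L : Type*} [Field K] [Field F] [Algebra K F] [Field L] [Algebra K L]

/-- The Galois group of a quadratic extension. -/
lemma quadratic_galois (h2 : (2 : K) ≠ 0) {d : K} {s : L} (hs : s ^ 2 = algebraMap K L d)
    (hs' : adjoin K {s} = ⊤) {σ : L ≃ₐ[K] L} (hσ : σ ≠ 1) :
    σ s = - s ∧ s ≠ 0 ∧ ∀ a, σ a = a → a ∈ (algebraMap K L).range := by
  have h1 : σ s ≠ s := by
    intro h
    apply hσ
    have h3 : adjoin K {s} ≤ quotientField σ := by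
      rw [adjoin_simple_le_iff, mem_quotientField, h]
    rw [hs'] at h3
    ext a
    exact mem_quotientField.mp (h3 (mem_top (x := a)))
  have h3 : σ s = - s := by
    refine (sq_eq_sq_iff_eq_or_eq_neg.mp ?_).resolve_left h1
    rw [← map_pow, hs, σ.commutes]
  refine ⟨h3, ?_, fun a ha => ?_⟩
  · rintro rfl
    simp at h1
  · have h4 : quotientField σ = ⊥ := quotientField_eq_of_sq_mem h2 bot_le h3
      (by rw [hs]; exact IntermediateField.algebraMap_mem _ d) hs' (by
        rw [Set.singleton_subset_iff]
        exact mem_adjoin_simple_self _ s)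
    have h5 := mem_quotientField.mpr ha
    rw [h4, mem_bot] at h5
    exact h5

variable {P : CurvePoint K F L}

lemma CurvePoint.eval_inj {f : F} {a b : L} (ha : P.eval f = (a : OnePoint L))
    (hb : P.eval f = (b : OnePoint L)) : a = b :=
  OnePoint.coe_injective (ha.symm.trans hb)

lemma CurvePoint.eval_apply_of_image_eq_conj {w : F ≃ₐ[K] F} {σ : L ≃ₐ[K] L}
    (h : P.image w = P.conj σ) {f : F} {a : L} (ha : P.eval f = (a : OnePoint L)) :
    P.eval (w f) = (σ a : OnePoint L) := by
  have h1 : P.eval (w f) = OnePoint.map σ (P.eval f) := congrArg (fun Q => Q.eval f) h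
  rw [h1, ha, OnePoint.map_some]

lemma CurvePoint.eval_apply_of_image_eq {u : F ≃ₐ[K] F} (h : P.image u = P) (f : F) :
    P.eval (u f) = P.eval f := congrArg (fun Q => Q.eval f) h

lemma CurvePoint.eval_aeval {z : F} {a : L} (h : P.eval z = (a : OnePoint L)) (p : K[X]) :
    P.eval (aeval z p) = (aeval a p : OnePoint L) := by
  induction p using Polynomial.induction_on' with
  | add p q hp hq =>
    rw [map_add, map_add]
    exact P.eval_add _ _ _ _ hp hq
  | monomial n c =>
    rw [aeval_monomial, aeval_monomial]
    refine P.eval_mul _ _ _ _ (P.eval_algebraMap c) ?_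
    induction n with
    | zero => simpa using P.eval_one
    | succ n ih =>
      rw [pow_succ, pow_succ]
      exact P.eval_mul _ _ _ _ ih h

/-- The function is the reversed polynomial in `1/x`, and `1/x` vanishes at `P`. -/
lemma CurvePoint.eval_aeval_mul_inv_pow {x : F} (hx : x ∉ P.ring) (f : K[X]) :
    P.eval (aeval x f * x⁻¹ ^ f.natDegree) =
      (algebraMap K L f.leadingCoeff : OnePoint L) := by
  have hx0 : x ≠ 0 := by
    rintro rfl
    exact hx P.ring.zero_mem
  have h1 := P.eval_inv x (P.eval_eq_infty_iff.mpr hx)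
  have h2 := CurvePoint.eval_aeval h1 f.reverse
  have h3 : aeval x f * x⁻¹ ^ f.natDegree = aeval x⁻¹ f.reverse := by
    let _ : Invertible x := invertibleOfNonzero hx0
    have := eval₂_reverse_mul_pow (algebraMap K F) x f
    rw [invOf_eq_inv] at this
    rw [aeval_def, aeval_def, ← this, inv_pow]
    field_simp
  rw [h3, h2, ← coeff_zero_eq_aeval_zero', coeff_zero_reverse]

/-- A coordinate on the quotient by `w` with a pole at `P` whose sign is changed by `u`. -/
lemma CurvePoint.exists_coordinate (h2 : (2 : K) ≠ 0) {w u : F ≃ₐ[K] F} (hw : w ^ 2 = 1)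
    (hu : u ^ 2 = 1) (huw : ∀ h, u (w h) = w (u h)) (hw1 : w ≠ 1) (hu1 : u ≠ 1) (hne : u ≠ w)
    (θ : quotientField w ≃ₐ[K] RatFunc K) {σ : L ≃ₐ[K] L}
    (hσ : ∀ a, σ a = a → a ∈ (algebraMap K L).range)
    (hwP : P.image w = P.conj σ) (huP : P.image u = P) :
    ∃ x, x ∉ P.ring ∧ w x = x ∧ u x = - x ∧ ∀ h, w h = h → h ∈ K⟮x⟯ := by
  have h2' := two_ne_zero_of_algebra F h2
  have hV := P.algebraMap_mem
  have hww := apply_apply_of_sq_eq_one hw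
  have huu := apply_apply_of_sq_eq_one hu
  obtain ⟨t, htV, hwt, htfix⟩ : ∃ t, t ∉ P.ring ∧ w t = t ∧ ∀ h, w h = h → h ∈ K⟮t⟯ := by
    have hwt : w (θ.symm RatFunc.X) = θ.symm RatFunc.X :=
      mem_quotientField.mp (θ.symm RatFunc.X).2
    let φ : RatFunc K →ₐ[K] F :=
      (quotientField w).val.comp (θ.symm : RatFunc K →ₐ[K] quotientField w)
    have hφ : Function.Injective φ := φ.toRingHom.injective
    have htr : Transcendental K (θ.symm RatFunc.X : F) := fun h =>
      RatFunc.transcendental_X ((isAlgebraic_algHom_iff φ hφ).mp h)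
    have htfix : ∀ h, w h = h → h ∈ K⟮(θ.symm RatFunc.X : F)⟯ := by
      intro h hh
      let h' : quotientField w := ⟨h, mem_quotientField.mpr hh⟩
      have h3 : θ h' ∈ K⟮(RatFunc.X : RatFunc K)⟯ := by
        rw [RatFunc.adjoin_X]
        trivial
      obtain ⟨p, q, hpq⟩ := (mem_adjoin_simple_iff K _).mp h3
      have h4 : φ (θ h') = h := congrArg Subtype.val (θ.symm_apply_apply h')
      rw [hpq, map_div₀, ← aeval_algHom_apply, ← aeval_algHom_apply] at h4
      exact (mem_adjoin_simple_iff K _).mpr ⟨p, q, h4.symm⟩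
    -- If `t` is finite at `P`, its value is fixed by `σ` because `w t = t`. It is then some `k ∈
    -- K`, and `1/(t - k)` generates the same field with a pole at `P`.
    by_cases hmem : (θ.symm RatFunc.X : F) ∈ P.ring
    · obtain ⟨a, ha⟩ := hmem
      have h3 := P.eval_apply_of_image_eq_conj hwP ha
      rw [hwt] at h3
      obtain ⟨k, rfl⟩ := hσ a (CurvePoint.eval_inj h3 ha)
      generalize (θ.symm RatFunc.X : F) = t₀ at *
      have hne0 : t₀ - algebraMap K F k ≠ 0 := by
        intro h
        apply htr
        rw [sub_eq_zero.mp h]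
        exact isAlgebraic_algebraMap k
      refine ⟨(t₀ - algebraMap K F k)⁻¹, ?_, by rw [map_inv₀, map_sub, hwt, w.commutes], ?_⟩
      · rintro ⟨b, hb⟩
        have h4 := P.eval_add _ _ _ _ ha (P.eval_algebraMap (- k))
        rw [map_neg, map_neg, add_neg_cancel, ← sub_eq_add_neg] at h4
        have h5 := P.eval_mul _ _ _ _ h4 hb
        rw [mul_inv_cancel₀ hne0, zero_mul] at h5
        exact one_ne_zero (CurvePoint.eval_inj P.eval_one h5)
      · intro h hh
        refine (adjoin_simple_le_iff.mpr ?_) (htfix h hh)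
        have h6 : t₀ = ((t₀ - algebraMap K F k)⁻¹)⁻¹ + algebraMap K F k := by
          rw [inv_inv, sub_add_cancel]
        have h7 : ∀ z ∈ K⟮(t₀ - algebraMap K F k)⁻¹⟯, z⁻¹ + algebraMap K F k ∈
          K⟮(t₀ - algebraMap K F k)⁻¹⟯ := fun z hz =>
            add_mem (inv_mem hz) (IntermediateField.algebraMap_mem _ k)
        have h8 := h7 _ (mem_adjoin_simple_self K _)
        rwa [← h6] at h8
    · exact ⟨_, hmem, hwt, htfix⟩
  have htr := transcendental_of_notMem hV htV
  have hut : u t ∉ P.ring := by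
    rw [← P.eval_eq_infty_iff, P.eval_apply_of_image_eq huP, P.eval_eq_infty_iff]
    exact htV
  have hmem : u t ∈ K⟮t⟯ := htfix _ (by rw [← huw, hwt])
  have hmem' : t ∈ K⟮u t⟯ := by
    obtain ⟨p, q, hpq⟩ := (mem_adjoin_simple_iff K _).mp hmem
    rw [mem_adjoin_simple_iff]
    refine ⟨p, q, ?_⟩
    have := congrArg u hpq
    rwa [huu, map_div₀, algEquiv_aeval, algEquiv_aeval] at this
  obtain ⟨a, b, c, e, h0, hm⟩ := exists_mobius htr hmem hmem'
  -- Both `t` and `u t` have a pole at `P`, so the Möbius transformation fixes infinity.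
  have hc : c = 0 := by
    by_contra hc
    have h1 : 1 < P.ring.valuation t := by rwa [← not_le, P.ring.valuation_le_one_iff]
    have h3 : 1 < P.ring.valuation (u t) := by rwa [← not_le, P.ring.valuation_le_one_iff]
    have h4 : P.ring.valuation (algebraMap K F c * t + algebraMap K F e) = P.ring.valuation t := by
      have := valuation_aeval hV htV (p := C c * X + C e)
        (fun h => hc (by simpa using congrArg (fun p => coeff p 1) h))
      rwa [natDegree_linear hc, pow_one, map_add, map_mul, aeval_C, aeval_C, aeval_X] at this
    have h5 : P.ring.valuation (algebraMap K F a * t + algebraMap K F b) ≤ P.ring.valuation t := by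
      refine (Valuation.map_add _ _ _).trans (max_le ?_ ?_)
      · rw [map_mul]
        exact mul_le_of_le_one_left' ((P.ring.valuation_le_one_iff _).mpr (hV a))
      · exact ((P.ring.valuation_le_one_iff _).mpr (hV b)).trans h1.le
    rw [← hm, map_mul, h4] at h5
    have h6 : (0 : P.ring.ValueGroup) < P.ring.valuation t := zero_lt_one.trans h1
    exact absurd h5 (not_le.mpr (lt_mul_of_one_lt_left h6 h3))
  subst hc
  rw [map_zero, zero_mul, zero_add] at h0 hm
  obtain ⟨α, β, hαβ⟩ : ∃ α β : K, u t = algebraMap K F α * t + algebraMap K F β := by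
    refine ⟨a / e, b / e, ?_⟩
    rw [map_div₀, map_div₀]
    field_simp
    linear_combination hm
  have h1 : C (α ^ 2 - 1) * X + C (α * β + β) = 0 := by
    apply aeval_inj htr
    have := huu t
    rw [hαβ, map_add, map_mul, u.commutes, u.commutes, hαβ] at this
    simp only [map_add, map_mul, map_sub, map_pow, map_one, map_zero, aeval_C, aeval_X]
    linear_combination this
  have h3 : α ^ 2 - 1 = 0 := by
    simpa only [coeff_add, coeff_C_mul, coeff_X_one, coeff_C_succ, mul_one, add_zero,
      coeff_zero] using congrArg (fun p => coeff p 1) h1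
  have h4 : α * β + β = 0 := by simpa using congrArg (fun p => coeff p 0) h1
  rcases sq_eq_one_iff.mp (sub_eq_zero.mp h3) with rfl | rfl
  -- Multiplier `1` would make `u` trivial on the fixed field of `w`, leaving only `u = 1` or `u =
  -- w`.
  · exfalso
    have hβ : β = 0 := mul_left_cancel₀ h2 (by linear_combination h4)
    rw [hβ, map_zero, map_one, one_mul, add_zero] at hαβ
    have hfix : ∀ h, w h = h → u h = h := by
      intro h hh
      obtain ⟨p, q, rfl⟩ := (mem_adjoin_simple_iff K _).mp (htfix h hh)
      rw [map_div₀, algEquiv_aeval, algEquiv_aeval, hαβ]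
    obtain ⟨z, hz, hwz⟩ := exists_apply_eq_neg hw hw1
    have huz : u z ^ 2 = z ^ 2 := by
      rw [← map_pow]
      exact hfix _ (by rw [map_pow, hwz, neg_sq])
    rcases sq_eq_sq_iff_eq_or_eq_neg.mp huz with huz | huz
    · exact hu1 (eq_one_of_fixed h2 hw hfix hz hwz huz)
    · have h5 : u * w = 1 := eq_one_of_fixed h2 hw (v := u * w)
        (fun h hh => by rw [AlgEquiv.mul_apply, hh, hfix h hh]) hz hwz
        (by rw [AlgEquiv.mul_apply, hwz, map_neg, huz, neg_neg])
      apply hne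
      rw [eq_inv_of_mul_eq_one_left h5]
      rw [sq] at hw
      exact (eq_inv_of_mul_eq_one_left hw).symm
  · rw [map_neg, map_one, neg_one_mul] at hαβ
    have hx : t = (t - algebraMap K F (β / 2)) + algebraMap K F (β / 2) := by ring
    refine ⟨t - algebraMap K F (β / 2), fun h => htV ?_, by rw [map_sub, hwt, w.commutes], ?_, ?_⟩
    · rw [hx]
      exact add_mem h (hV _)
    · rw [map_sub, u.commutes, hαβ, map_div₀, map_ofNat]
      field_simp
      ring
    · intro h hh
      refine (adjoin_simple_le_iff.mpr ?_) (htfix h hh)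
      have h7 := add_mem (mem_adjoin_simple_self K (t - algebraMap K F (β / 2)))
        (IntermediateField.algebraMap_mem _ (β / 2))
      rwa [← hx] at h7

lemma even_natDegree_of_comp_neg {f : K[X]} (h2 : (2 : K) ≠ 0) (hf : f ≠ 0)
    (h : f.comp (- X) = f) : Even f.natDegree := by
  by_contra hodd
  rw [Nat.not_even_iff_odd] at hodd
  have h1 := congrArg leadingCoeff h
  rw [leadingCoeff_comp (by rw [natDegree_neg, natDegree_X]; exact one_ne_zero), leadingCoeff_neg,
    leadingCoeff_X, hodd.neg_one_pow] at h1
  exact leadingCoeff_ne_zero.mpr hf (mul_left_cancel₀ h2 (by linear_combination - h1))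

lemma coeff_eq_zero_of_comp_neg {f : K[X]} (h2 : (2 : K) ≠ 0) (h : f.comp (- X) = f) {n : ℕ}
    (hn : Odd n) : f.coeff n = 0 := by
  have h1 := congrArg (fun p => coeff p n) h
  have h3 : (- X : K[X]) = C (-1) * X := by rw [C_neg, C_1, neg_one_mul]
  simp only [h3, comp_C_mul_X_coeff, hn.neg_one_pow] at h1
  exact mul_left_cancel₀ h2 (by linear_combination - h1)

/-- The normal form `y² = f(x)` of the curve, adapted to the involutions and the point. -/
theorem exists_normalForm [FiniteDimensional K L] (h2 : (2 : K) ≠ 0)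
    (hfin : ∃ x : F, Transcendental K x ∧ FiniteDimensional K⟮x⟯ F) (hg : HasGenus K F 1)
    {w u : F ≃ₐ[K] F} (hw : IsInvolution 0 w) (hu : u ^ 2 = 1) (huw : IsInvolution 1 (u * w))
    (θ : quotientField w ≃ₐ[K] RatFunc K) {d : K} {s : L} (hs : s ^ 2 = algebraMap K L d)
    (hs' : adjoin K {s} = ⊤) {σ : L ≃ₐ[K] L} (hσ : σ ≠ 1) {P : CurvePoint K F L}
    (hP : ¬ P.IsRational) (hwP : P.image w = P.conj σ) (huP : P.image u = P) :
    d ≠ 0 ∧ ∃ (m : ℕ) (f : K[X]) (x y : F), m ≤ 2 ∧ IsModel f x y ∧ Squarefree f ∧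
      f.natDegree = 2 * m ∧ f.leadingCoeff = d ∧ f.comp (- X) = f ∧ x ∉ P.ring ∧
      w x = x ∧ w y = - y ∧ u x = - x ∧ u y = (-1) ^ m * y := by
  obtain ⟨hσs, hs0, hσfix⟩ := quadratic_galois h2 hs hs' hσ
  have hrat : P.conj σ ≠ P := by
    intro h
    apply hP
    intro f a ha
    have h1 : OnePoint.map σ (P.eval f) = P.eval f := congrArg (fun Q => Q.eval f) h
    rw [ha, OnePoint.map_some] at h1
    exact hσfix a (OnePoint.coe_injective h1)
  have hw1 : w ≠ 1 := by
    rintro rfl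
    exact hrat (hwP.symm.trans rfl)
  have hne : u ≠ w := by
    rintro rfl
    exact hrat (hwP.symm.trans huP)
  have hu1 : u ≠ 1 := by
    -- With `u = 1`, the quotient by `u·w = w` would have both genus `1` and genus `0`.
    rintro rfl
    have := (one_mul w ▸ huw).2.unique hw.2
    norm_num at this
  have hcomm : ∀ h, u (w h) = w (u h) := by
    intro h
    have h1 := apply_apply_of_sq_eq_one huw.1 (w (u h))
    simp only [AlgEquiv.mul_apply, apply_apply_of_sq_eq_one hu, apply_apply_of_sq_eq_one hw.1] at h1
    exact h1
  obtain ⟨x, hxP, hwx, hux, hfix⟩ := CurvePoint.exists_coordinate h2 hw.1 hu hcomm hw1 hu1 hne θ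
    hσfix hwP huP
  have htr := transcendental_of_notMem P.algebraMap_mem hxP
  obtain ⟨f, y, H, hf, hwy⟩ := exists_isModel h2 hw.1 hw1 htr hwx hfix
  obtain ⟨ρ, hρ, huy, hev⟩ := H.even_of_apply_eq_neg hf hfix hwy hu hcomm hux
  obtain ⟨m, hm⟩ := (even_natDegree_of_comp_neg h2 hf.ne_zero hev).exists_two_nsmul
  rw [smul_eq_mul] at hm
  have hval := CurvePoint.eval_aeval_mul_inv_pow hxP f
  have hsq : aeval x f * x⁻¹ ^ f.natDegree = (y * x⁻¹ ^ m) ^ 2 := by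
    rw [← H.sq, hm]
    ring
  rw [hsq] at hval
  obtain ⟨β, hβ⟩ : y * x⁻¹ ^ m ∈ P.ring := mem_of_sq_mem ⟨_, hval⟩
  have hβ2 : β ^ 2 = algebraMap K L f.leadingCoeff := by
    have h1 := P.eval_mul _ _ _ _ hβ hβ
    rw [← sq, ← sq] at h1
    exact CurvePoint.eval_inj h1 hval
  have hlc : algebraMap K L f.leadingCoeff ≠ 0 :=
    (_root_.map_ne_zero _).mpr (leadingCoeff_ne_zero.mpr hf.ne_zero)
  have hβ0 : β ≠ 0 := by
    rintro rfl
    apply hlc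
    rw [← hβ2, zero_pow two_ne_zero]
  have hconst : ∀ (a : K) {h : F} {b : L}, P.eval h = (b : OnePoint L) →
      P.eval (algebraMap K F a * h) = ((algebraMap K L a * b : L) : OnePoint L) :=
    fun a h b hb => P.eval_mul _ _ _ _ (P.eval_algebraMap a) hb
  -- Here `w` negates `y/xᵐ`, and evaluating at `w(P)` conjugates the value.
  have hσβ : σ β = - β := by
    have h1 := P.eval_apply_of_image_eq_conj hwP hβ
    have h3 : w (y * x⁻¹ ^ m) = algebraMap K F (-1) * (y * x⁻¹ ^ m) := by
      rw [map_mul, map_pow, map_inv₀, hwx, hwy, map_neg, map_one]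
      ring
    rw [h3, hconst _ hβ] at h1
    rw [← OnePoint.coe_injective h1, map_neg, map_one, neg_one_mul]
  obtain ⟨k, hk⟩ := hσfix (β / s) (by rw [map_div₀, hσβ, hσs, neg_div_neg_eq])
  have hks : β = algebraMap K L k * s := by
    change algebraMap K L k = β / s at hk
    rw [hk, div_mul_cancel₀ _ hs0]
  have hk0 : k ≠ 0 := by
    rintro rfl
    apply hβ0
    rw [hks, map_zero, zero_mul]
  have hkF : algebraMap K F k ≠ 0 := (_root_.map_ne_zero _).mpr hk0
  have hlck : f.leadingCoeff = k ^ 2 * d := by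
    apply (algebraMap K L).injective
    rw [← hβ2, hks, mul_pow, hs, map_mul, map_pow]
  -- Since `u` fixes `P`, the factor `ρ (-1)ᵐ` by which it multiplies `y/xᵐ` must be `1`, the value
  -- `β` being nonzero.
  have hρm : ρ = (-1) ^ m := by
    have h1 := P.eval_apply_of_image_eq huP (y * x⁻¹ ^ m)
    have h3 : u (y * x⁻¹ ^ m) = algebraMap K F (ρ * (-1) ^ m) * (y * x⁻¹ ^ m) := by
      rw [map_mul, map_pow, map_inv₀, hux, huy, map_mul, map_pow, map_neg, map_one, inv_neg,
        neg_pow x⁻¹]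
      ring
    rw [h3, hconst _ hβ, hβ] at h1
    have h4 := OnePoint.coe_injective h1
    have h5 : algebraMap K L (ρ * (-1) ^ m) = algebraMap K L 1 := by
      apply mul_right_cancel₀ hβ0
      rw [h4, map_one, one_mul]
    have h6 := (algebraMap K L).injective h5
    have h7 : ((-1 : K) ^ m) * (-1) ^ m = 1 := by rw [← mul_pow]; simp
    calc ρ = ρ * (-1) ^ m * (-1) ^ m := by rw [mul_assoc, h7, mul_one]
      _ = (-1) ^ m := by rw [h6, one_mul]
  have hd0 : d ≠ 0 := by
    rintro rfl
    rw [map_zero] at hs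
    exact hs0 (pow_eq_zero_iff two_ne_zero |>.mp hs)
  have hc0 : (k ^ 2)⁻¹ ≠ 0 := inv_ne_zero (pow_ne_zero 2 hk0)
  have hsf : Squarefree (C (k ^ 2)⁻¹ * f) :=
    fun r hr => hf r ((isUnit_C.mpr hc0.isUnit).dvd_mul_left.mp hr)
  have H' : IsModel (C (k ^ 2)⁻¹ * f) x (algebraMap K F k⁻¹ * y) := by
    refine ⟨htr, ?_, ?_⟩
    · rw [mul_pow, H.sq, map_mul, aeval_C, ← map_pow, inv_pow]
    · rw [eq_top_iff, ← H.adjoin_eq_top, adjoin_le_iff]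
      rintro z (rfl | rfl)
      · exact subset_adjoin _ _ (Set.mem_insert _ _)
      · have h1 := mul_mem (IntermediateField.algebraMap_mem _ k)
          (subset_adjoin K _ (Set.mem_insert_of_mem x
            (Set.mem_singleton (algebraMap K F k⁻¹ * z))))
        rwa [← mul_assoc, ← map_mul, mul_inv_cancel₀ hk0, map_one, one_mul] at h1
  have hdeg : (C (k ^ 2)⁻¹ * f).natDegree = 2 * m := by rw [natDegree_C_mul hc0, hm]
  have hwy' : w (algebraMap K F k⁻¹ * y) = - (algebraMap K F k⁻¹ * y) := by
    rw [map_mul, w.commutes, hwy, mul_neg]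
  refine ⟨hd0, m, _, x, _, H'.le_two_of_hasGenus_one h2 hfin hg hsf hdeg hwx hwy' hP hwP hxP, H',
    hsf, hdeg, ?_, ?_, hxP, hwx, hwy', hux, ?_⟩
  · rw [leadingCoeff_mul, leadingCoeff_C, hlck]
    field_simp
  · rw [mul_comp, C_comp, hev]
  · rw [map_mul, u.commutes, huy, hρm, map_pow, map_neg, map_one]
    ring

end Points

/-! ### Biquadratic equations and the quotient by `u·w` -/

section Equations

variable {K F : Type*} [Field K] [Field F] [Algebra K F]

/-- `IsEquation` does not demand that `x` be transcendental; this supplies what `IsModel` needs. -/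
lemma transcendental_of_adjoin_eq_top {f : K[X]} {x y t : F} (hxy : y ^ 2 = aeval x f)
    (htop : adjoin K {x, y} = ⊤) (ht : Transcendental K t) : Transcendental K x := by
  intro hx
  apply ht
  have hx' : x ∈ algebraicClosure K F := hx.isIntegral
  have hy : y ∈ algebraicClosure K F := by
    have h1 : aeval x f ∈ algebraicClosure K F := by
      rw [aeval_eq_sum_range]
      exact sum_mem fun i _ => IntermediateField.smul_mem _ (pow_mem hx' i)
    rw [← hxy] at h1
    exact IsIntegral.of_pow two_pos h1
  have h1 : adjoin K {x, y} ≤ algebraicClosure K F := by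
    rw [adjoin_le_iff]
    rintro z (rfl | rfl)
    exacts [hx', hy]
  rw [htop] at h1
  exact IsIntegral.isAlgebraic (h1 (mem_top (x := t)))

lemma separable_biquadratic {b c d : K} (h2 : (2 : K) ≠ 0) (hc : c ≠ 0)
    (hbc : b ^ 2 - 4 * (d * c) ≠ 0) : (C d * X ^ 4 + C b * X ^ 2 + C c).Separable := by
  have h0 : (b ^ 2 - 4 * (d * c)) * c ≠ 0 := mul_ne_zero hbc hc
  obtain ⟨D, hD⟩ : ∃ D, D = b ^ 2 - 4 * (d * c) := ⟨_, rfl⟩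
  have hder : derivative (C d * X ^ 4 + C b * X ^ 2 + C c) = C d * (4 * X ^ 3) + C b * (2 * X) := by
    simp only [derivative_add, derivative_C_mul, derivative_X_pow, derivative_C, add_zero]
    norm_num [map_ofNat]
  have hhalf : (2 : K[X]) * C (2⁻¹) = 1 := by
    rw [← map_ofNat C 2, ← C_mul, mul_inv_cancel₀ h2, C_1]
  have hinv : C ((D * c)⁻¹) * (C D * C c) = 1 := by
    rw [← C_mul, ← C_mul, inv_mul_cancel₀ (by rwa [hD]), C_1]
  have hDC : (C D : K[X]) = C b ^ 2 - 4 * (C d * C c) := by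
    rw [hD]
    simp only [map_sub, map_mul, map_pow, map_ofNat]
  -- These Bézout coefficients come from completing the square, `4d f = (2d X² + b)² - D`, together
  -- with `f = X (d X³ + b X) + c`.
  refine ⟨C ((D * c)⁻¹) * (C D + 4 * C d * X * (C d * X ^ 3 + C b * X)),
    - (C ((D * c)⁻¹) * ((C d * X ^ 3 + C b * X) * (C b * C (2⁻¹) + C d * X ^ 2))), ?_⟩
  rw [hder, ← hinv, hDC]
  linear_combination (- C ((D * c)⁻¹) * (C d * X ^ 3 + C b * X) * C b * X *
    (2 * C d * X ^ 2 + C b)) * hhalf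

lemma biquadratic_coeff_ne_zero {b c d : K} (h2 : (2 : K) ≠ 0) (hd : d ≠ 0)
    (hf : Squarefree (C d * X ^ 4 + C b * X ^ 2 + C c)) : c ≠ 0 ∧ b ^ 2 - 4 * (d * c) ≠ 0 := by
  constructor
  · rintro rfl
    refine not_isUnit_X (hf X ⟨C d * X ^ 2 + C b, ?_⟩)
    rw [C_0]
    ring
  · intro h
    have h4 : (4 : K) ≠ 0 := by
      have : (4 : K) = 2 * 2 := by norm_num
      rw [this]
      exact mul_ne_zero h2 h2
    have h1 : IsUnit (C (2 * d) * X ^ 2 + C b) := by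
      refine hf _ ⟨C ((4 * d)⁻¹), ?_⟩
      have hinv : C ((4 * d)⁻¹) * (4 * C d) = 1 := by
        rw [← map_ofNat C 4, ← C_mul, ← C_mul, inv_mul_cancel₀ (mul_ne_zero h4 hd), C_1]
      have h' := congrArg C h
      simp only [map_sub, map_mul, map_pow, map_ofNat, map_zero] at h'
      rw [C_mul, map_ofNat]
      linear_combination (- (C d * X ^ 4 + C b * X ^ 2 + C c)) * hinv - C ((4 * d)⁻¹) * h'
    have h3 := natDegree_eq_zero_of_isUnit h1
    have h5 : (C (2 * d) * X ^ 2 + C b).natDegree = 2 := by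
      have := mul_ne_zero h2 hd
      compute_degree!
    omega

/-- On the conic, `x²` lies in `K(y)`, so the quotient has the rational function field `K(y)`. -/
lemma not_isEquation_of_natDegree_two (h2 : (2 : K) ≠ 0) {A B : K}
    (hAB : 4 * A ^ 3 + 27 * B ^ 2 ≠ 0) {v : F ≃ₐ[K] F} {d c : K} {x y : F}
    (hy : Transcendental K y) (hd : d ≠ 0) (hvx : v x = - x) (hvy : v y = y)
    (hxy : y ^ 2 = algebraMap K F d * x ^ 2 + algebraMap K F c) (htop : adjoin K {x, y} = ⊤) :
    ¬ IsEquation K (quotientField v) (cubic A B) := by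
  have hdF : algebraMap K F d ≠ 0 := (_root_.map_ne_zero _).mpr hd
  have hq : quotientField v = K⟮y⟯ := by
    have hymem := mem_adjoin_simple_self K y
    refine quotientField_eq_of_sq_mem h2 (by rwa [adjoin_simple_le_iff, mem_quotientField]) hvx ?_
      htop ?_
    · have h1 : x ^ 2 = (y ^ 2 - algebraMap K F c) / algebraMap K F d := by
        field_simp
        linear_combination - hxy
      rw [h1]
      exact div_mem (sub_mem (pow_mem hymem 2) (IntermediateField.algebraMap_mem _ c))
        (IntermediateField.algebraMap_mem _ d)
    · rintro z (rfl | rfl)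
      · exact mem_adjoin_simple_self _ z
      · exact IntermediateField.algebraMap_mem K⟮z⟯⟮x⟯ ⟨z, hymem⟩
  rintro ⟨-, -, U, V, hUV, hUVtop⟩
  have ht : Transcendental K (⟨y, mem_quotientField.mpr hvy⟩ : quotientField v) := fun h =>
    hy ((isAlgebraic_algHom_iff (quotientField v).val
      (quotientField v).val.toRingHom.injective).mpr h)
  have H : IsModel (cubic A B) U V :=
    ⟨transcendental_of_adjoin_eq_top hUV hUVtop ht, hUV, hUVtop⟩
  exact not_isModel_cubic_ratFunc h2 hAB
    (H.map ((equivOfEq hq).trans (RatFunc.algEquivOfTranscendental y hy).symm))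

/-- The quotient of `y² = d x⁴ + b x² + c` by `(x, y) ↦ (-x, -y)`. -/
lemma exists_isModel_quotientField (h2 : (2 : K) ≠ 0) {v : F ≃ₐ[K] F} {d u₀ c : K} {x y : F}
    (hx : Transcendental K x) (hd : d ≠ 0) (hvx : v x = - x) (hvy : v y = - y)
    (hxy : y ^ 2 = algebraMap K F d * x ^ 4 + algebraMap K F (3 * u₀) * x ^ 2 + algebraMap K F c)
    (htop : adjoin K {x, y} = ⊤) :
    ∃ X₁ Y₁ : quotientField v, IsModel
      (cubic (d * c - 3 * u₀ ^ 2) (- (u₀ * (d * c - 2 * u₀ ^ 2)))) X₁ Y₁ := by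
  have hdF : algebraMap K F d ≠ 0 := (_root_.map_ne_zero _).mpr hd
  have hx0 : x ≠ 0 := by
    rintro rfl
    exact hx (isAlgebraic_zero)
  -- Multiplying the quartic equation by `d² x²` gives a monic cubic in `d x²`; the shift by `u₀`
  -- removes its quadratic term.
  obtain ⟨X₁, hX₁⟩ : ∃ X₁, X₁ = algebraMap K F d * x ^ 2 + algebraMap K F u₀ := ⟨_, rfl⟩
  obtain ⟨Y₁, hY₁⟩ : ∃ Y₁, Y₁ = algebraMap K F d * x * y := ⟨_, rfl⟩
  have hXmem : X₁ ∈ adjoin K {X₁, Y₁} := subset_adjoin _ _ (Set.mem_insert _ _)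
  have hYmem : Y₁ ∈ adjoin K {X₁, Y₁} := subset_adjoin _ _ (Set.mem_insert_of_mem _ rfl)
  have hX : X₁ ∈ quotientField v := by
    rw [mem_quotientField, hX₁, map_add, map_mul, map_pow, hvx, v.commutes, v.commutes, neg_sq]
  have hY : Y₁ ∈ quotientField v := by
    rw [mem_quotientField, hY₁, map_mul, map_mul, hvx, hvy, v.commutes]
    ring
  have hsq : x ^ 2 = (X₁ - algebraMap K F u₀) / algebraMap K F d := by
    rw [hX₁]
    field_simp
    ring
  have hsqmem : x ^ 2 ∈ adjoin K {X₁, Y₁} := by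
    rw [hsq]
    exact div_mem (sub_mem hXmem (IntermediateField.algebraMap_mem _ _))
      (IntermediateField.algebraMap_mem _ _)
  have hq : quotientField v = adjoin K {X₁, Y₁} := by
    refine quotientField_eq_of_sq_mem h2 ?_ hvx hsqmem htop ?_
    · rw [adjoin_le_iff]
      rintro z (rfl | rfl)
      exacts [hX, hY]
    · rintro z (rfl | rfl)
      · exact mem_adjoin_simple_self _ z
      · have h1 : z = Y₁ / (algebraMap K F d * x) := by
          rw [hY₁]
          field_simp
        rw [h1]
        exact div_mem (IntermediateField.algebraMap_mem (adjoin K {X₁, Y₁})⟮x⟯ ⟨Y₁, hYmem⟩)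
          (mul_mem (IntermediateField.algebraMap_mem (adjoin K {X₁, Y₁})⟮x⟯
            ⟨_, IntermediateField.algebraMap_mem _ d⟩) (mem_adjoin_simple_self _ x))
  have hXtr : Transcendental K X₁ := by
    intro h
    apply hx
    refine IsAlgebraic.of_pow two_pos ?_
    rw [hsq, div_eq_mul_inv]
    exact (h.sub (isAlgebraic_algebraMap _)).mul (isAlgebraic_algebraMap _).inv
  refine ⟨⟨X₁, hX⟩, ⟨Y₁, hY⟩, fun h => hXtr ((isAlgebraic_algHom_iff (quotientField v).val
    (quotientField v).val.toRingHom.injective).mpr h), ?_, ?_⟩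
  · apply Subtype.ext
    have h1 := aeval_algHom_apply (quotientField v).val ⟨X₁, hX⟩
      (cubic (d * c - 3 * u₀ ^ 2) (- (u₀ * (d * c - 2 * u₀ ^ 2))))
    refine Eq.trans ?_ h1
    change Y₁ ^ 2 = aeval X₁ _
    simp only [cubic, map_add, map_mul, map_neg, map_sub, map_pow, map_ofNat, aeval_X, aeval_C,
      hX₁, hY₁] at hxy ⊢
    linear_combination (algebraMap K F d * x) ^ 2 * hxy
  · rw [eq_top_iff]
    rintro h -
    have h1 := adjoin_map K {(⟨X₁, hX⟩ : quotientField v), ⟨Y₁, hY⟩} (quotientField v).val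
    rw [Set.image_pair] at h1
    have h3 : (h : F) ∈ adjoin K {X₁, Y₁} := by
      rw [← hq]
      exact h.2
    change (h : F) ∈ adjoin K {(quotientField v).val ⟨X₁, hX⟩, (quotientField v).val ⟨Y₁, hY⟩} at h3
    rw [← h1] at h3
    obtain ⟨z, hz, hzh⟩ := h3
    have : z = h := Subtype.ext hzh
    rwa [← this]

end Equations

/-! ### Assembly of the theorem -/

section Main

open WeierstrassCurve WeierstrassCurve.Affine

variable {K F : Type*} [Field K] [Field F] [Algebra K F]

lemma isJacobianRoot_of_equation (h2 : (2 : K) ≠ 0) {A B u d : K}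
    [(shortWeierstrass A B).IsElliptic] (hu : u ^ 3 + A * u + B = 0) (hd : d ≠ 0) {x y : F}
    (hxy : y ^ 2 = algebraMap K F d * x ^ 4 + algebraMap K F (3 * u) * x ^ 2 +
      algebraMap K F ((A + 3 * u ^ 2) / d)) (htop : adjoin K {x, y} = ⊤) :
    IsJacobianRoot F A B u := by
  obtain ⟨hc, hbc⟩ := discr_factor_ne_zero hu
  have hdc : d * ((A + 3 * u ^ 2) / d) = A + 3 * u ^ 2 := mul_div_cancel₀ _ hd
  have heq : ((shortWeierstrass A B).baseChange K).Equation u 0 := by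
    rw [equation_shortWeierstrass]
    simp [cubic, hu]
  have : ((shortWeierstrass A B).baseChange K).IsElliptic :=
    inferInstanceAs ((shortWeierstrass A B).map (algebraMap K K)).IsElliptic
  have hJ := isJacobian_isogenousCurve h2 hd (hdc.symm ▸ hc) (hdc.symm ▸ hbc) hxy htop
  rw [hdc] at hJ
  exact ⟨hu, equation_iff_nonsingular.mp heq, isogenousCurve (3 * u) (A + 3 * u ^ 2),
    isElliptic_isogenousCurve h2 hc hbc, isQuotientBy_isogenousCurve h2 hu _, hJ⟩

theorem exists_isJacobianRoot {L : Type*} [Field L] [Algebra K L] [FiniteDimensional K L]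
    (h2 : (2 : K) ≠ 0) (h3 : (3 : K) ≠ 0) (hC : IsCurve K F) (hg : HasGenus K F 1)
    {w u : F ≃ₐ[K] F} (hw : IsInvolution 0 w) (hu : u ^ 2 = 1) (huw : IsInvolution 1 (u * w))
    (θ : quotientField w ≃ₐ[K] RatFunc K) {d : K} {s : L} (hs : s ^ 2 = algebraMap K L d)
    (hs' : adjoin K {s} = ⊤) {σ : L ≃ₐ[K] L} (hσ : σ ≠ 1) {P : CurvePoint K F L}
    (hP : ¬ P.IsRational) (hwP : P.image w = P.conj σ) (huP : P.image u = P) {A' B' : K}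
    [(shortWeierstrass A' B').IsElliptic]
    (hC' : IsEquation K (quotientField (u * w)) (cubic A' B')) :
    ∃ u₀ : K, IsJacobianRoot F A' B' u₀ ∧
      IsEquation K F (C d * X ^ 4 + C (3 * u₀) * X ^ 2 + C ((A' + 3 * u₀ ^ 2) / d)) := by
  obtain ⟨hd, m, f, x, y, hm2, H, hf, hdeg, hlc, hev, hxP, hwx, hwy, hux, huy⟩ :=
    exists_normalForm h2 hC.exists_finite hg hw hu huw θ hs hs' hσ hP hwP huP
  have hAB := discr_ne_zero (A := A') (B := B')
  have hvx : (u * w) x = - x := by rw [AlgEquiv.mul_apply, hwx, hux]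
  have hvy : (u * w) y = - ((-1) ^ m * y) := by rw [AlgEquiv.mul_apply, hwy, map_neg, huy]
  have hsum := f.as_sum_range_C_mul_X_pow
  have hlc' : f.coeff (2 * m) = d := by rw [← hdeg]; exact hlc
  have hV := P.algebraMap_mem
  have hodd : ∀ {n : ℕ}, Odd n → f.coeff n = 0 := fun hn => coeff_eq_zero_of_comp_neg h2 hev hn
  rw [hdeg] at hsum
  interval_cases m
  -- For `m = 0`, `y` is algebraic over `K`, hence a constant fixed by `w`.
  · simp only [mul_zero, zero_add, Finset.sum_range_one, pow_zero, mul_one] at hsum hlc'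
    exfalso
    have h1 : y ^ 2 = algebraMap K F d := by rw [H.sq, hsum, hlc', aeval_C]
    have hy : y ∈ algebraicClosure K F := by
      refine IsIntegral.of_pow two_pos ?_
      rw [h1]
      exact isIntegral_algebraMap
    rw [hC.algClosed, mem_bot] at hy
    obtain ⟨a, rfl⟩ := hy
    rw [w.commutes] at hwy
    have h4 : algebraMap K F a = 0 :=
      mul_left_cancel₀ (two_ne_zero_of_algebra F h2) (by linear_combination hwy)
    rw [h4, zero_pow two_ne_zero] at h1
    exact (_root_.map_ne_zero (algebraMap K F)).mpr hd h1.symm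
  · exfalso
    simp only [mul_one] at hlc'
    simp only [mul_one, Finset.sum_range_succ, Finset.sum_range_zero, zero_add, hlc',
      hodd odd_one, pow_zero, C_0, zero_mul, add_zero] at hsum
    refine not_isEquation_of_natDegree_two (c := f.coeff 0) h2 hAB ?_ hd hvx (by rw [hvy]; ring)
      ?_ H.adjoin_eq_top hC'
    · refine transcendental_of_notMem hV fun hy => hxP ?_
      have h1 := pow_mem hy 2
      rw [H.sq, ← P.ring.valuation_le_one_iff, valuation_aeval hV hxP hf.ne_zero, hdeg, mul_one,
        ← map_pow, P.ring.valuation_le_one_iff] at h1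
      exact mem_of_sq_mem h1
    · rw [H.sq]
      conv_lhs => rw [hsum]
      simp only [map_add, map_mul, map_pow, aeval_C, aeval_X]
      ring
  · norm_num at hlc'
    norm_num [Finset.sum_range_succ, hlc', hodd odd_one, hodd (show Odd 3 by decide)] at hsum
    obtain ⟨u₀, hu₀⟩ : ∃ u₀, f.coeff 2 = 3 * u₀ := ⟨f.coeff 2 / 3, by field_simp⟩
    obtain ⟨c, hc⟩ : ∃ c, f.coeff 0 = c := ⟨_, rfl⟩
    rw [hu₀, hc] at hsum
    have hform : f = C d * X ^ 4 + C (3 * u₀) * X ^ 2 + C c := by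
      rw [hsum]
      ring
    have hsq := H.sq
    rw [hform] at hf hsq
    simp only [map_add, map_mul, map_pow, aeval_C, aeval_X] at hsq
    obtain ⟨hc0, hbc⟩ := biquadratic_coeff_ne_zero h2 hd hf
    rw [even_two.neg_one_pow, one_mul] at hvy
    obtain ⟨X₁, Y₁, H₁⟩ := exists_isModel_quotientField (u₀ := u₀) (c := c) h2 H.transcendental hd
      hvx hvy (by rw [map_mul]; exact hsq) H.adjoin_eq_top
    obtain ⟨-, -, U, V, hUV, hUVtop⟩ := hC'
    have H₂ : IsModel (cubic A' B') U V :=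
      ⟨transcendental_of_adjoin_eq_top hUV hUVtop H₁.transcendental, hUV, hUVtop⟩
    have hAB₁ : 4 * (d * c - 3 * u₀ ^ 2) ^ 3 + 27 * (- (u₀ * (d * c - 2 * u₀ ^ 2))) ^ 2 ≠ 0 := by
      have h1 : 4 * (d * c - 3 * u₀ ^ 2) ^ 3 + 27 * (- (u₀ * (d * c - 2 * u₀ ^ 2))) ^ 2 =
          - ((3 * u₀) ^ 2 - 4 * (d * c)) * (d * c) ^ 2 := by ring
      rw [h1]
      exact mul_ne_zero (neg_ne_zero.mpr hbc) (pow_ne_zero 2 (mul_ne_zero hd hc0))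
    -- The scaling factor `k` is absorbed by `(x, y) ↦ (kx, k²y)`, which keeps the leading
    -- coefficient `d`, turns `u₀` into `k²u₀` and `c` into `k⁴c`.
    obtain ⟨k, hk, hA, hB⟩ := IsModel.scaling h2 h3 hAB₁ hAB H₁ H₂
    have hkF : algebraMap K F k ≠ 0 := (_root_.map_ne_zero _).mpr hk
    have hc₁ : (A' + 3 * (k ^ 2 * u₀) ^ 2) / d = k ^ 4 * c := by
      rw [hA]
      field_simp
      ring
    have hroot : (k ^ 2 * u₀) ^ 3 + A' * (k ^ 2 * u₀) + B' = 0 := by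
      rw [hA, hB]
      ring
    have htop : adjoin K {algebraMap K F k * x, algebraMap K F k ^ 2 * y} = ⊤ := by
      rw [eq_top_iff, ← H.adjoin_eq_top, adjoin_le_iff]
      have h1 := IntermediateField.algebraMap_mem
        (adjoin K {algebraMap K F k * x, algebraMap K F k ^ 2 * y}) k
      rintro z (rfl | rfl)
      · have h4 := mul_mem (inv_mem h1) (subset_adjoin K _
          (Set.mem_insert (algebraMap K F k * z) {algebraMap K F k ^ 2 * y}))
        rwa [inv_mul_cancel_left₀ hkF] at h4
      · have h4 := mul_mem (inv_mem (pow_mem h1 2)) (subset_adjoin K _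
          (Set.mem_insert_of_mem (algebraMap K F k * x)
            (Set.mem_singleton (algebraMap K F k ^ 2 * z))))
        rwa [inv_mul_cancel_left₀ (pow_ne_zero 2 hkF)] at h4
    have hxy : (algebraMap K F k ^ 2 * y) ^ 2 = algebraMap K F d * (algebraMap K F k * x) ^ 4 +
        algebraMap K F (3 * (k ^ 2 * u₀)) * (algebraMap K F k * x) ^ 2 +
        algebraMap K F ((A' + 3 * (k ^ 2 * u₀) ^ 2) / d) := by
      rw [hc₁]
      simp only [map_mul, map_pow]
      linear_combination algebraMap K F k ^ 4 * hsq
    refine ⟨k ^ 2 * u₀, isJacobianRoot_of_equation h2 hroot hd hxy htop, Or.inr ?_,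
      separable_biquadratic h2 ?_ ?_, _, _, ?_, htop⟩
    · compute_degree!
    · rw [hc₁]
      exact mul_ne_zero (pow_ne_zero 4 hk) hc0
    · rw [mul_div_cancel₀ _ hd]
      exact (discr_factor_ne_zero hroot).2
    · rw [hxy]
      simp only [map_add, map_mul, map_pow, aeval_C, aeval_X]

end Main

end GenusOne

theorem mainTheorem8 {K F L : Type*} [Field K] [Field F] [Algebra K F] [Field L] [Algebra K L]
    (h2 : (2 : K) ≠ 0) (h3 : (3 : K) ≠ 0)
    -- the curve `C` of genus one and its involutions `w`, `u`
    (hC : GenusOne.IsCurve K F) (hg : GenusOne.HasGenus K F 1)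
    (w u : F ≃ₐ[K] F)
    (hw : GenusOne.IsInvolution 0 w) (hu : GenusOne.IsInvolution 0 u)
    (hwP : Nonempty (GenusOne.quotientField w ≃ₐ[K] RatFunc K))
    (huw : GenusOne.IsInvolution 1 (u * w))
    -- the quadratic extension `L = K(√d)` and the point `P`
    (d : K) (hL : Module.finrank K L = 2)
    (hd : ∃ s : L, s ^ 2 = algebraMap K L d ∧ IntermediateField.adjoin K {s} = ⊤)
    (σ : L ≃ₐ[K] L) (hσ : σ ≠ 1)
    (P : GenusOne.CurvePoint K F L) (hP : ¬ P.IsRational)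
    (hwPσ : P.image w = P.conj σ) (huP : P.image u = P)
    -- the equation of the elliptic curve `C' = C/⟨u·w⟩`
    (A' B' : K) [(GenusOne.shortWeierstrass A' B').IsElliptic]
    (hC' : GenusOne.IsEquation K (GenusOne.quotientField (u * w))
      (Polynomial.X ^ 3 + Polynomial.C A' * Polynomial.X + Polynomial.C B')) :
    (∃ u₀ : K, GenusOne.IsJacobianRoot F A' B' u₀ ∧
      GenusOne.IsEquation K F
        (Polynomial.C d * Polynomial.X ^ 4 + Polynomial.C (3 * u₀) * Polynomial.X ^ 2 +
          Polynomial.C ((A' + 3 * u₀ ^ 2) / d))) ∧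
    ∀ u₀ : K, GenusOne.IsJacobianRoot F A' B' u₀ →
      (∀ u₁ : K, GenusOne.IsJacobianRoot F A' B' u₁ → u₁ = u₀) →
      GenusOne.IsEquation K F
        (Polynomial.C d * Polynomial.X ^ 4 + Polynomial.C (3 * u₀) * Polynomial.X ^ 2 +
          Polynomial.C ((A' + 3 * u₀ ^ 2) / d)) := by
  have : FiniteDimensional K L := Module.finite_of_finrank_pos (by omega)
  obtain ⟨θ⟩ := hwP
  obtain ⟨s, hs, hs'⟩ := hd
  obtain ⟨u₁, hu₁, heq⟩ :=
    GenusOne.exists_isJacobianRoot h2 h3 hC hg hw hu.1 huw θ hs hs' hσ hP hwPσ huP hC'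
  refine ⟨⟨u₁, hu₁, heq⟩, fun u₀ _ huniq => ?_⟩
  rwa [← huniq u₁ hu₁]
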